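/- Let $n\ge 2$, let $X=S^2\times S^{2n-3}$, and let $E=TX\oplus\underline{\mathbb R}$, a real vector bundle of rank $2n$. A trivialization of $E$ is a vector bundle isomorphism $E\to X\times\mathbb R^{2n}$; the set of trivializations carries the compact-open topology, and $\pi_0\mathrm{Triv}(E)$ denotes its set of path components (homotopy classes of trivializations). Homotopy groups of $O(2n)$ are based at the identity. Then: (1) There is a bijection $\pi_0\mathrm{Triv}(E)\cong\pi_{2n-3}(O(2n))\times\pi_{2n-1}(O(2n))$. (2) The identification is natural once a reference trivialization is chosen, in the following sense. Fix identifications $I^2/\partial I^2\cong S^2$ and $I^{2n-3}/\partial I^{2n-3}\cong S^{2n-3}$, and hence $I^{2n-1}/\partial I^{2n-1}\cong S^2\wedge S^{2n-3}$, and fix a trivialization $\tau_0$ of $E$. For $a\in\pi_{2n-3}(O(2n))$ and $b\in\pi_{2n-1}(O(2n))$ represented by based maps $\alpha\colon S^{2n-3}\to O(2n)$ and $\beta\colon S^2\wedge S^{2n-3}\to O(2n)$, let $\Phi_{\tau_0}(a,b)$ be the class of the trivialization obtained from $\tau_0$ by applying, in the fibre over $(x,y)$, the matrix $\alpha(y)\,\beta(x\wedge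 y)\in O(2n)$. Then $\Phi_{\tau_0}$ is a well-defined bijection from $\pi_{2n-3}(O(2n))\times\pi_{2n-1}(O(2n))$ onto the set of homotopy classes of trivializations that induce the same orientation of $E$ as $\tau_0$. -/

import Mathlib

open scoped Topology Manifold unitInterval Matrix Topology.Homotopy
open Bundle

noncomputable section

namespace SphereFraming

/-- Euclidean space `ℝ^m`. -/
abbrev E (m : ℕ) : Type := EuclideanSpace ℝ (Fin m)

/-- The unit sphere `S^m` in `ℝ^(m+1)`. -/
abbrev Sph (m : ℕ) : Type := Metric.sphere (0 : E (m + 1)) 1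

/-- The product manifold `S^2 × S^(2n-3)` (used for `2 ≤ n`). -/
abbrev SphProd (n : ℕ) : Type := Sph 2 × Sph (2 * n - 3)

/-- The fibres of `T(S^2 × S^(2n-3)) ⊕ ℝ`, the direct sum of the tangent bundle and the trivial
line bundle. -/
abbrev StableTangent (n : ℕ) : SphProd n → Type :=
  (fun x => TangentSpace ((𝓡 2).prod (𝓡 (2 * n - 3))) x) ×ᵇ Bundle.Trivial (SphProd n) ℝ

/-- The total space of `T(S^2 × S^(2n-3)) ⊕ ℝ`, with its topology as a Whitney sum. -/
abbrev StableTotal (n : ℕ) : Type :=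
  TotalSpace ((E 2 × E (2 * n - 3)) × ℝ) (StableTangent n)

/-- A trivialization of `T(S^2 × S^(2n-3)) ⊕ ℝ`: an isomorphism of vector bundles onto the product
bundle with fibre `ℝ^(2n)`. -/
@[ext]
structure StableTriv (n : ℕ) where
  fiberEquiv : ∀ x : SphProd n, StableTangent n x ≃ₗ[ℝ] E (2 * n)
  continuous_toFun : Continuous fun v : StableTotal n => fiberEquiv v.1 v.2
  continuous_invFun : Continuous fun w : SphProd n × E (2 * n) =>
    (⟨w.1, (fiberEquiv w.1).symm w.2⟩ : StableTotal n)

namespace StableTriv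

/-- The fibre coordinate of a trivialization, as a continuous map on the total space. -/
def toContinuousMap {n : ℕ} (τ : StableTriv n) : C(StableTotal n, E (2 * n)) where
  toFun v := τ.fiberEquiv v.1 v.2
  continuous_toFun := τ.continuous_toFun

/-- The space of trivializations carries the compact-open topology. -/
instance (n : ℕ) : TopologicalSpace (StableTriv n) :=
  TopologicalSpace.induced toContinuousMap inferInstance

end StableTriv

/-- The orthogonal group `O(m)`, a topological group of matrices. -/
abbrev O (m : ℕ) : Type := Matrix.orthogonalGroup (Fin m) ℝ

/-- The linear automorphism of `ℝ^m` given by an orthogonal matrix. -/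
def orthEquiv {m : ℕ} (A : O m) : E m ≃ₗ[ℝ] E m :=
  LinearEquiv.ofLinearMap (Matrix.toEuclideanLin (A : Matrix (Fin m) (Fin m) ℝ))
    (Matrix.toEuclideanLin ((A⁻¹ : O m) : Matrix (Fin m) (Fin m) ℝ))
    (by
      ext1 v
      simp only [LinearMap.comp_apply, Matrix.toLpLin_apply, Matrix.mulVec_mulVec, ← Submonoid.coe_mul,
        mul_inv_cancel]
      simp)
    (by
      ext1 v
      simp only [LinearMap.comp_apply, Matrix.toLpLin_apply, Matrix.mulVec_mulVec, ← Submonoid.coe_mul,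
        inv_mul_cancel]
      simp)

theorem orthEquiv_apply {m : ℕ} (A : O m) (v : E m) :
    orthEquiv A v = WithLp.toLp 2 ((A : Matrix (Fin m) (Fin m) ℝ) *ᵥ v.ofLp) := rfl

theorem orthEquiv_symm_apply {m : ℕ} (A : O m) (v : E m) :
    (orthEquiv A).symm v =
      WithLp.toLp 2 (((A⁻¹ : O m) : Matrix (Fin m) (Fin m) ℝ) *ᵥ v.ofLp) := rfl

/-- The trivialization `f · τ`, obtained from `τ` by applying in the fibre over `x` the orthogonal
matrix `f x`. -/
def StableTriv.twist {n : ℕ} (f : C(SphProd n, O (2 * n))) (τ : StableTriv n) : StableTriv n where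
  fiberEquiv x := (τ.fiberEquiv x).trans (orthEquiv (f x))
  continuous_toFun := by
    have h1 : Continuous fun v : StableTotal n => (f v.1 : Matrix (Fin (2 * n)) (Fin (2 * n)) ℝ) :=
      continuous_subtype_val.comp (f.continuous.comp
        (FiberBundle.continuous_proj ((E 2 × E (2 * n - 3)) × ℝ) (StableTangent n)))
    have h2 := (PiLp.continuous_ofLp 2 (fun _ : Fin (2 * n) => ℝ)).comp τ.continuous_toFun
    exact (PiLp.continuous_toLp 2 (fun _ : Fin (2 * n) => ℝ)).comp (h1.matrix_mulVec h2)
  continuous_invFun := by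
    have h1 : Continuous fun w : SphProd n × E (2 * n) =>
        (((f w.1)⁻¹ : O (2 * n)) : Matrix (Fin (2 * n)) (Fin (2 * n)) ℝ) :=
      continuous_subtype_val.comp ((f.continuous.comp continuous_fst).inv)
    have h2 : Continuous fun w : SphProd n × E (2 * n) => w.2.ofLp :=
      (PiLp.continuous_ofLp 2 (fun _ : Fin (2 * n) => ℝ)).comp continuous_snd
    have h3 : Continuous fun w : SphProd n × E (2 * n) => (orthEquiv (f w.1)).symm w.2 :=
      (PiLp.continuous_toLp 2 (fun _ : Fin (2 * n) => ℝ)).comp (h1.matrix_mulVec h2)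
    exact τ.continuous_invFun.comp (continuous_fst.prodMk h3)

/-- Two trivializations induce the same orientation of the bundle: in every fibre, the transition
automorphism of `ℝ^(2n)` has positive determinant. -/
def StableTriv.SameOrientation {n : ℕ} (τ₀ τ : StableTriv n) : Prop :=
  ∀ x : SphProd n,
    0 < LinearMap.det (((τ₀.fiberEquiv x).symm.trans (τ.fiberEquiv x) :
      E (2 * n) ≃ₗ[ℝ] E (2 * n)) : E (2 * n) →ₗ[ℝ] E (2 * n))

/-- A continuous map `I^m → S^m` that exhibits `S^m` as the cube with its boundary collapsed to a
point. -/
def IsCollapse {m : ℕ} (q : C(Fin m → I, Sph m)) : Prop :=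
  Function.Surjective q ∧
    ∀ s t, q s = q t ↔ s = t ∨ (s ∈ Cube.boundary (Fin m) ∧ t ∈ Cube.boundary (Fin m))

/-- `f : S^m → O(k)` is the based map corresponding to the loop `α : (I^m, ∂I^m) → (O(k), 1)` under
the collapse `q`. -/
def Represents {m k : ℕ} (q : C(Fin m → I, Sph m)) (α : GenLoop (Fin m) (O k) 1)
    (f : C(Sph m, O k)) : Prop :=
  ∀ t, f (q t) = α t

/-- `g : S^2 × S^(2n-3) → O(2n)` is the composite of the quotient map
`S^2 × S^(2n-3) → S^2 ∧ S^(2n-3) = S^(2n-1)` with the based map corresponding to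
`β : (I^(2n-1), ∂I^(2n-1)) → (O(2n), 1)`. The first two coordinates of `u` give the point of `S^2`,
the other `2n-3` give the point of `S^(2n-3)`. -/
def RepresentsTop {n : ℕ} (hn : 2 ≤ n) (p : C(Fin 2 → I, Sph 2))
    (q : C(Fin (2 * n - 3) → I, Sph (2 * n - 3)))
    (β : GenLoop (Fin (2 * n - 1)) (O (2 * n)) 1) (g : C(SphProd n, O (2 * n))) : Prop :=
  ∀ u : Fin (2 * n - 1) → I,
    g (p fun i => u ⟨i, by omega⟩, q fun j => u ⟨2 + j, by omega⟩) = β u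

end SphereFraming

end

/-! Fix a reference trivialization. Any other differs from it by a family of invertible matrices
over `X = S^2 × S^(2n-3)`, and Gram–Schmidt deforms such families into `O(2n)` without changing the
sign of the determinant. So path components of trivializations are free homotopy classes of maps `X
→ O(2n)` (`joined_twist_iff`, `exists_joined_twist`), and those with the reference orientation are
the classes of maps to `SO(2n)`.

Let `h : X → SO(2n)`, normalised to be `1` at the base point `(x₀, y₀)`; this is possible because
`SO(2n)` is path connected. Write `h(x, y) = f(y) g(x, y) γ(x)` with `f = h(x₀, ·)` and `γ = h(·,
y₀)`. Then `g` is `1` on the wedge, hence lives on the smash product, and `γ` can be discarded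
because `π_2(SO(2n)) = 0` (`sphere_two_homotopic_one`). This gives surjectivity onto one orientation
class (`exists_product_homotopic`). For injectivity, a free homotopy between two products is
corrected by its own restrictions to the two axes, which yields based homotopies of both factors
(`homotopic_of_product_homotopic`).

The vanishing of `π_2(SO(m))` for `m ≥ 3` is proved by hand. For `m = 3`, a map from `S^2` lifts to
unit quaternions, and a map `S^2 → S^3` can be moved off a point. The step from `m` to `m + 1`
rotates the first column to a fixed vector, again after moving it off a point of `S^m`.

All trivializations together form two orientation classes, so the set of components is covered by
two injective images of `S = π_(2n-3) × π_(2n-1)`. The bijection with `S` itself is a statement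
about cardinals: `S` is infinite, so two copies of it are equinumerous with one
(`nonempty_equiv_of_two_injections`). A trivialization exists because `TS^m ⊕ ℝ` is trivial, used
once for each sphere (`standardTriv`).

Infinitude of `π_(2n-1)(O(2n))` comes from explicit loops made of two reflections. Their first
columns are radial maps to `S^(2n-1)` whose degree integral is a fixed positive multiple of `k`
(`degInt_radialMap`). That integral is a homotopy invariant by the divergence theorem
(`degInt_eq_of_homotopy`). -/

noncomputable section

namespace SphereFraming

/-! ### Divergence of the cofactor field -/

section Degree

open MeasureTheory

/-- The determinant as a continuous multilinear function of the rows. -/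
def detCMM (N : ℕ) : ContinuousMultilinearMap ℝ (fun _ : Fin N => Fin N → ℝ) ℝ where
  toMultilinearMap := (Matrix.detRowAlternating (n := Fin N) (R := ℝ)).toMultilinearMap
  cont := Continuous.matrix_det (A := fun M : Fin N → Fin N → ℝ => Matrix.of M) continuous_id

theorem detCMM_apply {N : ℕ} (M : Fin N → Fin N → ℝ) : detCMM N M = Matrix.det (Matrix.of M) := rfl

/-- The rows of the Jacobian matrix of `U`. -/
def jac {N : ℕ} (U : (Fin N → ℝ) → (Fin N → ℝ)) (x : Fin N → ℝ) (i : Fin N) : Fin N → ℝ :=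
  fderiv ℝ U x (Pi.single i 1)

/-- The cofactor vector field: the Jacobian determinant of `U` with row `i` replaced by `U`. -/
def cofField {N : ℕ} (U : (Fin N → ℝ) → (Fin N → ℝ)) (i : Fin N) (x : Fin N → ℝ) : ℝ :=
  detCMM N (Function.update (jac U x) i (U x))

variable {N : ℕ} {U : (Fin N → ℝ) → (Fin N → ℝ)}

/-- The second derivative of `U` in coordinate directions. -/
def hess (U : (Fin N → ℝ) → (Fin N → ℝ)) (x : Fin N → ℝ) (i j : Fin N) : Fin N → ℝ :=
  fderiv ℝ (fderiv ℝ U) x (Pi.single i 1) (Pi.single j 1)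

theorem hess_symm (hU : ContDiff ℝ 2 U) (x : Fin N → ℝ) (i j : Fin N) :
    hess U x i j = hess U x j i := by
  have h : IsSymmSndFDerivAt ℝ U x :=
    hU.contDiffAt.isSymmSndFDerivAt (by simp)
  exact h _ _

theorem hasFDerivAt_jac (hU : ContDiff ℝ 2 U) (x : Fin N → ℝ) (j : Fin N) :
    HasFDerivAt (fun y => jac U y j)
      ((ContinuousLinearMap.apply ℝ _ (Pi.single j (1 : ℝ))).comp (fderiv ℝ (fderiv ℝ U) x)) x := by
  have h1 : ContDiff ℝ 1 (fderiv ℝ U) := hU.fderiv_right (by norm_num)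
  have h2 := (h1.differentiable (by norm_num) x).hasFDerivAt
  exact (ContinuousLinearMap.apply ℝ (Fin N → ℝ) (Pi.single j (1 : ℝ))).hasFDerivAt.comp x h2

/-- The derivative of the cofactor field. -/
def cofFieldDeriv (U : (Fin N → ℝ) → (Fin N → ℝ)) (i : Fin N) (x : Fin N → ℝ) :
    (Fin N → ℝ) →L[ℝ] ℝ :=
  ∑ j, ((detCMM N).toContinuousLinearMap (Function.update (jac U x) i (U x)) j).comp
    (if j = i then fderiv ℝ U x else
      (ContinuousLinearMap.apply ℝ _ (Pi.single j (1 : ℝ))).comp (fderiv ℝ (fderiv ℝ U) x))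

theorem hasFDerivAt_cofField (hU : ContDiff ℝ 2 U) (i : Fin N) (x : Fin N → ℝ) :
    HasFDerivAt (cofField U i) (cofFieldDeriv U i x) x := by
  have h : ∀ j, HasFDerivAt (fun y => Function.update (jac U y) i (U y) j)
      (if j = i then fderiv ℝ U x else
      (ContinuousLinearMap.apply ℝ _ (Pi.single j (1 : ℝ))).comp (fderiv ℝ (fderiv ℝ U) x)) x := by
    intro j
    by_cases hj : j = i
    · subst hj
      simpa using (hU.differentiable (by norm_num) x).hasFDerivAt
    · simpa [hj] using hasFDerivAt_jac hU x j
  exact HasFDerivAt.multilinear_comp (detCMM N) h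

theorem detCMM_update_swap (M : Fin N → Fin N → ℝ) {i j : Fin N} (hij : i ≠ j)
    (a b : Fin N → ℝ) :
    detCMM N (Function.update (Function.update M i a) j b) =
      -detCMM N (Function.update (Function.update M i b) j a) := by
  have h := (Matrix.detRowAlternating (n := Fin N) (R := ℝ)).map_swap
    (Function.update (Function.update M i b) j a) hij
  have h2 : Function.update (Function.update M i b) j a ∘ Equiv.swap i j =
      Function.update (Function.update M i a) j b := by
    funext k
    by_cases hk : k = i
    · subst hk; simp [hij]
    · by_cases hk' : k = j
      · subst hk'; simp [hij]
      · simp [Equiv.swap_apply_of_ne_of_ne hk hk', hk, hk']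
  rw [h2] at h
  exact h

/-- Differentiating the replaced row restores the Jacobian determinant, once for each `i`. Every
other term puts a second derivative in row `j`; it is antisymmetric in `(i, j)`, since mixed
partials commute and exchanging two rows changes the sign, so these terms cancel in the sum. -/
theorem div_cofField (hU : ContDiff ℝ 2 U) (x : Fin N → ℝ) :
    ∑ i, cofFieldDeriv U i x (Pi.single i 1) = N * detCMM N (jac U x) := by
  have key : ∀ i, cofFieldDeriv U i x (Pi.single i 1) = detCMM N (jac U x) +
      ∑ j, if j = i then 0 else
        detCMM N (Function.update (Function.update (jac U x) i (U x)) j (hess U x i j)) := by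
    intro i
    have h1 : detCMM N (jac U x) = ∑ j, if j = i then detCMM N (jac U x) else 0 := by simp
    conv_rhs => rw [h1, ← Finset.sum_add_distrib]
    simp only [cofFieldDeriv, sum_apply]
    refine Finset.sum_congr rfl fun j _ => ?_
    by_cases hj : j = i
    · subst hj
      simp only [if_true, ContinuousLinearMap.comp_apply,
        ContinuousMultilinearMap.toContinuousLinearMap_apply, Function.update_idem, add_zero]
      congr 1
      exact Function.update_eq_self_iff.2 rfl
    · simp [hj, hess]
  simp only [key, Finset.sum_add_distrib, Finset.sum_const, Finset.card_univ, Fintype.card_fin,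
    nsmul_eq_mul, add_eq_left]
  set S : Fin N → Fin N → ℝ := fun i j => if j = i then 0 else
        detCMM N (Function.update (Function.update (jac U x) i (U x)) j (hess U x i j)) with hS
  have anti : ∀ i j, S i j = - S j i := by
    intro i j
    by_cases hj : j = i
    · subst hj; simp [hS]
    · simp only [hS, hj, Ne.symm hj, if_false]
      rw [detCMM_update_swap _ (Ne.symm hj), hess_symm hU x i j,
        Function.update_comm (Ne.symm hj)]
  have h2 : ∑ i, ∑ j, S i j = - ∑ i, ∑ j, S i j := by
    conv_lhs => rw [Finset.sum_comm]
    rw [← Finset.sum_neg_distrib]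
    refine Finset.sum_congr rfl fun i _ => ?_
    rw [← Finset.sum_neg_distrib]
    exact Finset.sum_congr rfl fun j _ => anti j i
  linarith

/-- Differentiating `|U|² = 1` shows that all partial derivatives are orthogonal to `U x`, so the
Jacobian matrix annihilates the nonzero vector `U x`. -/
theorem detCMM_jac_eq_zero (hU : ContDiff ℝ 2 U) (h1 : ∀ x, U x ⬝ᵥ U x = 1) (x : Fin N → ℝ) :
    detCMM N (jac U x) = 0 := by
  have hd := (hU.differentiable (by norm_num) x).hasFDerivAt
  have hc : ∀ k, HasFDerivAt (fun y => U y k) ((ContinuousLinearMap.proj k).comp (fderiv ℝ U x)) x :=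
    fun k => hasFDerivAt_pi'.1 hd k
  have hs : HasFDerivAt (fun y => ∑ k, U y k * U y k)
      (∑ k, (U x k • ((ContinuousLinearMap.proj k).comp (fderiv ℝ U x)) +
        U x k • ((ContinuousLinearMap.proj k).comp (fderiv ℝ U x)))) x :=
    HasFDerivAt.fun_sum fun k _ => (hc k).mul (hc k)
  have hconst : (fun y => ∑ k, U y k * U y k) = fun _ => (1 : ℝ) := funext fun y => h1 y
  rw [hconst] at hs
  have h0 := hs.unique (hasFDerivAt_const (1 : ℝ) x)
  rw [detCMM_apply, ← Matrix.exists_mulVec_eq_zero_iff]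
  refine ⟨U x, ?_, ?_⟩
  · intro h
    have := h1 x
    simp [h] at this
  · funext i
    have h3 := congrArg (fun L => L (Pi.single i (1 : ℝ))) h0
    simp only [sum_apply, add_apply,
      smul_apply, ContinuousLinearMap.comp_apply,
      ContinuousLinearMap.proj_apply, smul_eq_mul, zero_apply,
      Finset.sum_add_distrib] at h3
    have h4 : ∑ k, U x k * (fderiv ℝ U x) (Pi.single i 1) k = 0 := by linarith
    simp only [Matrix.mulVec, dotProduct, Matrix.of_apply, jac, Pi.zero_apply]
    rw [← h4]
    exact Finset.sum_congr rfl fun k _ => mul_comm _ _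

end Degree

/-! ### Homotopy invariance of the degree integral -/

section DegreeInvariance

open MeasureTheory Set

/-- The degree density of a map `f` from `ℝ^m` to the sphere in `ℝ^(m+1)`. -/
def degDensity {m : ℕ} (f : (Fin m → ℝ) → (Fin (m + 1) → ℝ)) (x : Fin m → ℝ) : ℝ :=
  detCMM (m + 1) (Fin.cons (f x) fun i => fderiv ℝ f x (Pi.single i 1))

theorem hasFDerivAt_cons_const {m : ℕ} (t : ℝ) (x : Fin m → ℝ) :
    HasFDerivAt (fun y : Fin m → ℝ => (Fin.cons t y : Fin (m + 1) → ℝ))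
      (ContinuousLinearMap.pi
        (Fin.cons 0 fun i => ContinuousLinearMap.proj i :
          Fin (m + 1) → (Fin m → ℝ) →L[ℝ] ℝ)) x := by
  rw [hasFDerivAt_pi']
  intro i
  refine Fin.cases ?_ (fun j => ?_) i
  · simpa using! hasFDerivAt_const t x
  · simpa using! hasFDerivAt_apply j x

/-- The flux of the cofactor field through a time slice is the degree density of that slice:
replacing row `0` removes the only time derivative. -/
theorem cofField_zero_cons {m : ℕ} {U : (Fin (m + 1) → ℝ) → (Fin (m + 1) → ℝ)}
    (hU : ContDiff ℝ 2 U) (t : ℝ) (x : Fin m → ℝ) :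
    cofField U 0 (Fin.cons t x) = degDensity (fun y => U (Fin.cons t y)) x := by
  have hd := (hU.differentiable (by norm_num) (Fin.cons t x)).hasFDerivAt
  have h := hd.comp x (hasFDerivAt_cons_const t x)
  have h' : fderiv ℝ (fun y => U (Fin.cons t y)) x = _ := h.fderiv
  unfold cofField degDensity
  congr 1
  funext i
  refine Fin.cases ?_ (fun j => ?_) i
  · simp
  · simp only [Function.update_of_ne (Fin.succ_ne_zero j), Fin.cons_succ, h', jac,
      ContinuousLinearMap.comp_apply]
    congr 1
    funext k
    refine Fin.cases ?_ (fun l => ?_) k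
    · simp [(Fin.succ_ne_zero j).symm]
    · simp [Pi.single_apply]

/-- The degree integral over the box `[-a, a]^m`. -/
def degInt {m : ℕ} (a : ℝ) (f : (Fin m → ℝ) → (Fin (m + 1) → ℝ)) : ℝ :=
  ∫ x in Icc (fun _ => -a) (fun _ => a), degDensity f x

theorem div_cofField_eq_zero {N : ℕ} {U : (Fin N → ℝ) → (Fin N → ℝ)}
    (hU : ContDiff ℝ 2 U) (h1 : ∀ x, U x ⬝ᵥ U x = 1) :
    (fun x => ∑ i, cofFieldDeriv U i x (Pi.single i 1)) = fun _ => 0 := by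
  funext x
  rw [div_cofField hU, detCMM_jac_eq_zero hU h1, mul_zero]

/-- Divergence theorem on `[0, 1] × [-a, a]^m` for a divergence-free field. The side faces carry no
flux because `U` is constant near them, so the two time slices balance. -/
theorem degInt_eq_of_smooth_homotopy {m : ℕ} {U : (Fin (m + 1) → ℝ) → (Fin (m + 1) → ℝ)}
    (hU : ContDiff ℝ 2 U) (h1 : ∀ x, U x ⬝ᵥ U x = 1) {a b : ℝ} (ha : 0 < a) (hab : b < a)
    (e : Fin (m + 1) → ℝ) (he : ∀ x, ∀ i : Fin m, b < |x i.succ| → U x = e) :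
    degInt a (fun y => U (Fin.cons 0 y)) = degInt a (fun y => U (Fin.cons 1 y)) := by
  have hz := div_cofField_eq_zero hU h1
  have hle : (Fin.cons 0 fun _ => -a : Fin (m + 1) → ℝ) ≤ Fin.cons 1 fun _ => a := by
    intro i
    refine Fin.cases (by simp) (fun j => ?_) i
    simp only [Fin.cons_succ]
    linarith
  have key := integral_divergence_of_hasFDerivAt_off_countable'
    (a := (Fin.cons 0 fun _ => -a : Fin (m + 1) → ℝ)) (b := Fin.cons 1 fun _ => a) hle
    (cofField U) (cofFieldDeriv U) ∅ countable_empty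
    (fun i x _ => (hasFDerivAt_cofField hU i x).continuousAt.continuousWithinAt)
    (fun x _ i => hasFDerivAt_cofField hU i x) (by rw [hz]; exact integrableOn_zero)
  rw [hz] at key
  simp only [integral_zero] at key
  have hface : ∀ (i : Fin m) (x : Fin (m + 1) → ℝ), b < |x i.succ| → cofField U i.succ x = 0 := by
    intro i x hx
    have hev : U =ᶠ[𝓝 x] fun _ => e := by
      have : ∀ᶠ y in 𝓝 x, b < |y i.succ| :=
        ((continuous_apply i.succ).abs.tendsto x).eventually_const_lt hx
      exact this.mono fun y hy => he y i hy
    have hfd : fderiv ℝ U x = 0 := by rw [hev.fderiv_eq]; simp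
    -- The replaced row is `i.succ`, so row `0` is still a derivative of `U`, and it vanishes.
    refine (detCMM (m + 1)).map_coord_zero 0 ?_
    rw [Function.update_of_ne (Fin.succ_ne_zero i).symm]
    simp [jac, hfd]
  rw [Fin.sum_univ_succ, Finset.sum_eq_zero, add_zero] at key
  · have e1 : ∀ (t : ℝ) (x : Fin m → ℝ), cofField U 0 (Fin.insertNth 0 t x) =
        degDensity (fun y => U (Fin.cons t y)) x := by
      intro t x
      rw [← cofField_zero_cons hU, Fin.insertNth_zero']
    simp only [e1, Fin.cons_zero] at key
    have e2 : ∀ (s c : ℝ), ((Fin.cons s fun _ => c : Fin (m + 1) → ℝ) ∘ Fin.succAbove 0) =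
        fun _ => c := fun s c => by funext i; simp
    simp only [e2] at key
    exact (sub_eq_zero.1 key.symm).symm
  · intro i _
    have hh : ∀ c : ℝ, b < |c| → ∀ x : Fin m → ℝ,
        cofField U i.succ (Fin.insertNth i.succ c x) = 0 :=
      fun c hc x => hface i _ (by simpa using hc)
    simp only [Fin.cons_succ]
    rw [setIntegral_congr_fun measurableSet_Icc
        (fun x _ => hh a (by rwa [abs_of_pos ha]) x),
      setIntegral_congr_fun measurableSet_Icc
        (fun x _ => hh (-a) (by rwa [abs_neg, abs_of_pos ha]) x)]
    simp

/-- Normalisation of a nonzero vector to Euclidean length one. -/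
def unitVec {N : ℕ} (v : Fin N → ℝ) : Fin N → ℝ := (Real.sqrt (v ⬝ᵥ v))⁻¹ • v

theorem unitVec_dot {N : ℕ} {v : Fin N → ℝ} (hv : v ≠ 0) : unitVec v ⬝ᵥ unitVec v = 1 := by
  have hp : 0 < v ⬝ᵥ v := by simpa using Matrix.dotProduct_star_self_pos_iff.2 hv
  have := Real.mul_self_sqrt hp.le
  have hs : Real.sqrt (v ⬝ᵥ v) ≠ 0 := (Real.sqrt_pos.2 hp).ne'
  simp only [unitVec, smul_dotProduct, dotProduct_smul, smul_eq_mul]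
  generalize Real.sqrt (v ⬝ᵥ v) = r at *
  rw [← this]
  field_simp

theorem unitVec_of_unit {N : ℕ} {v : Fin N → ℝ} (hv : v ⬝ᵥ v = 1) : unitVec v = v := by
  simp [unitVec, hv]

theorem contDiff_unitVec {N : ℕ} {n : WithTop ℕ∞} {g : (Fin N → ℝ) → (Fin N → ℝ)}
    (hg : ContDiff ℝ n g) (h0 : ∀ x, g x ≠ 0) : ContDiff ℝ n fun x => unitVec (g x) := by
  have hd : ContDiff ℝ n fun x => g x ⬝ᵥ g x := by
    simp only [dotProduct]
    exact ContDiff.sum fun k _ => (contDiff_pi.1 hg k).mul (contDiff_pi.1 hg k)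
  have hp : ∀ x, g x ⬝ᵥ g x ≠ 0 := fun x h => h0 x (by simpa using h)
  exact ((hd.sqrt hp).inv fun x => (Real.sqrt_ne_zero'.2
    (by simpa using Matrix.dotProduct_star_self_pos_iff.2 (h0 x)))).smul hg

/-- A merely continuous homotopy is replaced by a smooth one with the same ends: approximate it
while keeping it exact near the ends and far out, then normalise back to the sphere. -/
theorem degInt_eq_of_homotopy {m : ℕ} {f₀ f₁ : (Fin m → ℝ) → (Fin (m + 1) → ℝ)}
    (hf₀ : ContDiff ℝ 2 f₀) (hf₁ : ContDiff ℝ 2 f₁) (e : Fin (m + 1) → ℝ)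
    {H : ℝ → (Fin m → ℝ) → (Fin (m + 1) → ℝ)} (hH : Continuous fun p : ℝ × (Fin m → ℝ) => H p.1 p.2)
    (h1 : ∀ t x, H t x ⬝ᵥ H t x = 1) (he : ∀ t x, ∀ i, 1 ≤ |x i| → H t x = e)
    (H0 : ∀ t ≤ 0, H t = f₀) (H1 : ∀ t ≥ 1, H t = f₁) :
    degInt 3 f₀ = degInt 3 f₁ := by
  -- The time change `3 z₀ - 1` makes the homotopy stationary for `z₀ ≤ 1/3` and `z₀ ≥ 2/3`. This
  -- gives an open set `V` on which `F` is already `C²`, containing the closed set `S` on which the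
  -- approximation has to be exact.
  let F : (Fin (m + 1) → ℝ) → (Fin (m + 1) → ℝ) := fun z => H (3 * z 0 - 1) (Fin.tail z)
  have hF : Continuous F :=
    hH.comp (f := fun z : Fin (m + 1) → ℝ => (3 * z 0 - 1, Fin.tail z))
      (by unfold Fin.tail; fun_prop)
  have hF0 : ∀ z, F z ≠ 0 := fun z h => by
    have h2 := h1 (3 * z 0 - 1) (Fin.tail z)
    change F z ⬝ᵥ F z = 1 at h2
    simp [h] at h2
  have htail : ContDiff ℝ 2 (fun z : Fin (m + 1) → ℝ => (Fin.tail z : Fin m → ℝ)) :=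
    contDiff_pi.2 fun i => contDiff_apply ℝ ℝ i.succ
  let S : Set (Fin (m + 1) → ℝ) :=
    {z | z 0 ≤ 0} ∪ {z | 1 ≤ z 0} ∪ ⋃ i : Fin m, {z | 2 ≤ |z i.succ|}
  let V : Set (Fin (m + 1) → ℝ) :=
    {z | z 0 < 1 / 3} ∪ {z | 2 / 3 < z 0} ∪ ⋃ i : Fin m, {z | 1 < |z i.succ|}
  have hS : IsClosed S := by
    refine ((isClosed_le (continuous_apply 0) continuous_const).union
      (isClosed_le continuous_const (continuous_apply 0))).union ?_
    exact isClosed_iUnion_of_finite fun i =>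
      isClosed_le continuous_const (continuous_apply i.succ).abs
  have hV : IsOpen V := by
    refine ((isOpen_lt (continuous_apply 0) continuous_const).union
      (isOpen_lt continuous_const (continuous_apply 0))).union ?_
    exact isOpen_iUnion fun i => isOpen_lt continuous_const (continuous_apply i.succ).abs
  have hSV : S ⊆ V := by
    rintro z ((hz | hz) | hz)
    · exact Or.inl (Or.inl (lt_of_le_of_lt (b := (0 : ℝ)) hz (by norm_num)))
    · exact Or.inl (Or.inr (lt_of_lt_of_le (b := (1 : ℝ)) (by norm_num) hz))
    · obtain ⟨i, hi⟩ := mem_iUnion.1 hz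
      exact Or.inr (mem_iUnion.2 ⟨i, lt_of_lt_of_le (b := (2 : ℝ)) (by norm_num) hi⟩)
  have hFV : ContDiffOn ℝ 2 F V := by
    intro z hz
    refine ContDiffAt.contDiffWithinAt ?_
    rcases hz with (hz | hz) | hz
    · have : F =ᶠ[𝓝 z] fun z => f₀ (Fin.tail z) := by
        filter_upwards [(isOpen_lt (continuous_apply 0) continuous_const).mem_nhds hz] with y hy
        have hy' : y 0 < 1 / 3 := hy
        simp only [F]
        rw [H0 _ (by linarith)]
      exact (hf₀.comp htail).contDiffAt.congr_of_eventuallyEq this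
    · have : F =ᶠ[𝓝 z] fun z => f₁ (Fin.tail z) := by
        filter_upwards [(isOpen_lt continuous_const (continuous_apply 0)).mem_nhds hz] with y hy
        have hy' : 2 / 3 < y 0 := hy
        simp only [F]
        rw [H1 _ (by linarith)]
      exact (hf₁.comp htail).contDiffAt.congr_of_eventuallyEq this
    · obtain ⟨i, hi⟩ := mem_iUnion.1 hz
      have : F =ᶠ[𝓝 z] fun z => e := by
        filter_upwards [(isOpen_lt continuous_const (continuous_apply i.succ).abs).mem_nhds hi]
          with y hy
        exact he _ _ i (le_of_lt hy)
      exact contDiffAt_const.congr_of_eventuallyEq this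
  -- The permitted error at `z` is `‖F z‖` itself, so the strict bound keeps `g` away from zero.
  obtain ⟨g, hg, hgF, hgS, -⟩ := hF.exists_contDiff_approx_and_eqOn (n := 2) hF.norm
    (fun z => norm_pos_iff.2 (hF0 z)) hS (hV.mem_nhdsSet.2 hSV) (by exact_mod_cast hFV)
  have hg0 : ∀ z, g z ≠ 0 := fun z hz => by
    have := hgF z
    simp [hz] at this
  have hgS' : ∀ z ∈ S, unitVec (g z) = F z := fun z hz => by
    rw [hgS hz]; exact unitVec_of_unit (h1 _ _)
  have key := degInt_eq_of_smooth_homotopy (U := fun z => unitVec (g z))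
    (contDiff_unitVec (by exact_mod_cast hg) hg0) (fun z => unitVec_dot (hg0 z)) (a := 3) (b := 2) (by norm_num)
    (by norm_num) e (fun z i hz => by
      rw [hgS' z (Or.inr (mem_iUnion.2 ⟨i, hz.le⟩))]
      exact he _ _ i (by change 1 ≤ |z i.succ|; linarith))
  have k0 : (fun y => unitVec (g (Fin.cons 0 y))) = f₀ := by
    funext y
    rw [hgS' _ (Or.inl (Or.inl (by simp)))]
    simp only [F, Fin.cons_zero, Fin.tail_cons]
    rw [H0 _ (by norm_num)]
  have k1 : (fun y => unitVec (g (Fin.cons 1 y))) = f₁ := by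
    funext y
    rw [hgS' _ (Or.inl (Or.inr (by simp)))]
    simp only [F, Fin.cons_zero, Fin.tail_cons]
    rw [H1 _ (by norm_num)]
  rwa [k0, k1] at key

end DegreeInvariance

/-! ### Radial maps to the sphere and their degree density -/

section RadialMaps

open MeasureTheory Set

/-- The matrix whose first row is `(P, Q x)` and whose other rows are `(a xᵢ, Q eᵢ + b xᵢ x)`. -/
def radialMatrix {m : ℕ} (P Q a b : ℝ) (x : Fin m → ℝ) : Matrix (Fin (m + 1)) (Fin (m + 1)) ℝ :=
  Matrix.of (Fin.cons (Fin.cons P (Q • x))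
    fun i => Fin.cons (a * x i) (Q • Pi.single i 1 + (b * x i) • x))

/-- For `Q ≠ 0`, subtracting multiples of the first row removes the rank-one block, and right
multiplication by the unipotent matrix `C` clears the first column, leaving a triangular matrix. For
`Q = 0` the remaining minor has rank at most one and size at least two. -/
theorem det_radialMatrix {m : ℕ} (hm : 2 ≤ m) (P Q a b : ℝ) (x : Fin m → ℝ) :
    (radialMatrix P Q a b x).det = Q ^ (m - 1) * (P * (Q + b * (x ⬝ᵥ x)) - a * Q * (x ⬝ᵥ x)) := by
  by_cases hQ : Q = 0
  · subst hQ
    rw [zero_pow (by omega), zero_mul, Matrix.det_succ_row_zero, Fin.sum_univ_succ,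
      Finset.sum_eq_zero fun i _ => by simp [radialMatrix]]
    have hsub : (radialMatrix P 0 a b x).submatrix Fin.succ (Fin.succAbove 0) =
        Matrix.vecMulVec (b • x) x := by
      ext i j
      simp [radialMatrix, Matrix.vecMulVec_apply]
    have hnt : Nontrivial (Fin m) := Fin.nontrivial_iff_two_le.2 hm
    rw [hsub, Matrix.det_vecMulVec]
    simp
  · let B := radialMatrix P Q (a - b * P / Q) 0 x
    have h1 : (radialMatrix P Q a b x).det = B.det := by
      refine Matrix.det_eq_of_forall_row_eq_smul_add_const
        (Fin.cons 0 fun i => b / Q * x i) 0 (by simp) fun i j => ?_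
      refine Fin.cases ?_ (fun i => ?_) i
      · simp [B, radialMatrix]
      · refine Fin.cases ?_ (fun j => ?_) j
        · simp only [B, radialMatrix, Matrix.of_apply, Fin.cons_succ, Fin.cons_zero]
          field_simp
          ring
        · simp only [B, radialMatrix, Matrix.of_apply, Fin.cons_succ, Fin.cons_zero, Pi.add_apply,
            Pi.smul_apply, smul_eq_mul]
          field_simp
          ring
    let c := (a - b * P / Q) / Q
    let C : Matrix (Fin (m + 1)) (Fin (m + 1)) ℝ := Matrix.of
      (Fin.cons (Fin.cons 1 0) fun i => Fin.cons (-(c * x i)) (Pi.single i 1))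
    have hC : C.det = 1 := by
      rw [Matrix.det_of_isLowerTriangular, Fin.prod_univ_succ]
      · simp [C]
      · intro i j hij
        revert hij
        refine Fin.cases ?_ (fun i => ?_) i
        · refine Fin.cases (by simp) (fun j => by simp [C]) j
        · refine Fin.cases (fun h => ?_) (fun j h => ?_) j
          · exact absurd (OrderDual.toDual_lt_toDual.1 h) (Fin.not_lt_zero _)
          have hij : i ≠ j := by
            rintro rfl
            simp at h
          simp [C, hij.symm]
    have hBC : (B * C).det = (P - c * Q * (x ⬝ᵥ x)) * Q ^ m := by
      rw [Matrix.det_of_isUpperTriangular, Fin.prod_univ_succ]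
      · congr 1
        · simp only [Matrix.mul_apply, Fin.sum_univ_succ, B, C, radialMatrix, Matrix.of_apply,
            Fin.cons_succ, Fin.cons_zero, Pi.smul_apply, smul_eq_mul, dotProduct, Finset.mul_sum,
            mul_one]
          rw [sub_eq_add_neg, ← Finset.sum_neg_distrib]
          congr 1
          exact Finset.sum_congr rfl fun i _ => by ring
        · rw [Finset.prod_congr rfl (g := fun _ => Q) fun i _ => ?_]
          · simp
          · simp [Matrix.mul_apply, Fin.sum_univ_succ, B, C, radialMatrix, Pi.single_apply]
      · intro i j hij
        revert hij
        refine Fin.cases (by simp) (fun i => ?_) i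
        refine Fin.cases (fun _ => ?_) (fun j h => ?_) j
        · simp [Matrix.mul_apply, Fin.sum_univ_succ, B, C, radialMatrix, Pi.single_apply, c]
          field_simp
          ring
        · have hij : i ≠ j := by
            rintro rfl
            simp at h
          simp [Matrix.mul_apply, Fin.sum_univ_succ, B, C, radialMatrix, Pi.single_apply, hij.symm]
    rw [Matrix.det_mul, hC, mul_one] at hBC
    obtain ⟨k, rfl⟩ : ∃ k, m = k + 1 := ⟨m - 1, by omega⟩
    rw [h1, hBC, Nat.add_sub_cancel]
    simp only [c, pow_succ]
    field_simp
    ring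

/-- The angle function: `0` near the origin, `2πk` outside the unit ball, in terms of `s = |x|²`. -/
def angle (k : ℕ) (s : ℝ) : ℝ := 2 * Real.pi * k * Real.smoothTransition ((4 * s - 1) / 3)

theorem contDiff_angle (k : ℕ) {n : ℕ∞} : ContDiff ℝ n (angle k) := by
  unfold angle
  exact contDiff_const.mul (Real.smoothTransition.contDiff.comp
    (((contDiff_const.mul contDiff_id).sub contDiff_const).div_const _))

theorem angle_of_le {k : ℕ} {s : ℝ} (hs : s ≤ 1 / 4) : angle k s = 0 := by
  simp [angle, Real.smoothTransition.zero_of_nonpos (x := (4 * s - 1) / 3) (by linarith)]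

theorem angle_of_ge {k : ℕ} {s : ℝ} (hs : 1 ≤ s) : angle k s = 2 * Real.pi * k := by
  simp [angle, Real.smoothTransition.one_of_one_le (x := (4 * s - 1) / 3) (by linarith)]

/-- The coefficient of `x` in the radial map. -/
def radialCoeff (k : ℕ) (s : ℝ) : ℝ := Real.sin (angle k s) / Real.sqrt s

/-- The angle vanishes identically for `s < 1/4`, so the singularity of `1 / √s` at the origin is
never seen. -/
theorem contDiff_radialCoeff (k : ℕ) {n : ℕ∞} : ContDiff ℝ n (radialCoeff k) := by
  rw [contDiff_iff_contDiffAt]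
  intro s
  rcases lt_or_ge s (1 / 4) with hs | hs
  · have : radialCoeff k =ᶠ[𝓝 s] fun _ => 0 := by
      filter_upwards [Iio_mem_nhds hs] with t ht
      simp [radialCoeff, angle_of_le (le_of_lt ht)]
    exact contDiffAt_const.congr_of_eventuallyEq this
  · have hs0 : s ≠ 0 := by linarith
    exact ((Real.contDiff_sin.comp (contDiff_angle k)).contDiffAt).div (contDiffAt_id.sqrt hs0)
      (Real.sqrt_ne_zero'.2 (by linarith))

/-- A smooth map from `ℝ^m` to the sphere in `ℝ^(m+1)`, equal to the first basis vector outside the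
unit ball, that wraps `k` times around the sphere on each half of every line through the origin. -/
def radialMap {m : ℕ} (k : ℕ) (x : Fin m → ℝ) : Fin (m + 1) → ℝ :=
  Fin.cons (Real.cos (angle k (x ⬝ᵥ x))) (radialCoeff k (x ⬝ᵥ x) • x)

theorem contDiff_dotProduct_self {m : ℕ} {n : WithTop ℕ∞} :
    ContDiff ℝ n fun x : Fin m → ℝ => x ⬝ᵥ x := by
  simp only [dotProduct]
  exact ContDiff.sum fun k _ => (contDiff_apply ℝ ℝ k).mul (contDiff_apply ℝ ℝ k)

theorem contDiff_radialMap {m : ℕ} (k : ℕ) {n : ℕ∞} : ContDiff ℝ n (radialMap (m := m) k) := by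
  rw [contDiff_pi]
  intro i
  refine Fin.cases ?_ (fun j => ?_) i
  · exact Real.contDiff_cos.comp ((contDiff_angle k).comp contDiff_dotProduct_self)
  · exact ((contDiff_radialCoeff k).comp contDiff_dotProduct_self).mul (contDiff_apply ℝ ℝ j)

theorem exists_hasFDerivAt_dotProduct_self {m : ℕ} (x : Fin m → ℝ) :
    ∃ L : (Fin m → ℝ) →L[ℝ] ℝ, HasFDerivAt (fun x : Fin m → ℝ => x ⬝ᵥ x) L x ∧
      ∀ i, L (Pi.single i 1) = 2 * x i := by
  simp only [dotProduct]
  refine ⟨_, HasFDerivAt.fun_sum fun k _ => (hasFDerivAt_apply k x).mul (hasFDerivAt_apply k x),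
    fun i => ?_⟩
  simp [sum_apply, Finset.sum_add_distrib, Pi.single_apply, two_mul]

theorem fderiv_radialMap_single {m : ℕ} (k : ℕ) (x : Fin m → ℝ) (i : Fin m) :
    fderiv ℝ (radialMap k) x (Pi.single i 1) =
      Fin.cons (-Real.sin (angle k (x ⬝ᵥ x)) * deriv (angle k) (x ⬝ᵥ x) * 2 * x i)
        (radialCoeff k (x ⬝ᵥ x) • Pi.single i 1 +
          (2 * deriv (radialCoeff k) (x ⬝ᵥ x) * x i) • x) := by
  have hd := ((contDiff_radialMap (m := m) k (n := 1)).differentiable (by norm_num) x).hasFDerivAt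
  obtain ⟨L, hs, hsi⟩ := exists_hasFDerivAt_dotProduct_self x
  have ha := ((contDiff_angle k (n := 1)).differentiable (by norm_num) (x ⬝ᵥ x)).hasDerivAt
  have hq := ((contDiff_radialCoeff k (n := 1)).differentiable (by norm_num) (x ⬝ᵥ x)).hasDerivAt
  rw [hasFDerivAt_pi'] at hd
  funext j
  refine Fin.cases ?_ (fun j => ?_) j
  · have h2 := (hd 0).unique ((ha.cos).comp_hasFDerivAt (f := fun y : Fin m → ℝ => y ⬝ᵥ y) x hs)
    have h3 := congrArg (fun L => L (Pi.single i (1 : ℝ))) h2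
    simp only [ContinuousLinearMap.comp_apply, ContinuousLinearMap.proj_apply, smul_apply, hsi,
      smul_eq_mul] at h3
    rw [h3, Fin.cons_zero]
    ring
  · have h2 := (hd j.succ).unique ((hq.comp_hasFDerivAt (f := fun y : Fin m → ℝ => y ⬝ᵥ y) x hs).mul (hasFDerivAt_apply j x))
    have h3 := congrArg (fun L => L (Pi.single i (1 : ℝ))) h2
    simp only [ContinuousLinearMap.comp_apply, ContinuousLinearMap.proj_apply, smul_apply, hsi,
      smul_eq_mul, add_apply, Function.comp_apply] at h3
    rw [h3, Fin.cons_succ]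
    simp only [Pi.add_apply, Pi.smul_apply, smul_eq_mul, Pi.single_apply]
    ring

/-- With `r = |x|` and `θ(r) = angle k (r²)` this is the polar Jacobian `(sin θ / r)^(m-1) θ'(r)`;
the derivative of `radialCoeff` drops out through `sin² + cos² = 1`. -/
theorem degDensity_radialMap {m : ℕ} (hm : 2 ≤ m) (k : ℕ) (x : Fin m → ℝ) :
    degDensity (radialMap k) x =
      Real.sin (angle k (x ⬝ᵥ x)) ^ (m - 1) / Real.sqrt (x ⬝ᵥ x) ^ (m - 1) *
        (2 * Real.sqrt (x ⬝ᵥ x) * deriv (angle k) (x ⬝ᵥ x)) := by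
  have h1 : degDensity (radialMap k) x = (radialMatrix (Real.cos (angle k (x ⬝ᵥ x)))
      (radialCoeff k (x ⬝ᵥ x)) (-Real.sin (angle k (x ⬝ᵥ x)) * deriv (angle k) (x ⬝ᵥ x) * 2)
      (2 * deriv (radialCoeff k) (x ⬝ᵥ x)) x).det := by
    rw [degDensity, detCMM_apply]
    congr 1
    simp only [radialMatrix, radialMap]
    congr 2
    funext i
    exact fderiv_radialMap_single k x i
  rw [h1, det_radialMatrix hm]
  generalize hs : x ⬝ᵥ x = s
  rcases lt_or_ge s (1 / 4) with h | h
  · have hr : radialCoeff k s = 0 := by simp [radialCoeff, angle_of_le h.le]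
    rw [hr, angle_of_le h.le]
    simp [zero_pow (show m - 1 ≠ 0 by omega)]
  · have hs0 : 0 < s := by linarith
    have ha := ((contDiff_angle k (n := 1)).differentiable (by norm_num) s).hasDerivAt
    have hq : HasDerivAt (radialCoeff k) _ s :=
      ha.sin.div (Real.hasDerivAt_sqrt hs0.ne') (Real.sqrt_ne_zero'.2 hs0)
    rw [hq.deriv]
    have hsq := Real.mul_self_sqrt hs0.le
    have hr0 := Real.sqrt_ne_zero'.2 hs0
    have hcs := Real.sin_sq_add_cos_sq (angle k s)
    simp only [radialCoeff, div_pow]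
    generalize Real.sqrt s = r at *
    generalize Real.sin (angle k s) = S at *
    generalize Real.cos (angle k s) = C at *
    generalize deriv (angle k) s = D at *
    congr 1
    subst hsq
    field_simp
    linear_combination (2 * D * r ^ 2) * hcs

end RadialMaps

/-! ### The degree integral of a radial map -/

section RadialDegree

open MeasureTheory Set

theorem deriv_angle_of_ge {k : ℕ} {s : ℝ} (hs : 1 < s) : deriv (angle k) s = 0 := by
  have : angle k =ᶠ[𝓝 s] fun _ => 2 * Real.pi * k := by
    filter_upwards [Ioi_mem_nhds hs] with t ht
    exact angle_of_ge (le_of_lt ht)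
  rw [this.deriv_eq]
  simp

theorem one_le_dotProduct_self {m : ℕ} {x : Fin m → ℝ} {i : Fin m} {a : ℝ} (ha : 0 ≤ a)
    (h : a < |x i|) : a ^ 2 < x ⬝ᵥ x := by
  have h1 : x i * x i ≤ x ⬝ᵥ x :=
    Finset.single_le_sum (f := fun j => x j * x j) (fun j _ => mul_self_nonneg _)
      (Finset.mem_univ i)
  have h2 : x i * x i = |x i| ^ 2 := by rw [sq_abs, sq]
  have h3 : a ^ 2 < |x i| ^ 2 := by gcongr
  linarith

/-- Substitution `u = angle k (y²)`. The integrand vanishes for `y > 1`, so the half-line may be cut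
at `2`. -/
theorem integral_sin_angle (d k : ℕ) :
    ∫ y in Ioi (0 : ℝ), Real.sin (angle k (y ^ 2)) ^ d * (2 * y * deriv (angle k) (y ^ 2)) =
      ∫ u in (0 : ℝ)..(2 * Real.pi * k), Real.sin u ^ d := by
  have h1 : ∫ y in Ioi (0 : ℝ), Real.sin (angle k (y ^ 2)) ^ d * (2 * y * deriv (angle k) (y ^ 2)) =
      ∫ y in Ioc (0 : ℝ) 2,
        Real.sin (angle k (y ^ 2)) ^ d * (2 * y * deriv (angle k) (y ^ 2)) := by
    refine (setIntegral_eq_of_subset_of_forall_sdiff_eq_zero measurableSet_Ioi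
      Ioc_subset_Ioi_self fun y hy => ?_)
    have hy2 : 2 < y := by
      by_contra h
      exact hy.2 ⟨hy.1, not_lt.1 h⟩
    rw [deriv_angle_of_ge (by nlinarith)]
    ring
  have hder : ∀ y ∈ uIcc (0 : ℝ) 2, HasDerivAt (fun y => angle k (y ^ 2))
      (2 * y * deriv (angle k) (y ^ 2)) y := by
    intro y _
    have ha := ((contDiff_angle k (n := 1)).differentiable (by norm_num) (y ^ 2)).hasDerivAt
    have := HasDerivAt.comp (h₂ := angle k) (h := fun x : ℝ => x ^ 2) y ha (hasDerivAt_pow 2 y)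
    convert! this using 1
    simp
    ring
  have hcont : ContinuousOn (fun y => 2 * y * deriv (angle k) (y ^ 2)) (uIcc (0 : ℝ) 2) := by
    have h := (contDiff_angle k (n := 1)).continuous_deriv (by norm_num)
    exact Continuous.continuousOn (by fun_prop)
  have key := intervalIntegral.integral_comp_mul_deriv hder hcont
    (g := fun u => Real.sin u ^ d) (by fun_prop)
  rw [h1, ← intervalIntegral.integral_of_le (by norm_num)]
  simpa [angle_of_le (k := k) (s := 0) (by norm_num),
    angle_of_ge (k := k) (s := 2 ^ 2) (by norm_num)] using key

/-- An even power of the sine has period `π`. This is where the parity of the sphere enters: for an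
odd power the integral over `[0, 2πk]` is zero and could not detect `k`. -/
theorem integral_sin_pow_even_multiple {d : ℕ} (hd : Even d) (k : ℕ) :
    ∫ u in (0 : ℝ)..(2 * Real.pi * k), Real.sin u ^ d =
      (2 * k) * ∫ u in (0 : ℝ)..Real.pi, Real.sin u ^ d := by
  have hper : Function.Periodic (fun u => Real.sin u ^ d) Real.pi := fun u => by
    simp [Real.sin_add_pi, hd.neg_pow]
  have h := hper.intervalIntegral_add_zsmul_eq (2 * k : ℕ) 0
    (fun _ _ => Continuous.intervalIntegrable (by fun_prop) _ _)
  simp only [zero_add, zsmul_eq_mul] at h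
  push_cast at h
  rw [← h]
  congr 1
  ring

/-- In polar coordinates the volume factor `r^(m-1)` cancels the one in the density. The constant is
the area of the unit sphere in `ℝ^m` times the sine integral over one full turn. -/
theorem degInt_radialMap {m : ℕ} (hm : 2 ≤ m) (hodd : Odd m) :
    ∃ c : ℝ, 0 < c ∧ ∀ k : ℕ, degInt 3 (radialMap (m := m) k) = c * k := by
  have hev : Even (m - 1) := by
    obtain ⟨j, rfl⟩ := hodd
    exact ⟨j, by omega⟩
  refine ⟨m * (volume : Measure (E m)).real (Metric.ball 0 1) *
    (2 * ∫ u in (0 : ℝ)..Real.pi, Real.sin u ^ (m - 1)), ?_, fun k => ?_⟩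
  · have h1 : 0 < (volume : Measure (E m)).real (Metric.ball 0 1) :=
      ENNReal.toReal_pos (Metric.measure_ball_pos volume _ one_pos).ne' measure_ball_lt_top.ne
    have h2 : 0 < ∫ u in (0 : ℝ)..Real.pi, Real.sin u ^ (m - 1) := integral_sin_pow_pos _
    have h3 : (0 : ℝ) < m := by exact_mod_cast (by omega : 0 < m)
    positivity
  · let g : ℝ → ℝ := fun r => Real.sin (angle k (r ^ 2)) ^ (m - 1) / r ^ (m - 1) *
      (2 * r * deriv (angle k) (r ^ 2))
    have h1 : degInt 3 (radialMap (m := m) k) = ∫ x, degDensity (radialMap (m := m) k) x := by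
      refine setIntegral_eq_integral_of_forall_compl_eq_zero fun x hx => ?_
      have : ∃ i, 3 < |x i| := by
        by_contra! hcon
        exact hx ⟨fun i => (abs_le.1 (hcon i)).1, fun i => (abs_le.1 (hcon i)).2⟩
      obtain ⟨i, hi⟩ := this
      have := one_le_dotProduct_self (by norm_num) hi
      rw [degDensity_radialMap hm, deriv_angle_of_ge (by linarith)]
      ring
    have h2 : ∫ x, degDensity (radialMap (m := m) k) x = ∫ y : E m, g ‖y‖ := by
      rw [← (PiLp.volume_preserving_ofLp (Fin m)).integral_comp
        (MeasurableEquiv.toLp 2 (Fin m → ℝ)).symm.measurableEmbedding]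
      refine integral_congr_ae (Filter.Eventually.of_forall fun y => ?_)
      have hn : y.ofLp ⬝ᵥ y.ofLp = ‖y‖ ^ 2 := by
        rw [EuclideanSpace.real_norm_sq_eq]
        exact Finset.sum_congr rfl fun i _ => (sq _).symm
      simp only [degDensity_radialMap hm, hn, Real.sqrt_sq (norm_nonneg y), g]
    have hnt : Nontrivial (E m) :=
      have : Nonempty (Fin m) := ⟨⟨0, by omega⟩⟩
      inferInstance
    rw [h1, h2, integral_fun_norm_addHaar, finrank_euclideanSpace_fin]
    have h3 : ∫ y in Ioi (0 : ℝ), y ^ (m - 1) • g y =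
        ∫ y in Ioi (0 : ℝ), Real.sin (angle k (y ^ 2)) ^ (m - 1) *
          (2 * y * deriv (angle k) (y ^ 2)) := by
      refine setIntegral_congr_fun measurableSet_Ioi fun y hy => ?_
      have hy0 : y ≠ 0 := (ne_of_gt hy)
      simp only [g, smul_eq_mul]
      field_simp
    rw [h3, integral_sin_angle, integral_sin_pow_even_multiple hev]
    simp only [nsmul_eq_mul, smul_eq_mul]
    ring

end RadialDegree

/-! ### Reflections as orthogonal matrices -/

section Reflections

variable {N : ℕ}

/-- The matrix of the orthogonal reflection in the hyperplane `u^⊥` (the identity when `u = 0`). -/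
def reflMatrix (u : Fin N → ℝ) : Matrix (Fin N) (Fin N) ℝ :=
  1 - (2 / (u ⬝ᵥ u)) • Matrix.vecMulVec u u

theorem reflMatrix_mul_self (u : Fin N → ℝ) : reflMatrix u * reflMatrix u = 1 := by
  by_cases h : u ⬝ᵥ u = 0
  · simp [reflMatrix, h]
  · simp only [reflMatrix, sub_mul, mul_sub, one_mul, mul_one, smul_mul_assoc, mul_smul_comm,
      Matrix.vecMulVec_mul_vecMulVec, Matrix.vecMulVec_smul, smul_smul]
    have : 2 / (u ⬝ᵥ u) * (2 / (u ⬝ᵥ u) * (u ⬝ᵥ u)) = 2 / (u ⬝ᵥ u) + 2 / (u ⬝ᵥ u) := by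
      field_simp
      norm_num
    rw [smul_sub, smul_smul, this, add_smul]
    abel

theorem reflMatrix_transpose (u : Fin N → ℝ) : (reflMatrix u)ᵀ = reflMatrix u := by
  simp [reflMatrix, Matrix.transpose_vecMulVec]

/-- The orthogonal reflection in the hyperplane `u^⊥` (the identity when `u = 0`). -/
def refl (u : Fin N → ℝ) : O N :=
  ⟨reflMatrix u, by
    rw [Matrix.mem_orthogonalGroup_iff, reflMatrix_transpose, reflMatrix_mul_self]⟩

theorem refl_mul_self (u : Fin N → ℝ) : refl u * refl u = 1 :=
  Subtype.ext (reflMatrix_mul_self u)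

/-- A reflection depends only on the line spanned by `u`; hence the sign `cos (πk)` that appears at
the boundary of the radial loops is harmless. -/
theorem refl_smul (u : Fin N → ℝ) {c : ℝ} (hc : c ≠ 0) : refl (c • u) = refl u := by
  refine Subtype.ext ?_
  simp only [refl, reflMatrix, smul_dotProduct, dotProduct_smul, Matrix.smul_vecMulVec,
    Matrix.vecMulVec_smul, smul_smul, smul_eq_mul]
  congr 2
  by_cases h : u ⬝ᵥ u = 0
  · simp [h]
  · field_simp

theorem reflMatrix_mulVec (u v : Fin N → ℝ) :
    reflMatrix u *ᵥ v = v - (2 / (u ⬝ᵥ u) * (u ⬝ᵥ v)) • u := by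
  simp only [reflMatrix, Matrix.sub_mulVec, Matrix.one_mulVec, Matrix.smul_mulVec,
    Matrix.vecMulVec_mulVec, smul_smul, op_smul_eq_smul]

theorem continuous_refl {X : Type*} [TopologicalSpace X] {u : X → Fin N → ℝ} (hu : Continuous u)
    (h0 : ∀ x, u x ≠ 0) : Continuous fun x => refl (u x) := by
  refine Continuous.subtype_mk ?_ _
  have hd : Continuous fun x => u x ⬝ᵥ u x := hu.dotProduct hu
  exact continuous_const.sub ((continuous_const.div hd fun x => by simpa using h0 x).smul
    (hu.matrix_vecMulVec hu))

end Reflections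

/-! ### `π_m(O(m+1))` is infinite for odd `m ≥ 2` -/

section InfiniteHomotopyGroup

open Set

/-- The unit vector in `ℝ^(m+1)` whose reflection composed with the reflection in the first basis
vector takes the first basis vector to `radialMap k x`. -/
def halfRadialMap {m : ℕ} (k : ℕ) (x : Fin m → ℝ) : Fin (m + 1) → ℝ :=
  Fin.cons (Real.cos (angle k (x ⬝ᵥ x) / 2))
    ((Real.sin (angle k (x ⬝ᵥ x) / 2) / Real.sqrt (x ⬝ᵥ x)) • x)

theorem continuous_halfRadialMap {m : ℕ} (k : ℕ) : Continuous (halfRadialMap (m := m) k) := by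
  have ha : Continuous (angle k) := (contDiff_angle k (n := 0)).continuous
  have hd : Continuous fun x : Fin m → ℝ => x ⬝ᵥ x := continuous_id.dotProduct continuous_id
  have hc : Continuous fun s => Real.sin (angle k s / 2) / Real.sqrt s := by
    rw [continuous_iff_continuousAt]
    intro s
    rcases lt_or_ge s (1 / 4) with hs | hs
    · have : (fun s => Real.sin (angle k s / 2) / Real.sqrt s) =ᶠ[𝓝 s] fun _ => 0 := by
        filter_upwards [Iio_mem_nhds hs] with t ht
        simp [angle_of_le (le_of_lt ht)]
      exact continuousAt_const.congr this.symm
    · exact ContinuousAt.div (by fun_prop) (by fun_prop) (Real.sqrt_ne_zero'.2 (by linarith))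
  rw [continuous_pi_iff]
  intro i
  refine Fin.cases ?_ (fun j => ?_) i
  · exact Real.continuous_cos.comp ((ha.comp hd).div_const 2)
  · exact (hc.comp hd).mul (continuous_apply j)

theorem dotProduct_cons {m : ℕ} (a b : ℝ) (x y : Fin m → ℝ) :
    (Fin.cons a x : Fin (m + 1) → ℝ) ⬝ᵥ (Fin.cons b y : Fin (m + 1) → ℝ) = a * b + x ⬝ᵥ y := by
  simp [dotProduct, Fin.sum_univ_succ]

theorem halfRadialMap_dot {m : ℕ} (k : ℕ) (x : Fin m → ℝ) :
    halfRadialMap k x ⬝ᵥ halfRadialMap k x = 1 := by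
  rw [halfRadialMap, dotProduct_cons]
  simp only [smul_dotProduct, dotProduct_smul, smul_eq_mul]
  generalize hs : x ⬝ᵥ x = s
  rcases lt_or_ge s (1 / 4) with h | h
  · simp [angle_of_le h.le]
  · have hs0 : 0 < s := by linarith
    have hsq := Real.mul_self_sqrt hs0.le
    have hr0 := Real.sqrt_ne_zero'.2 hs0
    have hcs := Real.sin_sq_add_cos_sq (angle k s / 2)
    generalize Real.sin (angle k s / 2) = S at *
    generalize Real.cos (angle k s / 2) = C at *
    generalize Real.sqrt s = r at *
    subst hsq
    field_simp
    linarith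

theorem halfRadialMap_ne_zero {m : ℕ} (k : ℕ) (x : Fin m → ℝ) : halfRadialMap k x ≠ 0 := fun h => by
  simpa [h] using halfRadialMap_dot k x

theorem radialMap_of_ge {m : ℕ} (k : ℕ) {x : Fin m → ℝ} (hx : 1 ≤ x ⬝ᵥ x) :
    radialMap k x = Pi.single 0 1 := by
  funext i
  refine Fin.cases ?_ (fun j => ?_) i
  · simp [radialMap, angle_of_ge hx, mul_comm _ (k : ℝ)]
  · have : Real.sin (2 * Real.pi * k) = 0 := by
      rw [show 2 * Real.pi * k = (2 * k : ℕ) * Real.pi by push_cast; ring, Real.sin_nat_mul_pi]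
    simp [radialMap, radialCoeff, angle_of_ge hx, this]

/-- The first column of `R_c R_e` with `c = halfRadialMap k x` is `radialMap k x`. -/
theorem refl_halfRadialMap_col {m : ℕ} (k : ℕ) (x : Fin m → ℝ) :
    ((refl (halfRadialMap k x) * refl (Pi.single 0 1) : O (m + 1)) :
      Matrix (Fin (m + 1)) (Fin (m + 1)) ℝ) *ᵥ Pi.single 0 1 = radialMap k x := by
  have h1 : ((refl (halfRadialMap k x) * refl (Pi.single 0 1) : O (m + 1)) :
      Matrix (Fin (m + 1)) (Fin (m + 1)) ℝ) =
      reflMatrix (halfRadialMap k x) * reflMatrix (Pi.single 0 1) := rfl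
  rw [h1, ← Matrix.mulVec_mulVec, reflMatrix_mulVec (Pi.single 0 1), reflMatrix_mulVec,
    halfRadialMap_dot]
  have e1 : (Pi.single 0 1 : Fin (m + 1) → ℝ) ⬝ᵥ Pi.single 0 1 = 1 := by simp
  have e2 : (Pi.single 0 1 : Fin (m + 1) → ℝ) - (2 / 1 * 1 : ℝ) • Pi.single 0 1 =
      -Pi.single 0 1 := by
    norm_num
    rw [two_smul]
    abel
  rw [e1, e2, dotProduct_neg, dotProduct_single]
  -- A product of two reflections rotates by twice the angle between their axes, which is why
  -- `halfRadialMap` uses half of the angle.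
  have hcos : Real.cos (angle k (x ⬝ᵥ x)) = 2 * Real.cos (angle k (x ⬝ᵥ x) / 2) ^ 2 - 1 := by
    rw [← Real.cos_two_mul]; ring_nf
  have hsin : Real.sin (angle k (x ⬝ᵥ x)) =
      2 * Real.sin (angle k (x ⬝ᵥ x) / 2) * Real.cos (angle k (x ⬝ᵥ x) / 2) := by
    rw [← Real.sin_two_mul]; ring_nf
  funext i
  refine Fin.cases ?_ (fun j => ?_) i
  · simp only [radialMap, halfRadialMap, Fin.cons_zero, Pi.sub_apply, Pi.neg_apply, Pi.smul_apply,
      Pi.single_eq_same, smul_eq_mul, hcos]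
    ring
  · simp only [radialMap, halfRadialMap, Fin.cons_zero, Fin.cons_succ, Pi.sub_apply, Pi.neg_apply,
      Pi.smul_apply, smul_eq_mul, radialCoeff, hsin]
    rw [Pi.single_eq_of_ne (Fin.succ_ne_zero j)]
    ring

theorem refl_halfRadialMap_of_ge {m : ℕ} (k : ℕ) {x : Fin m → ℝ} (hx : 1 ≤ x ⬝ᵥ x) :
    refl (halfRadialMap k x) * refl (Pi.single 0 1) = 1 := by
  have hsin : Real.sin (2 * Real.pi * k / 2) = 0 := by
    rw [show 2 * Real.pi * k / 2 = k * Real.pi by ring, Real.sin_nat_mul_pi]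
  have hcos : Real.cos (2 * Real.pi * k / 2) ≠ 0 := fun h => by
    have := Real.sin_sq_add_cos_sq (2 * Real.pi * k / 2)
    simp [hsin, h] at this
  have : halfRadialMap k x = Real.cos (2 * Real.pi * k / 2) • Pi.single 0 1 := by
    funext i
    refine Fin.cases ?_ (fun j => ?_) i
    · simp [halfRadialMap, angle_of_ge hx]
    · simp [halfRadialMap, angle_of_ge hx, hsin]
  rw [this, refl_smul _ hcos, refl_mul_self]

theorem one_le_dotProduct_self' {m : ℕ} {x : Fin m → ℝ} {i : Fin m} (h : 1 ≤ |x i|) :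
    1 ≤ x ⬝ᵥ x := by
  have h1 : x i * x i ≤ x ⬝ᵥ x :=
    Finset.single_le_sum (f := fun j => x j * x j) (fun j _ => mul_self_nonneg _)
      (Finset.mem_univ i)
  have h2 : x i * x i = |x i| * |x i| := (abs_mul_abs_self _).symm
  nlinarith

/-- A generalized loop in `O(m+1)` whose first column wraps the cube `2k` times around the
sphere. -/
def radialLoop (m k : ℕ) : GenLoop (Fin m) (O (m + 1)) 1 :=
  ⟨⟨fun t => refl (halfRadialMap k fun i => 2 * (t i : ℝ) - 1) * refl (Pi.single 0 1),
    (continuous_refl ((continuous_halfRadialMap k).comp (by fun_prop))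
      fun _ => halfRadialMap_ne_zero k _).mul continuous_const⟩, by
    rintro t ⟨i, hi⟩
    refine refl_halfRadialMap_of_ge k (one_le_dotProduct_self' (i := i) ?_)
    rcases hi with hi | hi
    · simp [hi]
    · norm_num [hi]⟩

/-- Evaluating a homotopy of loops on the first basis vector gives a homotopy of sphere-valued maps
from `radialMap j` to `radialMap k`, constant outside the cube, so the degree integrals `c j` and `c
k` agree. -/
theorem radialLoop_injective {m : ℕ} (hm : 2 ≤ m) (hodd : Odd m) {j k : ℕ}
    (h : GenLoop.Homotopic (radialLoop m j) (radialLoop m k)) : j = k := by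
  obtain ⟨G⟩ := h
  -- Clamping extends the homotopy from the cube to all of `ℝ^m`: points on or outside the faces of
  -- `[-1, 1]^m` go to the boundary, where loops equal `1`. Time is clamped in the same way in `H`.
  let c : (Fin m → ℝ) → (Fin m → I) := fun x i => projIcc 0 1 zero_le_one ((x i + 1) / 2)
  have hc : Continuous c := continuous_pi fun i => continuous_projIcc.comp (by fun_prop)
  have hcb : ∀ x i, 1 ≤ |x i| → c x ∈ Cube.boundary (Fin m) := by
    intro x i hi
    refine ⟨i, ?_⟩
    rcases le_abs.1 hi with h | h
    · exact Or.inr (projIcc_of_right_le _ (by linarith))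
    · exact Or.inl (projIcc_of_le_left _ (by linarith))
  have hloop : ∀ (k : ℕ) (x : Fin m → ℝ),
      (radialLoop m k (c x) : Matrix (Fin (m + 1)) (Fin (m + 1)) ℝ) *ᵥ Pi.single 0 1 =
        radialMap k x := by
    intro k x
    by_cases hx : ∃ i, 1 ≤ |x i|
    · obtain ⟨i, hi⟩ := hx
      rw [GenLoop.boundary (radialLoop m k) _ (hcb x i hi), radialMap_of_ge k (one_le_dotProduct_self' hi)]
      exact Matrix.one_mulVec _
    · push Not at hx
      rw [← refl_halfRadialMap_col]
      have : (fun i => 2 * (c x i : ℝ) - 1) = x := by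
        funext i
        have := abs_lt.1 (hx i)
        simp only [c]
        rw [projIcc_of_mem zero_le_one ⟨by linarith, by linarith⟩]
        ring
      change ((refl (halfRadialMap k fun i => 2 * (c x i : ℝ) - 1) * refl (Pi.single 0 1) :
        O (m + 1)) : Matrix (Fin (m + 1)) (Fin (m + 1)) ℝ) *ᵥ _ = _
      rw [this]
  let H : ℝ → (Fin m → ℝ) → (Fin (m + 1) → ℝ) := fun t x =>
    (G (projIcc 0 1 zero_le_one t, c x) : Matrix (Fin (m + 1)) (Fin (m + 1)) ℝ) *ᵥ Pi.single 0 1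
  have hH : Continuous fun p : ℝ × (Fin m → ℝ) => H p.1 p.2 := by
    refine Continuous.matrix_mulVec ?_ continuous_const
    exact continuous_subtype_val.comp (G.continuous.comp
      ((continuous_projIcc.comp continuous_fst).prodMk (hc.comp continuous_snd)))
  have key := degInt_eq_of_homotopy (f₀ := radialMap j) (f₁ := radialMap k)
    (contDiff_radialMap j) (contDiff_radialMap k) (Pi.single 0 1) hH ?_ ?_ ?_ ?_
  · obtain ⟨a, ha, hdeg⟩ := degInt_radialMap hm hodd
    rw [hdeg, hdeg] at key
    exact_mod_cast mul_left_cancel₀ ha.ne' key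
  · intro t x
    simp only [H]
    rw [Matrix.dotProduct_mulVec, Matrix.vecMul_mulVec]
    have := (G (projIcc 0 1 zero_le_one t, c x)).2
    rw [Matrix.mem_orthogonalGroup_iff'] at this
    rw [this]
    simp
  · intro t x i hi
    simp only [H]
    rw [G.eq_fst _ (hcb x i hi)]
    change (radialLoop m j (c x) : Matrix (Fin (m + 1)) (Fin (m + 1)) ℝ) *ᵥ Pi.single 0 1 = _
    rw [GenLoop.boundary (radialLoop m j) _ (hcb x i hi)]
    exact Matrix.one_mulVec _
  · intro t ht
    funext x
    simp only [H]
    rw [projIcc_of_le_left _ ht, ← hloop j x]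
    congr 2
    exact G.apply_zero (c x)
  · intro t ht
    funext x
    simp only [H]
    rw [projIcc_of_right_le _ ht, ← hloop k x]
    congr 2
    exact G.apply_one (c x)

theorem infinite_homotopyGroup_orthogonal {m N : ℕ} (hm : 2 ≤ m) (hodd : Odd m) (hN : N = m + 1) :
    Infinite (π_ m (O N) 1) := by
  subst hN
  refine Infinite.of_injective
    (fun k : ℕ => (Quotient.mk _ (radialLoop m k) : π_ m (O (m + 1)) 1)) fun j k h => ?_
  exact radialLoop_injective hm hodd (Quotient.exact h)

end InfiniteHomotopyGroup

/-! ### An explicit collapse of the cube onto the sphere -/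

section Collapse

open Set

/-- The collapse `[-1,1]^m → S^m` in coordinates: the inverse stereographic projection of
`x / (1 - ‖x‖)` for the sup norm, in homogeneous form. -/
def collapseVec {m : ℕ} (x : Fin m → ℝ) : Fin (m + 1) → ℝ :=
  Fin.cons ((x ⬝ᵥ x - (1 - ‖x‖) ^ 2) / (x ⬝ᵥ x + (1 - ‖x‖) ^ 2))
    ((2 * (1 - ‖x‖) / (x ⬝ᵥ x + (1 - ‖x‖) ^ 2)) • x)

theorem collapseVec_denom_pos {m : ℕ} (x : Fin m → ℝ) : 0 < x ⬝ᵥ x + (1 - ‖x‖) ^ 2 := by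
  have h0 : 0 ≤ x ⬝ᵥ x := Finset.sum_nonneg fun i _ => mul_self_nonneg _
  by_cases hx : x = 0
  · simp [hx]
  · have : x ⬝ᵥ x ≠ 0 := fun h => hx (dotProduct_self_eq_zero.1 h)
    positivity

theorem continuous_collapseVec {m : ℕ} : Continuous (collapseVec (m := m)) := by
  have hd : Continuous fun x : Fin m → ℝ => x ⬝ᵥ x := continuous_id.dotProduct continuous_id
  rw [continuous_pi_iff]
  intro i
  refine Fin.cases ?_ (fun j => ?_) i
  · exact Continuous.div (by fun_prop) (by fun_prop) fun x => (collapseVec_denom_pos x).ne'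
  · exact (Continuous.div (by fun_prop) (by fun_prop)
      fun x => (collapseVec_denom_pos x).ne').mul (continuous_apply j)

theorem collapseVec_dot {m : ℕ} (x : Fin m → ℝ) : collapseVec x ⬝ᵥ collapseVec x = 1 := by
  have := collapseVec_denom_pos x
  rw [collapseVec, dotProduct_cons]
  simp only [smul_dotProduct, dotProduct_smul, smul_eq_mul]
  field_simp
  ring

/-- The affine identification of `[0,1]^m` with `[-1,1]^m`. -/
def cubeCoord {m : ℕ} (t : Fin m → I) (i : Fin m) : ℝ := 2 * (t i : ℝ) - 1

theorem continuous_cubeCoord {m : ℕ} : Continuous (cubeCoord (m := m)) := by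
  unfold cubeCoord
  fun_prop

theorem cubeCoord_injective {m : ℕ} : Function.Injective (cubeCoord (m := m)) := fun s t h => by
  funext i
  have := congrFun h i
  simp only [cubeCoord] at this
  exact Subtype.ext (by linarith)

theorem abs_cubeCoord_le {m : ℕ} (t : Fin m → I) (i : Fin m) : |cubeCoord t i| ≤ 1 := by
  have h0 := (t i).2.1
  have h1 := (t i).2.2
  rw [abs_le, cubeCoord]
  constructor <;> linarith

theorem norm_cubeCoord_le {m : ℕ} (t : Fin m → I) : ‖cubeCoord t‖ ≤ 1 :=
  (pi_norm_le_iff_of_nonneg zero_le_one).2 fun i => abs_cubeCoord_le t i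

theorem exists_cubeCoord_eq {m : ℕ} {x : Fin m → ℝ} (hx : ‖x‖ ≤ 1) :
    ∃ t : Fin m → I, cubeCoord t = x := by
  have h : ∀ i, |x i| ≤ 1 := (pi_norm_le_iff_of_nonneg zero_le_one).1 hx
  refine ⟨fun i => ⟨(x i + 1) / 2, ?_, ?_⟩, ?_⟩
  · linarith [(abs_le.1 (h i)).1]
  · linarith [(abs_le.1 (h i)).2]
  · funext i
    simp only [cubeCoord]
    ring

theorem mem_boundary_iff_norm_cubeCoord {m : ℕ} (hm : 1 ≤ m) (t : Fin m → I) :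
    t ∈ Cube.boundary (Fin m) ↔ ‖cubeCoord t‖ = 1 := by
  constructor
  · rintro ⟨i, hi⟩
    refine le_antisymm (norm_cubeCoord_le t) ?_
    have h1 : ‖cubeCoord t i‖ = 1 := by
      rcases hi with hi | hi
      · simp [cubeCoord, hi]
      · norm_num [cubeCoord, hi]
    exact h1 ▸ norm_le_pi_norm _ i
  · intro h
    by_contra hcon
    have hlt : ∀ i, ‖cubeCoord t i‖ < 1 := by
      intro i
      refine lt_of_le_of_ne (abs_cubeCoord_le t i) fun hi => hcon ⟨i, ?_⟩
      rcases eq_or_eq_neg_of_abs_eq hi with h' | h'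
      · exact Or.inr (Subtype.ext (by simp only [cubeCoord] at h'; simp only [Icc.coe_one]; linarith))
      · exact Or.inl (Subtype.ext (by simp only [cubeCoord] at h'; simp only [Icc.coe_zero]; linarith))
    have hne : Nonempty (Fin m) := ⟨⟨0, by omega⟩⟩
    exact absurd h ((pi_norm_lt_iff one_pos).2 hlt).ne

theorem toLp_mem_sphere {N : ℕ} {v : Fin N → ℝ} (hv : v ⬝ᵥ v = 1) :
    WithLp.toLp 2 v ∈ Metric.sphere (0 : E N) 1 := by
  rw [mem_sphere_zero_iff_norm, EuclideanSpace.norm_eq]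
  simp only [Real.norm_eq_abs, sq_abs, Real.sqrt_eq_one]
  rw [← hv]
  exact Finset.sum_congr rfl fun i _ => sq _

theorem sphere_dot {N : ℕ} (x : Metric.sphere (0 : E N) 1) : x.1.ofLp ⬝ᵥ x.1.ofLp = 1 := by
  have h := mem_sphere_zero_iff_norm.1 x.2
  have h2 := EuclideanSpace.real_norm_sq_eq x.1
  rw [h] at h2
  simp only [one_pow] at h2
  refine Eq.trans ?_ h2.symm
  exact Finset.sum_congr rfl fun i _ => (sq _).symm

/-- The first coordinate detects whether `‖x‖ = 1`. In the interior the value recovers `x / (1 -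
‖x‖)`; comparing norms gives `‖x‖ = ‖y‖`, and then `x = y`. -/
theorem collapseVec_eq_iff {m : ℕ} {x y : Fin m → ℝ} (hx : ‖x‖ ≤ 1) (hy : ‖y‖ ≤ 1) :
    collapseVec x = collapseVec y ↔ x = y ∨ (‖x‖ = 1 ∧ ‖y‖ = 1) := by
  constructor
  · intro h
    have h0 : (x ⬝ᵥ x - (1 - ‖x‖) ^ 2) / (x ⬝ᵥ x + (1 - ‖x‖) ^ 2) =
        (y ⬝ᵥ y - (1 - ‖y‖) ^ 2) / (y ⬝ᵥ y + (1 - ‖y‖) ^ 2) := by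
      simpa [collapseVec] using congrFun h 0
    have h1 : (2 * (1 - ‖x‖) / (x ⬝ᵥ x + (1 - ‖x‖) ^ 2)) • x =
        (2 * (1 - ‖y‖) / (y ⬝ᵥ y + (1 - ‖y‖) ^ 2)) • y := by
      funext i
      simpa [collapseVec] using congrFun h i.succ
    have px := collapseVec_denom_pos x
    have py := collapseVec_denom_pos y
    have h2 : 2 * (1 - ‖x‖) ^ 2 / (x ⬝ᵥ x + (1 - ‖x‖) ^ 2) =
        2 * (1 - ‖y‖) ^ 2 / (y ⬝ᵥ y + (1 - ‖y‖) ^ 2) := by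
      have ex : ∀ s d : ℝ, 0 < s + d → 2 * d / (s + d) = 1 - (s - d) / (s + d) := by
        intro s d h
        field_simp
        ring
      rw [ex _ _ px, ex _ _ py, h0]
    by_cases hx1 : 1 - ‖x‖ = 0
    · have : (1 - ‖y‖) = 0 := by
        rw [hx1] at h2
        simp only [ne_eq, OfNat.ofNat_ne_zero, not_false_eq_true, zero_pow, mul_zero, zero_div] at h2
        by_contra hne
        have : 0 < 2 * (1 - ‖y‖) ^ 2 / (y ⬝ᵥ y + (1 - ‖y‖) ^ 2) := by positivity
        linarith
      exact Or.inr ⟨by linarith, by linarith⟩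
    · have dx : 0 < 1 - ‖x‖ := lt_of_le_of_ne (by linarith) (Ne.symm hx1)
      have dy : 0 < 1 - ‖y‖ := by
        refine lt_of_le_of_ne (by linarith) fun h3 => ?_
        rw [← h3] at h2
        simp only [ne_eq, OfNat.ofNat_ne_zero, not_false_eq_true, zero_pow, mul_zero, zero_div] at h2
        have : 0 < 2 * (1 - ‖x‖) ^ 2 / (x ⬝ᵥ x + (1 - ‖x‖) ^ 2) := by positivity
        linarith
      have h4 : (1 - ‖y‖) • x = (1 - ‖x‖) • y := by
        generalize x ⬝ᵥ x + (1 - ‖x‖) ^ 2 = a at *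
        generalize y ⬝ᵥ y + (1 - ‖y‖) ^ 2 = b at *
        funext i
        have h1i := congrFun h1 i
        simp only [Pi.smul_apply, smul_eq_mul] at h1i ⊢
        have e1 : 2 * (1 - ‖x‖) / a = 2 * (1 - ‖x‖) ^ 2 / a / (1 - ‖x‖) := by field_simp
        have e2 : 2 * (1 - ‖y‖) / b = 2 * (1 - ‖x‖) ^ 2 / a / (1 - ‖y‖) := by
          rw [h2]; field_simp
        rw [e1, e2] at h1i
        have hpos : 2 * (1 - ‖x‖) ^ 2 / a ≠ 0 := by positivity
        field_simp at h1i
        linarith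
      have h5 : ‖x‖ = ‖y‖ := by
        have := congrArg norm h4
        rw [norm_smul, norm_smul, Real.norm_of_nonneg dy.le, Real.norm_of_nonneg dx.le] at this
        linarith
      rw [h5] at h4
      exact Or.inl (smul_right_injective _ (ne_of_gt dy) h4)
  · rintro (rfl | ⟨h1, h2⟩)
    · rfl
    · have hx0 := collapseVec_denom_pos x
      have hy0 := collapseVec_denom_pos y
      simp only [collapseVec, h1, h2, sub_self, ne_eq, OfNat.ofNat_ne_zero, not_false_eq_true,
        zero_pow, add_zero, sub_zero, mul_zero, zero_div, zero_smul] at hx0 hy0 ⊢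
      rw [div_self hx0.ne', div_self hy0.ne']

/-- Away from the pole, project stereographically to `y` and take `y / (1 + ‖y‖)`, the inverse of `x
↦ x / (1 - ‖x‖)`. The pole is the image of any boundary point, for instance the all-ones vector. -/
theorem exists_collapseVec_eq {m : ℕ} (hm : 1 ≤ m) {v : Fin (m + 1) → ℝ} (hv : v ⬝ᵥ v = 1) :
    ∃ x : Fin m → ℝ, ‖x‖ ≤ 1 ∧ collapseVec x = v := by
  obtain ⟨w, u, rfl⟩ : ∃ w u, v = Fin.cons w u := ⟨v 0, Fin.tail v, (Fin.cons_self_tail v).symm⟩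
  rw [dotProduct_cons] at hv
  have hu0 : 0 ≤ u ⬝ᵥ u := Finset.sum_nonneg fun i _ => mul_self_nonneg _
  have hne : Nonempty (Fin m) := ⟨⟨0, by omega⟩⟩
  by_cases hw : w = 1
  · subst hw
    have hu : u = 0 := dotProduct_self_eq_zero.1 (by linarith)
    have h1 : ‖(fun _ => 1 : Fin m → ℝ)‖ = 1 := by rw [pi_norm_const]; simp
    have hp := collapseVec_denom_pos (fun _ => 1 : Fin m → ℝ)
    refine ⟨fun _ => 1, h1.le, ?_⟩
    rw [collapseVec]
    rw [h1] at hp ⊢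
    simp only [sub_self, ne_eq, OfNat.ofNat_ne_zero, not_false_eq_true,
        zero_pow, add_zero, sub_zero, mul_zero, zero_div, zero_smul] at hp ⊢
    rw [div_self hp.ne', hu]
  · have hw' : 1 - w ≠ 0 := fun h => hw (by linarith)
    let y := (1 - w)⁻¹ • u
    let d := (1 + ‖y‖)⁻¹
    have hy0 : 0 < 1 + ‖y‖ := by positivity
    have hd : 0 < d := inv_pos.2 hy0
    have hdy : d * (1 + ‖y‖) = 1 := inv_mul_cancel₀ hy0.ne'
    have hn : ‖d • y‖ = 1 - d := by
      rw [norm_smul, Real.norm_of_nonneg hd.le]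
      linarith
    have hyy : y ⬝ᵥ y = (1 + w) / (1 - w) := by
      simp only [y, smul_dotProduct, dotProduct_smul, smul_eq_mul]
      have : u ⬝ᵥ u = (1 + w) * (1 - w) := by linarith
      rw [this]
      field_simp
    refine ⟨d • y, by rw [hn]; linarith, ?_⟩
    have e1 : (d • y) ⬝ᵥ (d • y) = d ^ 2 * ((1 + w) / (1 - w)) := by
      simp only [smul_dotProduct, dotProduct_smul, smul_eq_mul, hyy]
      ring
    have e2 : (d • y) ⬝ᵥ (d • y) + (1 - ‖d • y‖) ^ 2 = d ^ 2 * (2 / (1 - w)) := by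
      rw [e1, hn]
      field_simp
      ring
    have hd0 := hd.ne'
    rw [collapseVec, e2, e1, hn]
    congr 1
    · field_simp
      ring
    · simp only [y, smul_smul, sub_sub_cancel]
      have : 2 * d / (d ^ 2 * (2 / (1 - w))) * (d * (1 - w)⁻¹) = 1 := by
        field_simp
      rw [this, one_smul]

/-- Provides cube coordinates where no collapse is given: for the vanishing of `π_2`, for the
constancy of determinants, and for counting all components. -/
theorem exists_isCollapse {m : ℕ} (hm : 1 ≤ m) : ∃ q : C(Fin m → I, Sph m), IsCollapse q := by
  refine ⟨⟨fun t => ⟨WithLp.toLp 2 (collapseVec (cubeCoord t)),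
    toLp_mem_sphere (collapseVec_dot _)⟩, ?_⟩, ?_, ?_⟩
  · exact ((PiLp.continuous_toLp 2 _).comp
      (continuous_collapseVec.comp continuous_cubeCoord)).subtype_mk _
  · intro v
    obtain ⟨x, hx, hxv⟩ := exists_collapseVec_eq hm (sphere_dot v)
    obtain ⟨t, rfl⟩ := exists_cubeCoord_eq hx
    exact ⟨t, Subtype.ext (by simp [hxv])⟩
  · intro s t
    rw [mem_boundary_iff_norm_cubeCoord hm, mem_boundary_iff_norm_cubeCoord hm,
      ← cubeCoord_injective.eq_iff (a := s),
      ← collapseVec_eq_iff (norm_cubeCoord_le s) (norm_cubeCoord_le t)]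
    simp [Subtype.ext_iff]

/-- The boundary of a square is connected. -/
theorem isPreconnected_boundary_square : IsPreconnected (Cube.boundary (Fin 2)) := by
  have h := (isConnected_sphere (E := Fin 2 → ℝ) (by simp) 0
    (zero_le_one (α := ℝ))).isPreconnected
  let c : (Fin 2 → ℝ) → (Fin 2 → I) := fun x i => projIcc 0 1 zero_le_one ((x i + 1) / 2)
  have hc : Continuous c := continuous_pi fun i => continuous_projIcc.comp (by fun_prop)
  have himg : c '' Metric.sphere 0 1 = Cube.boundary (Fin 2) := by
    have hcc : ∀ t : Fin 2 → I, c (cubeCoord t) = t := by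
      intro t
      funext i
      have : (cubeCoord t i + 1) / 2 = t i := by simp [cubeCoord]
      simp only [c, this]
      exact projIcc_val _ _
    ext t
    rw [mem_boundary_iff_norm_cubeCoord (by norm_num)]
    constructor
    · rintro ⟨x, hx, rfl⟩
      rw [mem_sphere_zero_iff_norm] at hx
      obtain ⟨t, rfl⟩ := exists_cubeCoord_eq hx.le
      rw [hcc, hx]
    · intro ht
      exact ⟨cubeCoord t, by simpa using ht, hcc t⟩
  rw [← himg]
  exact h.image c hc.continuousOn

end Collapse

/-! ### Rotations carrying one unit vector to another -/

section Rotations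

open Set

theorem homotopic_of_continuous {X Y : Type*} [TopologicalSpace X] [TopologicalSpace Y]
    {f g : C(X, Y)} (H : I → X → Y) (hH : Continuous fun p : I × X => H p.1 p.2)
    (h0 : ∀ x, H 0 x = f x) (h1 : ∀ x, H 1 x = g x) : f.Homotopic g :=
  ⟨⟨⟨fun p => H p.1 p.2, hH⟩, h0, h1⟩⟩

theorem Homotopic.mul {X G : Type*} [TopologicalSpace X] [TopologicalSpace G] [Mul G]
    [ContinuousMul G] {f f' g g' : C(X, G)} (h : f.Homotopic f') (h' : g.Homotopic g') :
    (f * g).Homotopic (f' * g') := by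
  obtain ⟨F⟩ := h
  obtain ⟨F'⟩ := h'
  exact homotopic_of_continuous (fun t x => F (t, x) * F' (t, x))
    (F.continuous.mul F'.continuous) (by simp) (by simp)

theorem Homotopic.inv {X G : Type*} [TopologicalSpace X] [TopologicalSpace G] [Group G]
    [IsTopologicalGroup G] {f f' : C(X, G)} (h : f.Homotopic f') : (f⁻¹).Homotopic f'⁻¹ := by
  obtain ⟨F⟩ := h
  exact homotopic_of_continuous (fun t x => (F (t, x))⁻¹) F.continuous.inv (by simp) (by simp)

variable {N : ℕ} {X : Type*} [TopologicalSpace X]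

theorem O_transpose_mul (A : O N) :
    (A : Matrix (Fin N) (Fin N) ℝ)ᵀ * (A : Matrix (Fin N) (Fin N) ℝ) = 1 :=
  (Matrix.mem_orthogonalGroup_iff' _ _).1 A.2

theorem O_mul_transpose (A : O N) :
    (A : Matrix (Fin N) (Fin N) ℝ) * (A : Matrix (Fin N) (Fin N) ℝ)ᵀ = 1 :=
  (Matrix.mem_orthogonalGroup_iff _ _).1 A.2

theorem O_mulVec_dot (A : O N) (v w : Fin N → ℝ) :
    (A.1 *ᵥ v) ⬝ᵥ (A.1 *ᵥ w) = v ⬝ᵥ w := by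
  rw [Matrix.dotProduct_mulVec, Matrix.vecMul_mulVec, O_transpose_mul, Matrix.vecMul_one]

theorem O_det (A : O N) : A.1.det = 1 ∨ A.1.det = -1 := by
  have h := congrArg Matrix.det (O_mul_transpose A)
  rw [Matrix.det_mul, Matrix.det_transpose, Matrix.det_one] at h
  exact mul_self_eq_one_iff.1 h

theorem continuous_O_det : Continuous fun A : O N => A.1.det :=
  continuous_subtype_val.matrix_det

/-- The determinant of a continuous family of orthogonal matrices over a connected space is
constant. -/
theorem O_det_eq [PreconnectedSpace X] {A : X → O N} (hA : Continuous A) (x y : X) :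
    (A x).1.det = (A y).1.det := by
  have hc : Continuous fun x => (A x).1.det := continuous_O_det.comp hA
  have hr := isPreconnected_range hc
  by_contra hne
  have h0 : (0 : ℝ) ∈ range fun x => (A x).1.det := by
    rcases O_det (A x) with h1 | h1 <;> rcases O_det (A y) with h2 | h2
    · exact absurd (h1.trans h2.symm) hne
    · exact hr.Icc_subset ⟨y, rfl⟩ ⟨x, rfl⟩ ⟨by simp [h2], by simp [h1]⟩
    · exact hr.Icc_subset ⟨x, rfl⟩ ⟨y, rfl⟩ ⟨by simp [h1], by simp [h2]⟩
    · exact absurd (h1.trans h2.symm) hne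
  obtain ⟨z, hz⟩ := h0
  rcases O_det (A z) with h | h <;> simp [h] at hz

theorem det_eq_of_homotopic {A B : C(X, O N)} (h : A.Homotopic B) (x : X) :
    (A x).1.det = (B x).1.det := by
  obtain ⟨F⟩ := h
  have := O_det_eq (A := fun t : I => F (t, x)) (by fun_prop) 0 1
  simpa using this

/-- The rotation in the plane spanned by `u` and `w` taking the unit vector `u` to the unit
vector `w`. -/
def rot (u w : Fin N → ℝ) : O N := refl (u + w) * refl u

theorem rot_self (u : Fin N → ℝ) : rot u u = 1 := by
  rw [rot, ← two_smul ℝ u, refl_smul _ two_ne_zero, refl_mul_self]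

/-- The first reflection sends `u` to `-u`. The second, along `u + w`, sends `-u` to `w` because `u`
and `w` have the same length. -/
theorem rot_mulVec {u w : Fin N → ℝ} (hu : u ⬝ᵥ u = 1) (hw : w ⬝ᵥ w = 1) (h : u + w ≠ 0) :
    (rot u w).1 *ᵥ u = w := by
  have h1 : (rot u w).1 = reflMatrix (u + w) * reflMatrix u := rfl
  have h2 : (u + w) ⬝ᵥ (u + w) ≠ 0 := fun h' => h (dotProduct_self_eq_zero.1 h')
  have h3 : u - (2 / 1 * 1 : ℝ) • u = -u := by
    rw [div_one, mul_one, two_smul]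
    abel
  have h4 : 2 / ((u + w) ⬝ᵥ (u + w)) * ((u + w) ⬝ᵥ (-u)) = -1 := by
    have e : (u + w) ⬝ᵥ (u + w) = -2 * ((u + w) ⬝ᵥ (-u)) := by
      simp only [dotProduct_neg, add_dotProduct, dotProduct_add, hu, hw, dotProduct_comm w u]
      ring
    rw [e] at h2 ⊢
    have h5 : (u + w) ⬝ᵥ (-u) ≠ 0 := fun h' => h2 (by rw [h', mul_zero])
    field_simp
  rw [h1, ← Matrix.mulVec_mulVec, reflMatrix_mulVec u, hu, h3, reflMatrix_mulVec, h4]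
  simp

theorem dot_gt_neg_one {u w : Fin N → ℝ} (hu : u ⬝ᵥ u = 1) (hw : w ⬝ᵥ w = 1) (h : u + w ≠ 0) :
    -1 < u ⬝ᵥ w := by
  have h2 : 0 < (u + w) ⬝ᵥ (u + w) := by simpa using Matrix.dotProduct_star_self_pos_iff.2 h
  simp only [add_dotProduct, dotProduct_add, hu, hw, dotProduct_comm w u] at h2
  linarith

theorem continuous_rot {u w : X → Fin N → ℝ} (hu : Continuous u) (hw : Continuous w)
    (h0 : ∀ x, u x ≠ 0) (h : ∀ x, u x + w x ≠ 0) : Continuous fun x => rot (u x) (w x) :=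
  (continuous_refl (hu.add hw) h).mul (continuous_refl hu h0)

theorem ne_zero_of_unit {u : Fin N → ℝ} (hu : u ⬝ᵥ u = 1) : u ≠ 0 := by
  rintro rfl
  simp at hu

/-- The rotations taking `u x` to `w x`, as a continuous map. -/
def rotMap (u w : C(X, Fin N → ℝ)) (hu : ∀ x, u x ⬝ᵥ u x = 1) (h : ∀ x, u x + w x ≠ 0) :
    C(X, O N) :=
  ⟨fun x => rot (u x) (w x),
    continuous_rot u.continuous w.continuous (fun x => ne_zero_of_unit (hu x)) h⟩

/-- Slide `w` back to `u` along the straight segment. The points of the segment need not be unit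
vectors, since only the line through `u` plus the point matters. -/
theorem rotMap_homotopic_one (u w : C(X, Fin N → ℝ)) (hu : ∀ x, u x ⬝ᵥ u x = 1)
    (hw : ∀ x, w x ⬝ᵥ w x = 1) (h : ∀ x, u x + w x ≠ 0) : (rotMap u w hu h).Homotopic 1 := by
  refine homotopic_of_continuous
    (fun t x => rot (u x) ((1 - (t : ℝ)) • w x + (t : ℝ) • u x)) ?_ ?_ ?_
  · refine continuous_rot (by fun_prop) (by fun_prop) (fun p => ne_zero_of_unit (hu p.2))
      fun p hp => ?_
    -- With `c = u ⬝ᵥ w > -1`, pairing with `u` gives `(1 - t)(1 + c) + 2t = 0`, which forces `t =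
    -- 0` and then `c = -1`, a contradiction.
    have h1 := congrArg (fun v => u p.2 ⬝ᵥ v) hp
    simp only [dotProduct_add, dotProduct_smul, hu, smul_eq_mul, dotProduct_zero] at h1
    have h2 := dot_gt_neg_one (hu p.2) (hw p.2) (h p.2)
    have h3 := p.1.2.1
    have h4 := p.1.2.2
    have h5 : (p.1 : ℝ) = 0 := by nlinarith [mul_nonneg (sub_nonneg.2 h4) (by linarith : 0 ≤ 1 + u p.2 ⬝ᵥ w p.2)]
    rw [h5] at h1
    linarith
  · intro x
    simp [rotMap]
  · intro x
    simp [rot_self]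

end Rotations

/-! ### The stabilizer `O(m) ⊂ O(m+1)` and connectedness of `SO(m)` -/

section Stabilizer

variable {m : ℕ} {X : Type*} [TopologicalSpace X]

/-- The inclusion `O(m) → O(m+1)` as the stabilizer of the first basis vector. -/
def stab (B : O m) : O (m + 1) :=
  ⟨Matrix.of (Fin.cons (Fin.cons 1 0) fun i => Fin.cons 0 (B.1 i)), by
    rw [Matrix.mem_orthogonalGroup_iff]
    have h := O_mul_transpose B
    ext i j
    have hij : ∀ i j, ∑ k, B.1 i k * B.1 j k = (1 : Matrix (Fin m) (Fin m) ℝ) i j := fun i j => by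
      rw [← h]; rfl
    refine Fin.cases ?_ (fun i => ?_) i <;> refine Fin.cases ?_ (fun j => ?_) j
    · simp [Matrix.mul_apply, Fin.sum_univ_succ]
    · simp [Matrix.mul_apply, Fin.sum_univ_succ, (Fin.succ_ne_zero j).symm]
    · simp [Matrix.mul_apply, Fin.sum_univ_succ, Fin.succ_ne_zero i]
    · simp only [Matrix.mul_apply, Fin.sum_univ_succ, Matrix.of_apply, Matrix.transpose_apply,
        Fin.cons_succ, Fin.cons_zero, mul_zero, zero_add, hij, Matrix.one_apply, Fin.succ_inj]⟩

theorem continuous_stab : Continuous (stab (m := m)) := by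
  refine Continuous.subtype_mk (continuous_matrix fun i j => ?_) _
  refine Fin.cases ?_ (fun i => ?_) i <;> refine Fin.cases ?_ (fun j => ?_) j
  · exact continuous_const
  · exact continuous_const
  · exact continuous_const
  · exact continuous_subtype_val.matrix_elem i j

theorem stab_one : stab (1 : O m) = 1 := by
  refine Subtype.ext ?_
  ext i j
  refine Fin.cases ?_ (fun i => ?_) i <;> refine Fin.cases ?_ (fun j => ?_) j
  · simp [stab]
  · simp [stab, (Fin.succ_ne_zero j).symm]
  · simp [stab, Fin.succ_ne_zero i]
  · simp [stab, Matrix.one_apply]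

theorem stab_det (B : O m) : (stab B).1.det = B.1.det := by
  rw [Matrix.det_succ_row_zero, Fin.sum_univ_succ, Finset.sum_eq_zero fun i _ => by simp [stab]]
  have : (stab B).1.submatrix Fin.succ (Fin.succAbove 0) = B.1 := by
    ext i j
    simp [stab]
  rw [this]
  simp [stab]

/-- A family of orthogonal matrices fixing the first basis vector comes from `O(m)`. -/
theorem exists_eq_stab (A : C(X, O (m + 1)))
    (hA : ∀ x, (A x).1 *ᵥ Pi.single 0 1 = Pi.single 0 1) :
    ∃ B : C(X, O m), ∀ x, A x = stab (B x) := by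
  have hcol : ∀ x i, (A x).1 i 0 = (Pi.single 0 1 : Fin (m + 1) → ℝ) i := fun x i => by
    rw [← hA x]
    simp
  have hort : ∀ x i j, ∑ k, (A x).1 k i * (A x).1 k j = (1 : Matrix _ _ ℝ) i j := fun x i j => by
    rw [← O_transpose_mul (A x)]
    rfl
  have hrow : ∀ x (j : Fin m), (A x).1 0 j.succ = 0 := fun x j => by
    have h := hort x 0 j.succ
    rw [Fin.sum_univ_succ] at h
    simpa [hcol, Matrix.one_apply, (Fin.succ_ne_zero j).symm] using h
  have hmem : ∀ x, (A x).1.submatrix Fin.succ Fin.succ ∈ Matrix.orthogonalGroup (Fin m) ℝ := by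
    intro x
    rw [Matrix.mem_orthogonalGroup_iff']
    ext i j
    have h := hort x i.succ j.succ
    rw [Fin.sum_univ_succ] at h
    simpa [hrow, Matrix.mul_apply, Matrix.one_apply] using h
  have hcont : Continuous fun x => (A x).1.submatrix Fin.succ Fin.succ :=
    (continuous_subtype_val.comp A.continuous).matrix_submatrix Fin.succ Fin.succ
  let B : C(X, O m) := ⟨fun x => ⟨_, hmem x⟩, hcont.subtype_mk hmem⟩
  refine ⟨B, fun x => Subtype.ext ?_⟩
  ext i j
  refine Fin.cases ?_ (fun i => ?_) i <;> refine Fin.cases ?_ (fun j => ?_) j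
  · simp [stab, hcol]
  · simp [stab, hrow]
  · simp [stab, hcol]
  · simp [stab, B]

/-- If the columns `A x e₀` are homotopic, through rotations, to `e₀`, and families in `SO(m)` are
null-homotopic, so is `A`. -/
theorem homotopic_one_of_stab {A T : C(X, O (m + 1))} (hT : T.Homotopic 1)
    (hTA : ∀ x, ((T * A) x).1 *ᵥ Pi.single 0 1 = Pi.single 0 1) (hdet : ∀ x, (A x).1.det = 1)
    (ih : ∀ B : C(X, O m), (∀ x, (B x).1.det = 1) → B.Homotopic 1) : A.Homotopic 1 := by
  obtain ⟨B, hB⟩ := exists_eq_stab (T * A) hTA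
  have hTA' : (T * A).Homotopic A := by
    simpa using Homotopic.mul hT (ContinuousMap.Homotopic.refl A)
  have hBdet : ∀ x, (B x).1.det = 1 := fun x => by
    rw [← stab_det, ← hB, det_eq_of_homotopic hTA', hdet]
  have h1 := (ContinuousMap.Homotopic.refl (⟨stab, continuous_stab⟩ : C(O m, O (m + 1)))).comp
    (ih B hBdet)
  have e1 : (⟨stab, continuous_stab⟩ : C(O m, O (m + 1))).comp B = T * A :=
    ContinuousMap.ext fun x => (hB x).symm
  have e2 : (⟨stab, continuous_stab⟩ : C(O m, O (m + 1))).comp (1 : C(X, O m)) = 1 :=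
    ContinuousMap.ext fun x => stab_one
  rw [e1, e2] at h1
  exact hTA'.symm.trans h1

/-- Path connectedness of `SO(m)`, by induction: rotate the first column to the first basis vector
`e` and pass to the stabilizer. If the column is `-e`, two rotations through an orthogonal vector
are needed, so sizes `0` and `1` are treated separately. -/
theorem unit_homotopic_one : ∀ {m : ℕ} (A : C(Unit, O m)), (∀ x, (A x).1.det = 1) →
    A.Homotopic 1
  | 0, A, _ => by
    have : A = 1 := ContinuousMap.ext fun x => Subtype.ext (Subsingleton.elim _ _)
    subst this
    exact ContinuousMap.Homotopic.refl _
  | 1, A, hA => by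
    have : A = 1 := ContinuousMap.ext fun x => Subtype.ext (by
      ext i j
      have hR := hA x
      rw [Matrix.det_fin_one] at hR
      rw [Subsingleton.elim i 0, Subsingleton.elim j 0, hR]
      simp)
    subst this
    exact ContinuousMap.Homotopic.refl _
  | m + 2, A, hR => by
    let X := Unit
    let R := A ()
    let e : Fin (m + 2) → ℝ := Pi.single 0 1
    have he : e ⬝ᵥ e = 1 := by simp [e]
    let f : Fin (m + 2) → ℝ := R.1 *ᵥ e
    have hf : f ⬝ᵥ f = 1 := (O_mulVec_dot R e e).trans he
    have main : ∃ T : C(X, O (m + 2)), T.Homotopic 1 ∧ ∀ x, (T x).1 *ᵥ f = e := by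
      by_cases hfe : f + e = 0
      · let w : Fin (m + 2) → ℝ := Pi.single 1 1
        have hw : w ⬝ᵥ w = 1 := by simp [w]
        have hwe : w ⬝ᵥ e = 0 := by simp [w, e]
        have hf' : f = -e := eq_neg_of_add_eq_zero_left hfe
        have h1 : f + w ≠ 0 := fun h => by
          have := congrArg (fun v => w ⬝ᵥ v) h
          simp [hf', dotProduct_add, hw, hwe] at this
        have h2 : w + e ≠ 0 := fun h => by
          have := congrArg (fun v => w ⬝ᵥ v) h
          simp [dotProduct_add, hw, hwe] at this
        refine ⟨rotMap (.const X w) (.const X e) (fun _ => hw) (fun _ => h2) *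
          rotMap (.const X f) (.const X w) (fun _ => hf) (fun _ => h1), ?_, fun x => ?_⟩
        · simpa using Homotopic.mul (rotMap_homotopic_one (.const X w) (.const X e) (fun _ => hw)
            (fun _ => he) fun _ => h2) (rotMap_homotopic_one (.const X f) (.const X w)
            (fun _ => hf) (fun _ => hw) fun _ => h1)
        · change ((rot w e).1 * (rot f w).1) *ᵥ f = e
          rw [← Matrix.mulVec_mulVec, rot_mulVec hf hw h1, rot_mulVec hw he h2]
      · exact ⟨rotMap (.const X f) (.const X e) (fun _ => hf) (fun _ => hfe),
          rotMap_homotopic_one _ _ _ (fun _ => he) _, fun x => rot_mulVec hf he hfe⟩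
    obtain ⟨T, hT, hTf⟩ := main
    refine homotopic_one_of_stab hT (fun x => ?_) hR unit_homotopic_one
    change ((T x).1 * R.1) *ᵥ e = e
    rw [← Matrix.mulVec_mulVec]
    exact hTf x

/-- A constant family in `SO(m)` is homotopic to the identity. -/
theorem const_homotopic_one (R : O m) (hR : R.1.det = 1) :
    (ContinuousMap.const X R).Homotopic 1 :=
  (unit_homotopic_one (.const Unit R) fun _ => hR).comp
    (ContinuousMap.Homotopic.refl (.const X ()))

end Stabilizer

/-! ### Moving maps from `S^2` off antipodal points -/

section SphereMaps

open Set

/-- Spherical coordinates on `S^2`, scaled by a map `g` on `ℝ^3`. -/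
def polarCone {N : ℕ} (g : E 3 → Fin N → ℝ) (p : Fin 3 → ℝ) : Fin N → ℝ :=
  p 0 • g (WithLp.toLp 2 ![Real.cos (p 1) * Real.cos (p 2), Real.cos (p 1) * Real.sin (p 2),
    Real.sin (p 1)])

theorem contDiff_polarCone {N : ℕ} {g : E 3 → Fin N → ℝ} (hg : ContDiff ℝ 1 g) :
    ContDiff ℝ 1 (polarCone g) := by
  refine (contDiff_apply ℝ ℝ 0).smul (hg.comp (PiLp.contDiff_toLp.comp (contDiff_pi.2 fun i => ?_)))
  have h1 : ContDiff ℝ 1 fun p : Fin 3 → ℝ => p 1 := contDiff_apply ℝ ℝ 1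
  have h2 : ContDiff ℝ 1 fun p : Fin 3 → ℝ => p 2 := contDiff_apply ℝ ℝ 2
  fin_cases i
  · exact h1.cos.mul h2.cos
  · exact h1.cos.mul h2.sin
  · exact h1.sin

theorem exists_spherical_coordinates {a b c : ℝ} (h : a * a + b * b + c * c = 1) :
    ∃ s t : ℝ, Real.cos s * Real.cos t = a ∧ Real.cos s * Real.sin t = b ∧ Real.sin s = c := by
  have hc : |c| ≤ 1 := abs_le_one_iff_mul_self_le_one.2
    (by linarith [mul_self_nonneg a, mul_self_nonneg b])
  have hcos : Real.cos (Real.arcsin c) = ‖(⟨a, b⟩ : ℂ)‖ := by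
    rw [Real.cos_arcsin, Complex.norm_def, Complex.normSq_apply]
    congr 1
    simp only
    linarith
  exact ⟨Real.arcsin c, (⟨a, b⟩ : ℂ).arg, by rw [hcos, Complex.norm_mul_cos_arg],
    by rw [hcos, Complex.norm_mul_sin_arg], Real.sin_arcsin (abs_le.1 hc).1 (abs_le.1 hc).2⟩

theorem exists_polarCone_eq {N : ℕ} (g : E 3 → Fin N → ℝ) (r : ℝ) (x : Sph 2) :
    ∃ p, polarCone g p = r • g x.1 := by
  have hx : x.1 0 * x.1 0 + x.1 1 * x.1 1 + x.1 2 * x.1 2 = 1 := by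
    have := sphere_dot x
    simpa [dotProduct, Fin.sum_univ_three] using this
  obtain ⟨s, t, h0, h1, h2⟩ := exists_spherical_coordinates hx
  refine ⟨![r, s, t], ?_⟩
  have e : (WithLp.toLp 2 ![x.1 0, x.1 1, x.1 2] : E 3) = x.1 := by
    ext i
    fin_cases i <;> rfl
  have e2 : polarCone g ![r, s, t] = r • g (WithLp.toLp 2 ![Real.cos s * Real.cos t,
    Real.cos s * Real.sin t, Real.sin s]) := rfl
  rw [e2, h0, h1, h2, e]

theorem abs_le_one_of_unit {N : ℕ} {v : Fin N → ℝ} (hv : v ⬝ᵥ v = 1) (i : Fin N) : |v i| ≤ 1 := by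
  have h1 : v i * v i ≤ v ⬝ᵥ v :=
    Finset.single_le_sum (f := fun j => v j * v j) (fun j _ => mul_self_nonneg _)
      (Finset.mem_univ i)
  rw [hv] at h1
  exact abs_le_one_iff_mul_self_le_one.2 h1

/-- A map from `S^2` to a sphere of dimension at least `3` is close to one that misses two antipodal
points. -/
theorem exists_approx_missing {N : ℕ} (hN : 4 ≤ N) (f : C(Sph 2, Fin N → ℝ))
    (hf : ∀ x, f x ⬝ᵥ f x = 1) :
    ∃ g : C(Sph 2, Fin N → ℝ), (∀ x, g x ⬝ᵥ g x = 1) ∧ (∀ x, f x + g x ≠ 0) ∧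
      ∃ v : Fin N → ℝ, v ⬝ᵥ v = 1 ∧ ∀ x, v + g x ≠ 0 ∧ -v + g x ≠ 0 := by
  obtain ⟨F, hF⟩ := ContinuousMap.exists_extension'
    (Metric.isClosed_sphere (x := (0 : E 3)) (ε := 1)).isClosedEmbedding_subtypeVal f
  have hN0 : (0 : ℝ) < N + 1 := by positivity
  -- An error below `1 / (N + 1)` in each coordinate changes `f ⬝ᵥ G` by at most `N / (N + 1) < 1`,
  -- so it stays positive and the normalised `G` is never antipodal to `f`.
  obtain ⟨G, hG, hGF, -⟩ := F.continuous.exists_contDiff_approx (n := 1)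
    (continuous_const (y := ((N : ℝ) + 1)⁻¹)) fun _ => inv_pos.2 hN0
  have hpos : ∀ x : Sph 2, 0 < f x ⬝ᵥ G x.1 := by
    intro x
    have hFx : F x.1 = f x := congrFun hF x
    have h1 : f x ⬝ᵥ G x.1 = 1 + f x ⬝ᵥ (G x.1 - F x.1) := by
      rw [dotProduct_sub, hFx, hf]
      ring
    have h2 : |f x ⬝ᵥ (G x.1 - F x.1)| ≤ N * ((N : ℝ) + 1)⁻¹ := by
      refine (Finset.abs_sum_le_sum_abs _ _).trans ?_
      have : ∀ i ∈ Finset.univ, |f x i * (G x.1 - F x.1) i| ≤ ((N : ℝ) + 1)⁻¹ := by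
        intro i _
        rw [abs_mul]
        have ha := abs_le_one_of_unit (hf x) i
        have hb : |(G x.1 - F x.1) i| ≤ ((N : ℝ) + 1)⁻¹ := by
          have := hGF x.1
          rw [dist_eq_norm] at this
          exact (norm_le_pi_norm (G x.1 - F x.1) i).trans this.le
        calc |f x i| * |(G x.1 - F x.1) i| ≤ 1 * |(G x.1 - F x.1) i| := by gcongr
          _ ≤ _ := by rwa [one_mul]
      refine (Finset.sum_le_sum this).trans ?_
      simp
    have h3 : N * ((N : ℝ) + 1)⁻¹ < 1 := by
      rw [← div_eq_mul_inv, div_lt_one hN0]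
      linarith
    rw [h1]
    linarith [(abs_le.1 h2).1]
  have hG0 : ∀ x : Sph 2, G x.1 ≠ 0 := fun x h => by
    have := hpos x
    simp [h] at this
  have hnorm : ∀ x : Sph 2, 0 < G x.1 ⬝ᵥ G x.1 := fun x => by
    simpa using Matrix.dotProduct_star_self_pos_iff.2 (hG0 x)
  have hGc : Continuous fun x : Sph 2 => G x.1 := hG.continuous.comp continuous_subtype_val
  let g : C(Sph 2, Fin N → ℝ) := ⟨fun x => unitVec (G x.1), by
    unfold unitVec
    exact ((Real.continuous_sqrt.comp (hGc.dotProduct hGc)).inv₀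
      fun x => Real.sqrt_ne_zero'.2 (hnorm x)).smul hGc⟩
  -- The cone over `G(S^2)` lies in the image of a `C¹` map from `ℝ^3`, so it misses some vector of
  -- `ℝ^N` with `N ≥ 4`. Radii of both signs are included, so both `w` and `-w` are avoided.
  have hdense := (contDiff_polarCone (by exact_mod_cast hG)).dense_compl_range_of_finrank_lt_finrank
    (f := polarCone G) (by simp; omega)
  obtain ⟨w, hw⟩ := hdense.nonempty
  have hw' : ∀ (r : ℝ) (x : Sph 2), w ≠ r • G x.1 := fun r x h => by
    obtain ⟨p, hp⟩ := exists_polarCone_eq G r x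
    exact hw ⟨p, hp.trans h.symm⟩
  have hw0 : w ≠ 0 := fun h => by
    have hne : Nonempty (Sph 2) := (NormedSpace.sphere_nonempty.2 zero_le_one).to_subtype
    exact hw' 0 hne.some (by simp [h])
  refine ⟨g, fun x => unitVec_dot (hG0 x), fun x h => ?_, unitVec w, unitVec_dot hw0, fun x => ?_⟩
  · have h1 := congrArg (fun v => f x ⬝ᵥ v) h
    simp only [dotProduct_add, hf, dotProduct_zero] at h1
    have h2 : 0 < f x ⬝ᵥ g x := by
      change 0 < f x ⬝ᵥ unitVec (G x.1)
      rw [unitVec, dotProduct_smul]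
      exact mul_pos (inv_pos.2 (Real.sqrt_pos.2 (hnorm x))) (hpos x)
    linarith
  · have hsw : Real.sqrt (w ⬝ᵥ w) ≠ 0 := fun h => by
      have := unitVec_dot hw0
      simp [unitVec, h] at this
    have key : ∀ c : ℝ, unitVec w ≠ c • G x.1 := fun c h => by
      refine hw' (Real.sqrt (w ⬝ᵥ w) * c) x ?_
      rw [← smul_smul, ← h, unitVec, smul_smul, mul_inv_cancel₀ hsw, one_smul]
    refine ⟨fun h => key (-(Real.sqrt (G x.1 ⬝ᵥ G x.1))⁻¹) ?_,
      fun h => key (Real.sqrt (G x.1 ⬝ᵥ G x.1))⁻¹ ?_⟩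
    · rw [neg_smul]
      exact eq_neg_of_add_eq_zero_left h
    · exact (neg_add_eq_zero.1 h)

/-- Null-homotopy of maps from `S^2` passes from `SO(m)` to `SO(m+1)`. -/
theorem homotopic_one_succ {m : ℕ} (hm : 3 ≤ m)
    (ih : ∀ B : C(Sph 2, O m), (∀ x, (B x).1.det = 1) → B.Homotopic 1)
    (A : C(Sph 2, O (m + 1))) (hA : ∀ x, (A x).1.det = 1) : A.Homotopic 1 := by
  let e : Fin (m + 1) → ℝ := Pi.single 0 1
  have he : e ⬝ᵥ e = 1 := by simp [e]
  let f : C(Sph 2, Fin (m + 1) → ℝ) := ⟨fun x => (A x).1 *ᵥ e,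
    (continuous_subtype_val.comp A.continuous).matrix_mulVec continuous_const⟩
  have hf : ∀ x, f x ⬝ᵥ f x = 1 := fun x => (O_mulVec_dot (A x) e e).trans he
  obtain ⟨g, hg, hfg, v, hv, hvg⟩ := exists_approx_missing (by omega) f hf
  -- One of `v` and `-v` is not antipodal to `e`; it is the intermediate stop in moving the first
  -- column along `f → g → w → e`.
  obtain ⟨w, hw, hwg, hwe⟩ : ∃ w : Fin (m + 1) → ℝ, w ⬝ᵥ w = 1 ∧ (∀ x, w + g x ≠ 0) ∧
      w + e ≠ 0 := by
    by_cases hve : v + e = 0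
    · refine ⟨-v, by simpa using hv, fun x => (hvg x).2, fun h => ?_⟩
      have : e = 0 := by
        have h2 : (2 : ℝ) • e = (v + e) + (-v + e) := by rw [two_smul]; abel
        rw [hve, h, add_zero] at h2
        exact (smul_eq_zero.1 h2).resolve_left two_ne_zero
      simp [this] at he
    · exact ⟨v, hv, fun x => (hvg x).1, hve⟩
  let c : (Fin (m + 1) → ℝ) → C(Sph 2, Fin (m + 1) → ℝ) := fun u => .const _ u
  have hgw : ∀ x, g x + c w x ≠ 0 := fun x h => hwg x ((add_comm w (g x)).trans h)
  have h1 := rotMap_homotopic_one f g hf hg hfg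
  have h2 := rotMap_homotopic_one g (c w) hg (fun _ => hw) hgw
  have h3 := rotMap_homotopic_one (c w) (c e) (fun _ => hw) (fun _ => he) (fun _ => hwe)
  have h123 := Homotopic.mul h3 (Homotopic.mul h2 h1)
  rw [one_mul, one_mul] at h123
  refine homotopic_one_of_stab h123 (fun x => ?_) hA ih
  change ((rot w e).1 * ((rot (g x) w).1 * (rot (f x) (g x)).1) * (A x).1) *ᵥ e = e
  rw [← Matrix.mulVec_mulVec, ← Matrix.mulVec_mulVec, ← Matrix.mulVec_mulVec]
  change (rot w e).1 *ᵥ (rot (g x) w).1 *ᵥ (rot (f x) (g x)).1 *ᵥ f x = e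
  rw [rot_mulVec (hf x) (hg x) (hfg x), rot_mulVec (hg x) hw (hgw x), rot_mulVec hw he hwe]

end SphereMaps

/-! ### Quaternions and the lifting of rotations of `ℝ^3` -/

section Quaternions

open Set

/-- The product of quaternions written as vectors in `ℝ^4`. -/
def qmul (p q : Fin 4 → ℝ) : Fin 4 → ℝ :=
  ![p 0 * q 0 - p 1 * q 1 - p 2 * q 2 - p 3 * q 3,
    p 0 * q 1 + p 1 * q 0 + p 2 * q 3 - p 3 * q 2,
    p 0 * q 2 - p 1 * q 3 + p 2 * q 0 + p 3 * q 1,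
    p 0 * q 3 + p 1 * q 2 - p 2 * q 1 + p 3 * q 0]

/-- The matrix of `v ↦ q v q̄` on imaginary quaternions. -/
def conjMatrix (q : Fin 4 → ℝ) : Matrix (Fin 3) (Fin 3) ℝ :=
  !![q 0 * q 0 + q 1 * q 1 - q 2 * q 2 - q 3 * q 3, 2 * (q 1 * q 2 - q 0 * q 3),
      2 * (q 1 * q 3 + q 0 * q 2);
    2 * (q 1 * q 2 + q 0 * q 3), q 0 * q 0 - q 1 * q 1 + q 2 * q 2 - q 3 * q 3,
      2 * (q 2 * q 3 - q 0 * q 1);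
    2 * (q 1 * q 3 - q 0 * q 2), 2 * (q 2 * q 3 + q 0 * q 1),
      q 0 * q 0 - q 1 * q 1 - q 2 * q 2 + q 3 * q 3]

theorem dot_four (p q : Fin 4 → ℝ) :
    p ⬝ᵥ q = p 0 * q 0 + p 1 * q 1 + p 2 * q 2 + p 3 * q 3 := by
  simp [dotProduct, Fin.sum_univ_four]

theorem qmul_dot (p q : Fin 4 → ℝ) : qmul p q ⬝ᵥ qmul p q = (p ⬝ᵥ p) * (q ⬝ᵥ q) := by
  simp only [dot_four, qmul, Matrix.cons_val]
  ring

theorem conjMatrix_qmul (p q : Fin 4 → ℝ) :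
    conjMatrix (qmul p q) = conjMatrix p * conjMatrix q := by
  ext i j
  fin_cases i <;> fin_cases j <;>
    simp [conjMatrix, qmul, Matrix.mul_apply, Fin.sum_univ_three] <;> ring

theorem conjMatrix_mul_transpose (q : Fin 4 → ℝ) :
    conjMatrix q * (conjMatrix q)ᵀ = (q ⬝ᵥ q) ^ 2 • 1 := by
  ext i j
  fin_cases i <;> fin_cases j <;>
    simp [conjMatrix, dot_four, Matrix.mul_apply, Fin.sum_univ_three] <;> ring

theorem continuous_conjMatrix : Continuous conjMatrix := by
  refine continuous_matrix fun i j => ?_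
  fin_cases i <;> fin_cases j <;> simp [conjMatrix] <;> fun_prop

/-- The quaternion `q` induces the rotation `R`. -/
def Lifts (q : Fin 4 → ℝ) (R : O 3) : Prop := q ≠ 0 ∧ (q ⬝ᵥ q) • R.1 = conjMatrix q

theorem Lifts.mul {p q : Fin 4 → ℝ} {R S : O 3} (hp : Lifts p R) (hq : Lifts q S) :
    Lifts (qmul p q) (R * S) := by
  constructor
  · intro h
    have h2 := qmul_dot p q
    rw [h, zero_dotProduct, eq_comm, mul_eq_zero] at h2
    exact h2.elim (fun h => hp.1 (dotProduct_self_eq_zero.1 h))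
      fun h => hq.1 (dotProduct_self_eq_zero.1 h)
  · rw [qmul_dot, conjMatrix_qmul, ← hp.2, ← hq.2]
    simp only [Submonoid.coe_mul, smul_mul_smul_comm]

theorem lifts_one : Lifts (Pi.single 0 1) 1 := by
  refine ⟨by simp, ?_⟩
  ext i j
  fin_cases i <;> fin_cases j <;> simp [conjMatrix]

theorem Lifts.smul {q : Fin 4 → ℝ} {R : O 3} (hq : Lifts q R) {c : ℝ} (hc : c ≠ 0) :
    Lifts (c • q) R := by
  refine ⟨smul_ne_zero hc hq.1, ?_⟩
  have : conjMatrix (c • q) = (c * c) • conjMatrix q := by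
    ext i j
    fin_cases i <;> fin_cases j <;> simp [conjMatrix] <;> ring
  rw [this, ← hq.2, smul_smul]
  simp [mul_assoc]

theorem Lifts.eq {q : Fin 4 → ℝ} {R S : O 3} (hR : Lifts q R) (hS : Lifts q S) : R = S := by
  have h0 : q ⬝ᵥ q ≠ 0 := fun h => hR.1 (dotProduct_self_eq_zero.1 h)
  exact Subtype.ext (smul_right_injective _ h0 (hR.2.trans hS.2.symm))

/-- The rotation induced by a nonzero quaternion. -/
def quatRot (q : Fin 4 → ℝ) (hq : q ≠ 0) : O 3 :=
  ⟨(q ⬝ᵥ q)⁻¹ • conjMatrix q, by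
    have h0 : q ⬝ᵥ q ≠ 0 := fun h => hq (dotProduct_self_eq_zero.1 h)
    rw [Matrix.mem_orthogonalGroup_iff, Matrix.transpose_smul, smul_mul_smul_comm,
      conjMatrix_mul_transpose, smul_smul]
    field_simp
    simp⟩

theorem lifts_quatRot (q : Fin 4 → ℝ) (hq : q ≠ 0) : Lifts q (quatRot q hq) := by
  have h0 : q ⬝ᵥ q ≠ 0 := fun h => hq (dotProduct_self_eq_zero.1 h)
  refine ⟨hq, ?_⟩
  simp [quatRot, smul_smul, h0]

theorem continuous_quatRot {X : Type*} [TopologicalSpace X] {l : X → Fin 4 → ℝ} (hl : Continuous l)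
    (h0 : ∀ x, l x ≠ 0) : Continuous fun x => quatRot (l x) (h0 x) := by
  refine Continuous.subtype_mk ?_ _
  exact ((hl.dotProduct hl).inv₀ fun x h => h0 x (dotProduct_self_eq_zero.1 h)).smul
    (continuous_conjMatrix.comp hl)

theorem segment_ne_zero {N : ℕ} {u w : Fin N → ℝ} (hu : u ⬝ᵥ u = 1) (hw : w ⬝ᵥ w = 1)
    (h : u + w ≠ 0) (t : ℝ) : (1 - t) • u + t • w ≠ 0 := fun h0 => by
  have h1 := congrArg (fun v => u ⬝ᵥ v) h0
  have h2 := congrArg (fun v => w ⬝ᵥ v) h0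
  simp only [dotProduct_add, dotProduct_smul, hu, hw, smul_eq_mul, dotProduct_zero,
    dotProduct_comm w u] at h1 h2
  have h3 := dot_gt_neg_one hu hw h
  nlinarith

/-- Families of rotations with homotopic quaternion lifts are homotopic. -/
theorem homotopic_of_lifts {X : Type*} [TopologicalSpace X] {A B : C(X, O 3)}
    {l g : C(X, Fin 4 → ℝ)} (hA : ∀ x, Lifts (l x) (A x)) (hB : ∀ x, Lifts (g x) (B x))
    (hl : ∀ x, l x ⬝ᵥ l x = 1) (hg : ∀ x, g x ⬝ᵥ g x = 1) (h : ∀ x, l x + g x ≠ 0) :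
    A.Homotopic B := by
  refine homotopic_of_continuous
    (fun t x => quatRot ((1 - (t : ℝ)) • l x + (t : ℝ) • g x)
      (segment_ne_zero (hl x) (hg x) (h x) t)) ?_ (fun x => ?_) fun x => ?_
  · exact continuous_quatRot (l := fun p : I × X => (1 - (p.1 : ℝ)) • l p.2 + (p.1 : ℝ) • g p.2)
      (by fun_prop) fun p => segment_ne_zero (hl p.2) (hg p.2) (h p.2) p.1
  · refine Lifts.eq (q := l x) ?_ (hA x)
    have := lifts_quatRot ((1 - ((0 : I) : ℝ)) • l x + ((0 : I) : ℝ) • g x)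
      (segment_ne_zero (hl x) (hg x) (h x) _)
    simpa using this
  · refine Lifts.eq (q := g x) ?_ (hB x)
    have := lifts_quatRot ((1 - ((1 : I) : ℝ)) • l x + ((1 : I) : ℝ) • g x)
      (segment_ne_zero (hl x) (hg x) (h x) _)
    simpa using this

/-- The Cayley transform of a rotation. -/
def cayley (R : O 3) : Matrix (Fin 3) (Fin 3) ℝ := (R.1 + 1)⁻¹ * (R.1 - 1)

/-- A quaternion inducing the rotation `R`, if `-1` is not an eigenvalue of `R`. -/
def cayleyQuat (R : O 3) : Fin 4 → ℝ := ![1, cayley R 2 1, cayley R 0 2, cayley R 1 0]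

/-- The matrix of the cross product with `a`. -/
def crossMatrix (a b c : ℝ) : Matrix (Fin 3) (Fin 3) ℝ := !![0, -c, b; c, 0, -a; -b, a, 0]

/-- Up to the factor `|q|²`, conjugation by `q = 1 + ai + bj + ck` is the rotation `(1 + S)(1 -
S)⁻¹`, with `S` the cross product matrix. This links quaternions to the Cayley transform. -/
theorem conjMatrix_mul_one_sub (a b c : ℝ) :
    conjMatrix ![1, a, b, c] * (1 - crossMatrix a b c) =
      (![1, a, b, c] ⬝ᵥ ![1, a, b, c]) • (1 + crossMatrix a b c) := by
  ext i j
  fin_cases i <;> fin_cases j <;>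
    simp [conjMatrix, crossMatrix, Matrix.mul_apply, Fin.sum_univ_three] <;> ring

/-- Orthogonality makes the Cayley transform `S` of `R` skew, hence a cross product matrix, and `R
(1 - S) = 1 + S`. The previous identity gives the same equation for the quaternion, and `1 - S`
cancels because its determinant is `|q|² > 0`. -/
theorem lifts_cayleyQuat {R : O 3} (hR : (R.1 + 1).det ≠ 0) : Lifts (cayleyQuat R) R := by
  have hu : IsUnit (R.1 + 1).det := isUnit_iff_ne_zero.2 hR
  have h1 : (R.1 + 1) * cayley R = R.1 - 1 := by
    rw [cayley, Matrix.mul_nonsing_inv_cancel_left _ _ hu]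
  have h2 : cayley R * (R.1 + 1) = R.1 - 1 := by
    have : (R.1 - 1) * (R.1 + 1) = (R.1 + 1) * (R.1 - 1) := by noncomm_ring
    rw [cayley, mul_assoc, this, Matrix.nonsing_inv_mul_cancel_left _ _ hu]
  have h3 : (cayley R)ᵀ = -cayley R := by
    have h4 : (R.1ᵀ + 1) * (cayley R)ᵀ = R.1ᵀ - 1 := by
      have := congrArg Matrix.transpose h2
      simpa [Matrix.transpose_mul] using this
    have h5 : (R.1 + 1) * (cayley R)ᵀ = (R.1 + 1) * (-cayley R) := by
      have e1 : R.1 * ((R.1ᵀ + 1) * (cayley R)ᵀ) = (R.1 + 1) * (cayley R)ᵀ := by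
        rw [← mul_assoc, mul_add, O_mul_transpose, mul_one, add_comm]
      rw [← e1, h4, mul_sub, O_mul_transpose, mul_neg, h1]
      simp
    calc (cayley R)ᵀ = (R.1 + 1)⁻¹ * ((R.1 + 1) * (cayley R)ᵀ) :=
          (Matrix.nonsing_inv_mul_cancel_left _ _ hu).symm
      _ = -cayley R := by rw [h5, Matrix.nonsing_inv_mul_cancel_left _ _ hu]
  have hsk : ∀ i j, cayley R j i = -cayley R i j := fun i j => by
    have := congrFun (congrFun h3 i) j
    simpa using this
  have hd : ∀ i, cayley R i i = 0 := fun i => by linarith [hsk i i]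
  have hS : cayley R = crossMatrix (cayley R 2 1) (cayley R 0 2) (cayley R 1 0) := by
    ext i j
    fin_cases i <;> fin_cases j <;> simp [crossMatrix, hd, hsk 1 2, hsk 2 0, hsk 0 1]
  have hc := conjMatrix_mul_one_sub (cayley R 2 1) (cayley R 0 2) (cayley R 1 0)
  rw [← hS] at hc
  have hdot : 0 < cayleyQuat R ⬝ᵥ cayleyQuat R := by
    rw [dot_four]
    simp only [cayleyQuat, Matrix.cons_val]
    linarith [mul_self_nonneg (cayley R 2 1), mul_self_nonneg (cayley R 0 2),
      mul_self_nonneg (cayley R 1 0)]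
  have hdet : IsUnit (1 - cayley R).det := by
    have : (1 - cayley R).det = cayleyQuat R ⬝ᵥ cayleyQuat R := by
      rw [hS, Matrix.det_fin_three, dot_four]
      simp [crossMatrix, cayleyQuat]
      ring
    rw [this]
    exact isUnit_iff_ne_zero.2 hdot.ne'
  refine ⟨fun h => by simp [h] at hdot, ?_⟩
  have h6 : R.1 * (1 - cayley R) = 1 + cayley R := by
    rw [add_mul, one_mul] at h1
    have : R.1 * cayley R = R.1 - 1 - cayley R := eq_sub_of_add_eq h1
    rw [mul_sub, mul_one, this]
    abel
  have h7 : ((cayleyQuat R ⬝ᵥ cayleyQuat R) • R.1) * (1 - cayley R) =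
      conjMatrix (cayleyQuat R) * (1 - cayley R) := by
    rw [smul_mul_assoc, h6]
    exact hc.symm
  calc _ = ((cayleyQuat R ⬝ᵥ cayleyQuat R) • R.1) * (1 - cayley R) * (1 - cayley R)⁻¹ :=
        (Matrix.mul_nonsing_inv_cancel_right _ _ hdet).symm
    _ = _ := by rw [h7, Matrix.mul_nonsing_inv_cancel_right _ _ hdet]

theorem continuous_cayleyQuat {X : Type*} [TopologicalSpace X] {R : X → O 3} (hR : Continuous R)
    (h0 : ∀ x, ((R x).1 + 1).det ≠ 0) : Continuous fun x => cayleyQuat (R x) := by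
  have h1 : Continuous fun x => (R x).1 := continuous_subtype_val.comp hR
  have h2 : Continuous fun x => (R x).1 + 1 := h1.add continuous_const
  have h3 : Continuous fun x => ((R x).1 + 1)⁻¹ := by
    simp only [Matrix.inv_def, Ring.inverse_eq_inv']
    exact (h2.matrix_det.inv₀ h0).smul h2.matrix_adjugate
  have h4 : Continuous fun x => cayley (R x) := h3.mul (h1.sub continuous_const)
  refine continuous_pi fun i => ?_
  fin_cases i
  · exact continuous_const
  · exact h4.matrix_elem 2 1
  · exact h4.matrix_elem 0 2
  · exact h4.matrix_elem 1 0

theorem continuous_qmul {X : Type*} [TopologicalSpace X] {p q : X → Fin 4 → ℝ} (hp : Continuous p)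
    (hq : Continuous q) : Continuous fun x => qmul (p x) (q x) := by
  refine continuous_pi fun i => ?_
  fin_cases i <;> simp [qmul] <;> fun_prop

/-- A homotopy of rotations starting at the identity lifts to the quaternions. -/
theorem exists_lift_of_homotopy {X : Type*} [PseudoMetricSpace X] [CompactSpace X]
    (F : C(I × X, O 3)) (h0 : ∀ x, F (0, x) = 1) :
    ∃ L : C(X, Fin 4 → ℝ), ∀ x, Lifts (L x) (F (1, x)) := by
  let D : (I × I) × X → ℝ := fun p => (((F (p.1.1, p.2))⁻¹ * F (p.1.2, p.2)).1 + 1).det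
  have hDc : Continuous D := by
    have h1 : Continuous fun p : (I × I) × X => ((F (p.1.1, p.2))⁻¹ * F (p.1.2, p.2)) := by
      fun_prop
    exact ((continuous_subtype_val.comp h1).add continuous_const).matrix_det
  have hdiag : ∀ s x, D ((s, s), x) = 8 := by
    intro s x
    simp only [D, inv_mul_cancel]
    have : ((1 : O 3).1 + 1 : Matrix (Fin 3) (Fin 3) ℝ) = (2 : ℝ) • 1 := by
      rw [two_smul]; rfl
    rw [this, Matrix.det_smul]
    norm_num
  -- On the diagonal `D = det (2 · 1) = 8`. Uniform continuity keeps `D` nonzero over short time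
  -- steps, so each increment of the homotopy has a Cayley quaternion; the lift is their successive
  -- product.
  obtain ⟨δ, hδ, hD⟩ := Metric.uniformContinuous_iff.1
    (CompactSpace.uniformContinuous_of_continuous hDc) 8 (by norm_num)
  obtain ⟨K, hK⟩ := exists_nat_one_div_lt hδ
  let s : ℕ → I := fun k => projIcc 0 1 zero_le_one ((k : ℝ) / (K + 1))
  have hs : ∀ k x, D ((s k, s (k + 1)), x) ≠ 0 := by
    intro k x h
    have hd : dist ((s k, s k), x) ((s k, s (k + 1)), x) < δ := by
      have : dist (s k) (s (k + 1)) ≤ 1 / (K + 1) := by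
        have h1 := (LipschitzWith.projIcc (zero_le_one (α := ℝ))).dist_le_mul
          ((k : ℝ) / (K + 1)) (((k + 1 : ℕ) : ℝ) / (K + 1))
        refine h1.trans (le_of_eq ?_)
        rw [NNReal.coe_one, one_mul, Real.dist_eq, ← sub_div, abs_div,
          abs_of_pos (by positivity : (0 : ℝ) < K + 1)]
        push_cast
        simp
      simp only [Prod.dist_eq, dist_self]
      refine lt_of_le_of_lt ?_ hK
      have hp : (0 : ℝ) ≤ 1 / (K + 1) := by positivity
      simp only [max_le_iff, hp, this, and_self]
    have := hD hd
    rw [hdiag, h, Real.dist_eq] at this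
    norm_num at this
  have key : ∀ k, ∃ L : C(X, Fin 4 → ℝ), ∀ x, Lifts (L x) (F (s k, x)) := by
    intro k
    induction k with
    | zero =>
      refine ⟨.const _ (Pi.single 0 1), fun x => ?_⟩
      have : s 0 = 0 := by simp [s, projIcc_of_le_left]
      rw [this, h0]
      exact lifts_one
    | succ k ih =>
      obtain ⟨L, hL⟩ := ih
      have hc : Continuous fun x => (F (s k, x))⁻¹ * F (s (k + 1), x) := by fun_prop
      refine ⟨⟨fun x => qmul (L x) (cayleyQuat ((F (s k, x))⁻¹ * F (s (k + 1), x))),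
        continuous_qmul L.continuous (continuous_cayleyQuat hc fun x => hs k x)⟩, fun x => ?_⟩
      have := (hL x).mul (lifts_cayleyQuat (hs k x))
      rwa [mul_inv_cancel_left] at this
  obtain ⟨L, hL⟩ := key (K + 1)
  have h1 : s (K + 1) = 1 := by
    refine projIcc_of_right_le _ ?_
    push_cast
    rw [div_self (by positivity)]
  exact ⟨L, fun x => h1 ▸ hL x⟩

end Quaternions

/-! ### Vanishing of `π_2(SO(m))` for `m ≥ 3` -/

section NullHomotopy

open Set

/-- A continuous function on a compact space that is constant on the fibres of a continuous
surjection onto a Hausdorff space descends. -/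
theorem exists_descend {K Y Z : Type*} [TopologicalSpace K] [CompactSpace K] [TopologicalSpace Y]
    [T2Space Y] [TopologicalSpace Z] {p : K → Y} (hp : Continuous p) (hs : Function.Surjective p)
    {f : K → Z} (hf : Continuous f) (h : ∀ s t, p s = p t → f s = f t) :
    ∃ g : C(Y, Z), ∀ t, g (p t) = f t := by
  have hq : Topology.IsQuotientMap (⟨p, hp⟩ : C(K, Y)) :=
    Topology.IsQuotientMap.of_surjective_continuous hs hp
  have h' : Function.FactorsThrough (⟨f, hf⟩ : C(K, Z)) (⟨p, hp⟩ : C(K, Y)) :=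
    fun s t hst => h s t hst
  exact ⟨hq.lift ⟨f, hf⟩ h', fun t => DFunLike.congr_fun (hq.lift_comp ⟨f, hf⟩ h') t⟩

theorem IsCollapse.exists_descend {m : ℕ} {q : C(Fin m → I, Sph m)} (hq : IsCollapse q)
    {Z : Type*} [TopologicalSpace Z] {f : (Fin m → I) → Z} (hf : Continuous f) {z : Z}
    (hz : ∀ t ∈ Cube.boundary (Fin m), f t = z) : ∃ g : C(Sph m, Z), ∀ t, g (q t) = f t := by
  refine SphereFraming.exists_descend q.continuous hq.1 hf fun s t hst => ?_
  rcases (hq.2 s t).1 hst with rfl | ⟨h1, h2⟩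
  · rfl
  · rw [hz s h1, hz t h2]

theorem zero_mem_boundary {m : ℕ} (hm : 1 ≤ m) : (0 : Fin m → I) ∈ Cube.boundary (Fin m) :=
  ⟨⟨0, by omega⟩, Or.inl rfl⟩

/-- The kernel of the double cover is `±1`; the diagonal of `conjMatrix` already shows it. -/
theorem Lifts.unit_one {q : Fin 4 → ℝ} (hq : Lifts q 1) (h1 : q ⬝ᵥ q = 1) :
    (q 0 = 1 ∨ q 0 = -1) ∧ q 1 = 0 ∧ q 2 = 0 ∧ q 3 = 0 := by
  have h := hq.2
  rw [h1, one_smul] at h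
  have a := congrFun (congrFun h 0) 0
  have b := congrFun (congrFun h 1) 1
  have c := congrFun (congrFun h 2) 2
  simp only [conjMatrix, Matrix.of_apply, Matrix.cons_val, OneMemClass.coe_one,
    Matrix.one_apply_eq] at a b c
  rw [dot_four] at h1
  have e1 : q 1 * q 1 = 0 := by
    nlinarith [mul_self_nonneg (q 1), mul_self_nonneg (q 2), mul_self_nonneg (q 3)]
  have e2 : q 2 * q 2 = 0 := by
    nlinarith [mul_self_nonneg (q 1), mul_self_nonneg (q 2), mul_self_nonneg (q 3)]
  have e3 : q 3 * q 3 = 0 := by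
    nlinarith [mul_self_nonneg (q 1), mul_self_nonneg (q 2), mul_self_nonneg (q 3)]
  exact ⟨mul_self_eq_one_iff.1 (by linarith), mul_self_eq_zero.1 e1, mul_self_eq_zero.1 e2,
    mul_self_eq_zero.1 e3⟩

/-- A family of rotations of `ℝ^3` over `S^2`, equal to the identity at a point, lifts to the unit
quaternions. -/
theorem exists_lift_sphere {p : C(Fin 2 → I, Sph 2)} (hp : IsCollapse p) (A : C(Sph 2, O 3))
    (hA : A (p 0) = 1) :
    ∃ l : C(Sph 2, Fin 4 → ℝ), (∀ x, l x ⬝ᵥ l x = 1) ∧ ∀ x, Lifts (l x) (A x) := by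
  -- Shrinking the square to its corner `0` is a homotopy from the constant `1` to `A ∘ p`.
  let F : C(I × (Fin 2 → I), O 3) := ⟨fun z => A (p fun i => z.1 * z.2 i), by fun_prop⟩
  obtain ⟨L, hL⟩ := exists_lift_of_homotopy F fun x => by
    simp only [F, ContinuousMap.coe_mk, zero_mul]
    exact hA
  have hL' : ∀ t, Lifts (L t) (A (p t)) := fun t => by
    have := hL t
    simpa only [F, ContinuousMap.coe_mk, one_mul] using this
  have hpos : ∀ t, 0 < L t ⬝ᵥ L t := fun t => by
    simpa using Matrix.dotProduct_star_self_pos_iff.2 (hL' t).1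
  let M : (Fin 2 → I) → Fin 4 → ℝ := fun t => unitVec (L t)
  have hM : Continuous M := ((Real.continuous_sqrt.comp
    (L.continuous.dotProduct L.continuous)).inv₀ fun t => Real.sqrt_ne_zero'.2 (hpos t)).smul
    L.continuous
  have hM1 : ∀ t, M t ⬝ᵥ M t = 1 := fun t => unitVec_dot (hL' t).1
  have hML : ∀ t, Lifts (M t) (A (p t)) := fun t =>
    (hL' t).smul (inv_ne_zero (Real.sqrt_ne_zero'.2 (hpos t)))
  have hb0 := zero_mem_boundary (m := 2) (by norm_num)
  have hbdry : ∀ t ∈ Cube.boundary (Fin 2), A (p t) = 1 := fun t ht => by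
    rw [(hp.2 t 0).2 (Or.inr ⟨ht, hb0⟩), hA]
  have hu : ∀ t ∈ Cube.boundary (Fin 2), (M t 0 = 1 ∨ M t 0 = -1) ∧ M t 1 = 0 ∧ M t 2 = 0 ∧
      M t 3 = 0 := fun t ht => by
    have := hML t
    rw [hbdry t ht] at this
    exact this.unit_one (hM1 t)
  -- On the boundary the lift takes only the values `±1`, and the boundary is connected, so the lift
  -- is constant there and descends to `S^2`.
  have hconst : ∀ t ∈ Cube.boundary (Fin 2), M t 0 = M 0 0 := by
    intro t ht
    have hpre := isPreconnected_boundary_square.image (fun t => M t 0)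
      ((continuous_apply 0).comp hM).continuousOn
    have hno : (0 : ℝ) ∉ (fun t => M t 0) '' Cube.boundary (Fin 2) := by
      rintro ⟨s, hs, h⟩
      simp only at h
      rcases (hu s hs).1 with h' | h' <;> rw [h] at h' <;> norm_num at h'
    rcases (hu t ht).1 with h1 | h1 <;> rcases (hu 0 hb0).1 with h2 | h2
    · rw [h1, h2]
    · exact absurd (hpre.Icc_subset ⟨0, hb0, rfl⟩ ⟨t, ht, rfl⟩ ⟨by simp [h2], by simp [h1]⟩) hno
    · exact absurd (hpre.Icc_subset ⟨t, ht, rfl⟩ ⟨0, hb0, rfl⟩ ⟨by simp [h1], by simp [h2]⟩) hno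
    · rw [h1, h2]
  obtain ⟨l, hl⟩ := hp.exists_descend hM (z := M 0) fun t ht => by
    funext i
    obtain ⟨-, a1, a2, a3⟩ := hu t ht
    obtain ⟨-, b1, b2, b3⟩ := hu 0 hb0
    fin_cases i
    · exact hconst t ht
    · exact a1.trans b1.symm
    · exact a2.trans b2.symm
    · exact a3.trans b3.symm
  refine ⟨l, fun x => ?_, fun x => ?_⟩
  · obtain ⟨t, rfl⟩ := hp.1 x
    rw [hl, hM1]
  · obtain ⟨t, rfl⟩ := hp.1 x
    rw [hl]
    exact hML t

/-- After dividing by the value at the base point, the family lifts to unit quaternions. The lift is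
deformed along segments to a map missing a point, then to a constant, then to `1`, and each
deformation projects to rotations. -/
theorem homotopic_one_three (A : C(Sph 2, O 3)) (hdet : ∀ x, (A x).1.det = 1) :
    A.Homotopic 1 := by
  obtain ⟨p, hp⟩ := exists_isCollapse (m := 2) (by norm_num)
  let R : O 3 := A (p 0)
  have hB := const_homotopic_one (X := Sph 2) R (hdet _)
  let A' : C(Sph 2, O 3) := (ContinuousMap.const _ R)⁻¹ * A
  have hA' : A'.Homotopic A := by
    simpa [A'] using Homotopic.mul (Homotopic.inv hB) (ContinuousMap.Homotopic.refl A)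
  refine hA'.symm.trans ?_
  obtain ⟨l, hl1, hl⟩ := exists_lift_sphere hp A' (inv_mul_cancel R)
  obtain ⟨g, hg, hlg, v, hv, hvg⟩ := exists_approx_missing le_rfl l hl1
  let e : Fin 4 → ℝ := Pi.single 0 1
  have he : e ⬝ᵥ e = 1 := by simp [e]
  obtain ⟨w, hw, hwg, hwe⟩ : ∃ w : Fin 4 → ℝ, w ⬝ᵥ w = 1 ∧ (∀ x, w + g x ≠ 0) ∧
      w + e ≠ 0 := by
    by_cases hve : v + e = 0
    · refine ⟨-v, by simpa using hv, fun x => (hvg x).2, fun h => ?_⟩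
      have : e = 0 := by
        have h2 : (2 : ℝ) • e = (v + e) + (-v + e) := by rw [two_smul]; abel
        rw [hve, h, add_zero] at h2
        exact (smul_eq_zero.1 h2).resolve_left two_ne_zero
      simp [this] at he
    · exact ⟨v, hv, fun x => (hvg x).1, hve⟩
  have hne : ∀ {u : Fin 4 → ℝ}, u ⬝ᵥ u = 1 → u ≠ 0 := ne_zero_of_unit
  let c : (Fin 4 → ℝ) → C(Sph 2, Fin 4 → ℝ) := fun u => .const _ u
  let G : C(Sph 2, O 3) := ⟨fun x => quatRot (g x) (hne (hg x)),
    continuous_quatRot g.continuous fun x => hne (hg x)⟩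
  let W : C(Sph 2, O 3) := .const _ (quatRot w (hne hw))
  have h1 : A'.Homotopic G := homotopic_of_lifts (g := g) hl
    (fun x => lifts_quatRot (g x) (hne (hg x))) hl1 hg hlg
  have h2 : W.Homotopic G := homotopic_of_lifts (l := c w) (g := g)
    (fun _ => lifts_quatRot w (hne hw)) (fun x => lifts_quatRot (g x) (hne (hg x))) (fun _ => hw) hg hwg
  have h3 : W.Homotopic 1 := homotopic_of_lifts (l := c w) (g := c e)
    (fun _ => lifts_quatRot w (hne hw)) (fun _ => lifts_one) (fun _ => hw) (fun _ => he) fun _ => hwe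
  exact h1.trans (h2.symm.trans h3)

/-- Every map from `S^2` to `SO(m)` is null-homotopic. -/
theorem sphere_two_homotopic_one {m : ℕ} (hm : 3 ≤ m) :
    ∀ A : C(Sph 2, O m), (∀ x, (A x).1.det = 1) → A.Homotopic 1 := by
  induction m, hm using Nat.le_induction with
  | base => exact homotopic_one_three
  | succ m hm ih => exact homotopic_one_succ hm ih

end NullHomotopy

/-! ### Maps `S^2 × S^(2n-3) → SO(2n)` as pairs of loops -/

section ProductMaps

open Set

/-- A homotopy descends along a continuous surjection from a compact space onto a Hausdorff
space. -/
theorem homotopic_of_descend {K Y Z : Type*} [TopologicalSpace K] [CompactSpace K]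
    [TopologicalSpace Y] [T2Space Y] [TopologicalSpace Z] {q : K → Y} (hq : Continuous q)
    (hs : Function.Surjective q) {f f' : C(Y, Z)} (F : C(I × K, Z))
    (h0 : ∀ s, F (0, s) = f (q s)) (h1 : ∀ s, F (1, s) = f' (q s))
    (h : ∀ τ s s', q s = q s' → F (τ, s) = F (τ, s')) : f.Homotopic f' := by
  obtain ⟨G, hG⟩ := exists_descend (p := fun z : I × K => (z.1, q z.2))
    (continuous_fst.prodMk (hq.comp continuous_snd))
    (fun ⟨τ, y⟩ => by obtain ⟨s, rfl⟩ := hs y; exact ⟨(τ, s), rfl⟩) F.continuous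
    (fun a b hab => by
      obtain ⟨τ, s⟩ := a
      obtain ⟨τ', s'⟩ := b
      obtain ⟨rfl, h2⟩ := Prod.mk.inj hab
      exact h τ s s' h2)
  refine homotopic_of_continuous (fun τ y => G (τ, y)) G.continuous (fun y => ?_) fun y => ?_
  · obtain ⟨s, rfl⟩ := hs y
    exact (hG (0, s)).trans (h0 s)
  · obtain ⟨s, rfl⟩ := hs y
    exact (hG (1, s)).trans (h1 s)

variable {n : ℕ}

/-- The first two coordinates of a point of the cube `I^(2n-1)`. -/
def cubeFst (hn : 2 ≤ n) (u : Fin (2 * n - 1) → I) : Fin 2 → I := fun i => u ⟨i, by omega⟩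

/-- The last `2n-3` coordinates of a point of the cube `I^(2n-1)`. -/
def cubeSnd (hn : 2 ≤ n) (u : Fin (2 * n - 1) → I) : Fin (2 * n - 3) → I :=
  fun j => u ⟨2 + j, by omega⟩

theorem cube_ext (hn : 2 ≤ n) {u v : Fin (2 * n - 1) → I} (h1 : cubeFst hn u = cubeFst hn v)
    (h2 : cubeSnd hn u = cubeSnd hn v) : u = v := by
  funext i
  by_cases hi : i.1 < 2
  · exact congrFun h1 ⟨i, hi⟩
  · have := congrFun h2 ⟨i.1 - 2, by omega⟩
    simp only [cubeSnd] at this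
    convert! this using 2 <;> exact Fin.ext (by simp; omega)

theorem exists_cube (hn : 2 ≤ n) (s : Fin 2 → I) (t : Fin (2 * n - 3) → I) :
    ∃ u, cubeFst hn u = s ∧ cubeSnd hn u = t := by
  refine ⟨fun i => if h : i.1 < 2 then s ⟨i, h⟩ else t ⟨i.1 - 2, by omega⟩, ?_, ?_⟩
  · funext i
    simp only [cubeFst, dif_pos i.2]
  · funext j
    simp only [cubeSnd, dif_neg (show ¬ 2 + j.1 < 2 by omega)]
    exact congrArg t (Fin.ext (by simp))

theorem mem_boundary_cube_iff (hn : 2 ≤ n) (u : Fin (2 * n - 1) → I) :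
    u ∈ Cube.boundary (Fin (2 * n - 1)) ↔
      cubeFst hn u ∈ Cube.boundary (Fin 2) ∨ cubeSnd hn u ∈ Cube.boundary (Fin (2 * n - 3)) := by
  constructor
  · rintro ⟨i, hi⟩
    by_cases h : i.1 < 2
    · exact Or.inl ⟨⟨i, h⟩, hi⟩
    · refine Or.inr ⟨⟨i.1 - 2, by omega⟩, ?_⟩
      have : (⟨2 + (i.1 - 2), by omega⟩ : Fin (2 * n - 1)) = i := Fin.ext (by simp; omega)
      simpa only [cubeSnd, this] using hi
  · rintro (⟨i, hi⟩ | ⟨j, hj⟩)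
    · exact ⟨_, hi⟩
    · exact ⟨_, hj⟩

/-- The map `I^(2n-1) → S^2 × S^(2n-3)` given by two collapse maps. -/
def cubeToProd (hn : 2 ≤ n) (p : C(Fin 2 → I, Sph 2)) (q : C(Fin (2 * n - 3) → I, Sph (2 * n - 3)))
    (u : Fin (2 * n - 1) → I) : SphProd n := (p (cubeFst hn u), q (cubeSnd hn u))

variable {hn : 2 ≤ n} {p : C(Fin 2 → I, Sph 2)} {q : C(Fin (2 * n - 3) → I, Sph (2 * n - 3))}

theorem continuous_cubeToProd : Continuous (cubeToProd hn p q) := by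
  unfold cubeToProd cubeFst cubeSnd
  fun_prop

theorem cubeToProd_surjective (hp : IsCollapse p) (hq : IsCollapse q) :
    Function.Surjective (cubeToProd hn p q) := by
  rintro ⟨x, y⟩
  obtain ⟨s, rfl⟩ := hp.1 x
  obtain ⟨t, rfl⟩ := hq.1 y
  obtain ⟨u, rfl, rfl⟩ := exists_cube hn s t
  exact ⟨u, rfl⟩

theorem cubeToProd_eq (hp : IsCollapse p) (hq : IsCollapse q) {u v : Fin (2 * n - 1) → I}
    (h : cubeToProd hn p q u = cubeToProd hn p q v) :
    u = v ∨ (u ∈ Cube.boundary (Fin (2 * n - 1)) ∧ v ∈ Cube.boundary (Fin (2 * n - 1))) := by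
  obtain ⟨h1, h2⟩ := Prod.mk.inj h
  rw [mem_boundary_cube_iff hn, mem_boundary_cube_iff hn]
  rcases (hp.2 _ _).1 h1 with h1 | h1
  · rcases (hq.2 _ _).1 h2 with h2 | h2
    · exact Or.inl (cube_ext hn h1 h2)
    · exact Or.inr ⟨Or.inr h2.1, Or.inr h2.2⟩
  · exact Or.inr ⟨Or.inl h1.1, Or.inl h1.2⟩

theorem exists_represents (hq : IsCollapse q) (α : GenLoop (Fin (2 * n - 3)) (O (2 * n)) 1) :
    ∃ f, Represents q α f :=
  hq.exists_descend α.1.continuous α.2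

theorem exists_representsTop (hp : IsCollapse p) (hq : IsCollapse q)
    (β : GenLoop (Fin (2 * n - 1)) (O (2 * n)) 1) : ∃ g, RepresentsTop hn p q β g := by
  refine exists_descend (continuous_cubeToProd (hn := hn)) (cubeToProd_surjective hp hq)
    β.1.continuous fun u v huv => ?_
  rcases cubeToProd_eq hp hq huv with rfl | ⟨hu, hv⟩
  · rfl
  · exact (β.2 u hu).trans (β.2 v hv).symm

theorem Represents.homotopic (hq : IsCollapse q) {α α' : GenLoop (Fin (2 * n - 3)) (O (2 * n)) 1}
    {f f' : C(Sph (2 * n - 3), O (2 * n))} (hf : Represents q α f) (hf' : Represents q α' f')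
    (h : GenLoop.Homotopic α α') : f.Homotopic f' := by
  obtain ⟨F⟩ := h
  refine homotopic_of_descend q.continuous hq.1 F.toContinuousMap
    (fun s => (F.apply_zero s).trans (hf s).symm) (fun s => (F.apply_one s).trans (hf' s).symm)
    fun τ s s' hs => ?_
  rcases (hq.2 s s').1 hs with rfl | ⟨h1, h2⟩
  · rfl
  · exact ((F.eq_fst τ h1).trans (α.2 s h1)).trans ((F.eq_fst τ h2).trans (α.2 s' h2)).symm

theorem RepresentsTop.homotopic (hp : IsCollapse p) (hq : IsCollapse q)
    {β β' : GenLoop (Fin (2 * n - 1)) (O (2 * n)) 1} {g g' : C(SphProd n, O (2 * n))}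
    (hg : RepresentsTop hn p q β g) (hg' : RepresentsTop hn p q β' g')
    (h : GenLoop.Homotopic β β') : g.Homotopic g' := by
  obtain ⟨F⟩ := h
  refine homotopic_of_descend (continuous_cubeToProd (hn := hn)) (cubeToProd_surjective hp hq)
    F.toContinuousMap
    (fun s => (F.apply_zero s).trans (hg s).symm) (fun s => (F.apply_one s).trans (hg' s).symm)
    fun τ s s' hs => ?_
  rcases cubeToProd_eq hp hq hs with rfl | ⟨h1, h2⟩
  · rfl
  · exact ((F.eq_fst τ h1).trans (β.2 s h1)).trans ((F.eq_fst τ h2).trans (β.2 s' h2)).symm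

theorem Represents.base (hn : 2 ≤ n) {α : GenLoop (Fin (2 * n - 3)) (O (2 * n)) 1}
    {f : C(Sph (2 * n - 3), O (2 * n))} (hf : Represents q α f) : f (q 0) = 1 :=
  (hf 0).trans (α.2 0 (zero_mem_boundary (by omega)))

/-- Points over the base point of `S^2` come from the boundary of the cube, where `β = 1`. Together
with `RepresentsTop.snd_base`, `g` is trivial on the wedge. -/
theorem RepresentsTop.fst_base (hq : IsCollapse q)
    {β : GenLoop (Fin (2 * n - 1)) (O (2 * n)) 1} {g : C(SphProd n, O (2 * n))}
    (hg : RepresentsTop hn p q β g) (y : Sph (2 * n - 3)) : g (p 0, y) = 1 := by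
  obtain ⟨t, rfl⟩ := hq.1 y
  obtain ⟨u, hu1, hu2⟩ := exists_cube hn 0 t
  have h := hg u
  change g (p (cubeFst hn u), q (cubeSnd hn u)) = β u at h
  rw [hu1, hu2] at h
  refine h.trans (β.2 u ((mem_boundary_cube_iff hn u).2 (Or.inl ?_)))
  rw [hu1]
  exact zero_mem_boundary (by norm_num)

theorem RepresentsTop.snd_base (hp : IsCollapse p)
    {β : GenLoop (Fin (2 * n - 1)) (O (2 * n)) 1} {g : C(SphProd n, O (2 * n))}
    (hg : RepresentsTop hn p q β g) (x : Sph 2) : g (x, q 0) = 1 := by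
  obtain ⟨s, rfl⟩ := hp.1 x
  obtain ⟨u, hu1, hu2⟩ := exists_cube hn s 0
  have h := hg u
  change g (p (cubeFst hn u), q (cubeSnd hn u)) = β u at h
  rw [hu1, hu2] at h
  refine h.trans (β.2 u ((mem_boundary_cube_iff hn u).2 (Or.inr ?_)))
  rw [hu2]
  exact zero_mem_boundary (by omega)

theorem IsCollapse.eq_base {m : ℕ} (hm : 1 ≤ m) {q : C(Fin m → I, Sph m)} (hq : IsCollapse q)
    {t : Fin m → I} (ht : t ∈ Cube.boundary (Fin m)) : q t = q 0 :=
  (hq.2 t 0).2 (Or.inr ⟨ht, zero_mem_boundary hm⟩)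

/-- Maps given by homotopic pairs of loops are homotopic. -/
theorem product_homotopic (hp : IsCollapse p) (hq : IsCollapse q)
    {α α' : GenLoop (Fin (2 * n - 3)) (O (2 * n)) 1} {f f' : C(Sph (2 * n - 3), O (2 * n))}
    {β β' : GenLoop (Fin (2 * n - 1)) (O (2 * n)) 1} {g g' : C(SphProd n, O (2 * n))}
    (hf : Represents q α f) (hf' : Represents q α' f')
    (hg : RepresentsTop hn p q β g) (hg' : RepresentsTop hn p q β' g')
    (hα : GenLoop.Homotopic α α') (hβ : GenLoop.Homotopic β β') :
    (f.comp ContinuousMap.snd * g).Homotopic (f'.comp ContinuousMap.snd * g') :=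
  Homotopic.mul ((hf.homotopic hq hf' hα).comp (ContinuousMap.Homotopic.refl _))
    (hg.homotopic hp hq hg' hβ)

/-- Pairs of loops that give homotopic maps are homotopic. -/
theorem homotopic_of_product_homotopic (hp : IsCollapse p) (hq : IsCollapse q)
    {α α' : GenLoop (Fin (2 * n - 3)) (O (2 * n)) 1} {f f' : C(Sph (2 * n - 3), O (2 * n))}
    {β β' : GenLoop (Fin (2 * n - 1)) (O (2 * n)) 1} {g g' : C(SphProd n, O (2 * n))}
    (hf : Represents q α f) (hf' : Represents q α' f')
    (hg : RepresentsTop hn p q β g) (hg' : RepresentsTop hn p q β' g')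
    (h : (f.comp ContinuousMap.snd * g).Homotopic (f'.comp ContinuousMap.snd * g')) :
    GenLoop.Homotopic α α' ∧ GenLoop.Homotopic β β' := by
  obtain ⟨H⟩ := h
  have H0 : ∀ x y, H (0, (x, y)) = f y * g (x, y) := fun x y => H.apply_zero (x, y)
  have H1 : ∀ x y, H (1, (x, y)) = f' y * g' (x, y) := fun x y => H.apply_one (x, y)
  have fb := hf.base hn
  have fb' := hf'.base hn
  have g1 := hg.fst_base hq
  have g1' := hg'.fst_base hq
  have g2 := hg.snd_base hp
  have g2' := hg'.snd_base hp
  constructor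
  · let K : C(I × (Fin (2 * n - 3) → I), O (2 * n)) :=
      ⟨fun z => (H (z.1, (p 0, q 0)))⁻¹ * H (z.1, (p 0, q z.2)), by fun_prop⟩
    refine ⟨⟨⟨K, fun t => ?_, fun t => ?_⟩, fun τ t ht => ?_⟩⟩
    · change (H (0, (p 0, q 0)))⁻¹ * H (0, (p 0, q t)) = α t
      rw [H0, H0, fb, g1, g1, hf t]
      simp
    · change (H (1, (p 0, q 0)))⁻¹ * H (1, (p 0, q t)) = α' t
      rw [H1, H1, fb', g1', g1', hf' t]
      simp
    · change (H (τ, (p 0, q 0)))⁻¹ * H (τ, (p 0, q t)) = α t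
      rw [hq.eq_base (by omega) ht, inv_mul_cancel]
      exact (α.2 t ht).symm
  · let L : I → Sph 2 → Sph (2 * n - 3) → O (2 * n) := fun τ x y =>
      (H (τ, (p 0, y)))⁻¹ * H (τ, (x, y)) * (H (τ, (x, q 0)))⁻¹ * H (τ, (p 0, q 0))
    have hc1 : Continuous (cubeFst hn) := by unfold cubeFst; fun_prop
    have hc2 : Continuous (cubeSnd hn) := by unfold cubeSnd; fun_prop
    let K : C(I × (Fin (2 * n - 1) → I), O (2 * n)) :=
      ⟨fun z => L z.1 (p (cubeFst hn z.2)) (q (cubeSnd hn z.2)), by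
        simp only [L]
        fun_prop⟩
    refine ⟨⟨⟨K, fun u => ?_, fun u => ?_⟩, fun τ u hu => ?_⟩⟩
    · change L 0 (p (cubeFst hn u)) (q (cubeSnd hn u)) = β u
      simp only [L, H0, g1, g2, fb]
      simp only [inv_one, mul_one, inv_mul_cancel_left]
      exact hg u
    · change L 1 (p (cubeFst hn u)) (q (cubeSnd hn u)) = β' u
      simp only [L, H1, g1', g2', fb']
      simp only [inv_one, mul_one, inv_mul_cancel_left]
      exact hg' u
    · change L τ (p (cubeFst hn u)) (q (cubeSnd hn u)) = β u
      refine Eq.trans ?_ (β.2 u hu).symm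
      rcases (mem_boundary_cube_iff hn u).1 hu with h1 | h1
      · rw [hp.eq_base (by norm_num) h1]
        simp [L]
      · rw [hq.eq_base (by omega) h1]
        simp [L]

/-- Every map to `SO(2n)` is homotopic to one given by a pair of loops. -/
theorem exists_product_homotopic (hn : 2 ≤ n) (hp : IsCollapse p) (hq : IsCollapse q)
    (h : C(SphProd n, O (2 * n))) (hdet : ∀ z, (h z).1.det = 1) :
    ∃ (α : GenLoop (Fin (2 * n - 3)) (O (2 * n)) 1) (f : C(Sph (2 * n - 3), O (2 * n)))
      (β : GenLoop (Fin (2 * n - 1)) (O (2 * n)) 1) (g : C(SphProd n, O (2 * n))),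
      Represents q α f ∧ RepresentsTop hn p q β g ∧
        (f.comp ContinuousMap.snd * g).Homotopic h := by
  let c : O (2 * n) := h (p 0, q 0)
  let h₁ : C(SphProd n, O (2 * n)) := (ContinuousMap.const _ c)⁻¹ * h
  have hh₁ : h₁.Homotopic h := by
    simpa [h₁] using Homotopic.mul (Homotopic.inv (const_homotopic_one (X := SphProd n) c
      (hdet _))) (ContinuousMap.Homotopic.refl h)
  have hb : h₁ (p 0, q 0) = 1 := inv_mul_cancel c
  let γ : C(Sph 2, O (2 * n)) := ⟨fun x => h₁ (x, q 0), by fun_prop⟩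
  have hγ : γ.Homotopic 1 := sphere_two_homotopic_one (by omega) γ fun x => by
    change (h₁ (x, q 0)).1.det = 1
    rw [det_eq_of_homotopic hh₁, hdet]
  let f : C(Sph (2 * n - 3), O (2 * n)) := ⟨fun y => h₁ (p 0, y), by fun_prop⟩
  -- The axis `f` is divided out on the left and `γ` on the right, so that `f g = h₁ γ⁻¹`, which is
  -- homotopic to `h₁` once `γ` is null-homotopic.
  let g : C(SphProd n, O (2 * n)) :=
    (f.comp ContinuousMap.snd)⁻¹ * (h₁ * (γ.comp ContinuousMap.fst)⁻¹)
  have hg : ∀ x y, g (x, y) = (h₁ (p 0, y))⁻¹ * (h₁ (x, y) * (h₁ (x, q 0))⁻¹) := fun x y => rfl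
  let α : GenLoop (Fin (2 * n - 3)) (O (2 * n)) 1 := ⟨f.comp q, fun t ht => by
    change h₁ (p 0, q t) = 1
    rw [hq.eq_base (by omega) ht, hb]⟩
  let β : GenLoop (Fin (2 * n - 1)) (O (2 * n)) 1 :=
    ⟨g.comp ⟨cubeToProd hn p q, continuous_cubeToProd⟩, fun u hu => by
      change g (p (cubeFst hn u), q (cubeSnd hn u)) = 1
      rw [hg]
      rcases (mem_boundary_cube_iff hn u).1 hu with h1 | h1
      · rw [hp.eq_base (by norm_num) h1, hb]
        simp
      · rw [hq.eq_base (by omega) h1, hb]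
        simp⟩
  refine ⟨α, f, β, g, fun t => rfl, fun u => rfl, ?_⟩
  have e : f.comp ContinuousMap.snd * g = h₁ * (γ.comp ContinuousMap.fst)⁻¹ :=
    mul_inv_cancel_left _ _
  rw [e]
  have h2 : (γ.comp (ContinuousMap.fst : C(SphProd n, Sph 2))).Homotopic 1 :=
    hγ.comp (ContinuousMap.Homotopic.refl _)
  have h3 := Homotopic.mul (ContinuousMap.Homotopic.refl h₁) (Homotopic.inv h2)
  rw [inv_one, mul_one] at h3
  exact h3.trans hh₁

/-- The determinant of a family over `S^2 × S^(2n-3)` is constant. -/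
theorem product_det_eq (hn : 2 ≤ n) (h : C(SphProd n, O (2 * n))) (z w : SphProd n) :
    (h z).1.det = (h w).1.det := by
  obtain ⟨p, hp⟩ := exists_isCollapse (m := 2) (by norm_num)
  obtain ⟨q, hq⟩ := exists_isCollapse (m := 2 * n - 3) (by omega)
  obtain ⟨u, rfl⟩ := cubeToProd_surjective (hn := hn) hp hq z
  obtain ⟨v, rfl⟩ := cubeToProd_surjective (hn := hn) hp hq w
  exact O_det_eq (h.continuous.comp continuous_cubeToProd) u v

theorem product_det_one (hp : IsCollapse p) {α : GenLoop (Fin (2 * n - 3)) (O (2 * n)) 1}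
    {f : C(Sph (2 * n - 3), O (2 * n))} {β : GenLoop (Fin (2 * n - 1)) (O (2 * n)) 1}
    {g : C(SphProd n, O (2 * n))} (hf : Represents q α f) (hg : RepresentsTop hn p q β g)
    (z : SphProd n) : ((f.comp ContinuousMap.snd * g : C(SphProd n, O (2 * n))) z).1.det = 1 := by
  rw [product_det_eq hn _ z (p 0, q 0)]
  have : (f.comp ContinuousMap.snd * g : C(SphProd n, O (2 * n))) (p 0, q 0) = 1 := by
    change f (q 0) * g (p 0, q 0) = 1
    rw [hf.base hn, hg.snd_base hp, one_mul]
  rw [this]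
  simp

end ProductMaps

/-! ### Gram–Schmidt retraction of `GL(N)` onto `O(N)` -/

section GramSchmidt

open InnerProductSpace

variable {N : ℕ}

/-- The space of invertible real matrices. -/
abbrev InvMat (N : ℕ) : Type := {A : Matrix (Fin N) (Fin N) ℝ // A.det ≠ 0}

/-- The columns of a matrix, as vectors of Euclidean space. -/
def cols (A : Matrix (Fin N) (Fin N) ℝ) (j : Fin N) : E N := WithLp.toLp 2 fun i => A i j

theorem inner_cols (A B : Matrix (Fin N) (Fin N) ℝ) (i j : Fin N) :
    inner ℝ (cols A i) (cols B j) = (Aᵀ * B) i j := by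
  simp [cols, PiLp.inner_apply, Matrix.mul_apply, mul_comm]

theorem linearIndependent_cols (A : InvMat N) : LinearIndependent ℝ (cols A.1) := by
  have h := Matrix.linearIndependent_cols_of_det_ne_zero A.2
  exact h.map' (WithLp.linearEquiv 2 ℝ (Fin N → ℝ)).symm.toLinearMap (LinearEquiv.ker _)

theorem continuous_cols (n : Fin N) : Continuous fun A : InvMat N => cols A.1 n :=
  (PiLp.continuous_toLp 2 _).comp
    (continuous_pi fun i => (continuous_subtype_val :
      Continuous fun A : InvMat N => A.1).matrix_elem i n)

theorem continuous_gramSchmidt_cols (n : Fin N) :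
    Continuous fun A : InvMat N => gramSchmidt ℝ (cols A.1) n := by
  induction n using WellFoundedLT.induction with
  | _ n ih =>
    have e : (fun A : InvMat N => gramSchmidt ℝ (cols A.1) n) = fun A => cols A.1 n -
        ∑ i ∈ Finset.Iio n, (inner ℝ (gramSchmidt ℝ (cols A.1) i) (cols A.1 n) /
          ‖gramSchmidt ℝ (cols A.1) i‖ ^ 2) • gramSchmidt ℝ (cols A.1) i := by
      funext A
      exact eq_sub_of_add_eq (gramSchmidt_def'' ℝ (cols A.1) n).symm
    rw [e]
    have hn := continuous_cols n
    refine hn.sub (continuous_finsetSum _ fun i hi => ?_)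
    have hi := ih i (Finset.mem_Iio.1 hi)
    exact ((hi.inner hn).div (hi.norm.pow 2) fun A => pow_ne_zero 2 (norm_ne_zero_iff.2
      (gramSchmidt_ne_zero i (linearIndependent_cols A)))).smul hi

/-- The orthogonal matrix obtained from an invertible matrix by the Gram–Schmidt process. -/
def orthonormalize (A : InvMat N) : O N :=
  ⟨Matrix.of fun i j => (gramSchmidtNormed ℝ (cols A.1) j).ofLp i, by
    have h := gramSchmidtNormed_orthonormal (linearIndependent_cols A)
    rw [Matrix.mem_orthogonalGroup_iff']
    ext i j
    have h2 := (orthonormal_iff_ite.1 h) i j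
    rw [Matrix.one_apply, ← h2]
    exact (inner_cols _ _ i j).symm⟩

theorem cols_orthonormalize (A : InvMat N) :
    cols (orthonormalize A).1 = gramSchmidtNormed ℝ (cols A.1) := rfl

theorem continuous_orthonormalize : Continuous (orthonormalize (N := N)) := by
  refine Continuous.subtype_mk (continuous_matrix fun i j => ?_) _
  have h := continuous_gramSchmidt_cols j
  have h2 : Continuous fun A : InvMat N => gramSchmidtNormed ℝ (cols A.1) j :=
    (h.norm.inv₀ fun A => norm_ne_zero_iff.2
      (gramSchmidt_ne_zero j (linearIndependent_cols A))).smul h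
  exact (PiLp.continuous_apply 2 _ i).comp h2

theorem inner_gramSchmidt_self (v : Fin N → E N) (i : Fin N) :
    inner ℝ (gramSchmidt ℝ v i) (v i) = ‖gramSchmidt ℝ v i‖ ^ 2 := by
  conv_lhs => rw [gramSchmidt_def'' ℝ v i]
  rw [inner_add_right, inner_sum, Finset.sum_eq_zero, add_zero, real_inner_self_eq_norm_sq]
  intro k hk
  rw [inner_smul_right, gramSchmidt_orthogonal ℝ v (Finset.mem_Iio.1 hk).ne', mul_zero]

theorem transpose_orthonormalize_mul_eq_zero (A : InvMat N) {i j : Fin N} (h : j < i) :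
    ((orthonormalize A).1ᵀ * A.1) i j = 0 := by
  rw [← inner_cols, cols_orthonormalize, gramSchmidtNormed, inner_smul_left,
    gramSchmidt_inv_triangular ℝ _ h, mul_zero]

theorem transpose_orthonormalize_mul_pos (A : InvMat N) (i : Fin N) :
    0 < ((orthonormalize A).1ᵀ * A.1) i i := by
  have h := norm_pos_iff.2 (gramSchmidt_ne_zero (𝕜 := ℝ) i (linearIndependent_cols A))
  rw [← inner_cols, cols_orthonormalize, gramSchmidtNormed, inner_smul_left,
    inner_gramSchmidt_self]
  simp only [RCLike.ofReal_real_eq_id, id, map_inv₀, conj_trivial]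
  positivity

/-- The inclusion of the orthogonal group into the invertible matrices. -/
def orthInclusion (N : ℕ) : C(O N, InvMat N) where
  toFun A := ⟨A.1, by rcases O_det A with h | h <;> rw [h] <;> norm_num⟩
  continuous_toFun := Continuous.subtype_mk continuous_subtype_val _

/-- The Gram–Schmidt process, as a retraction onto the orthogonal group. -/
def orthRetraction (N : ℕ) : C(InvMat N, O N) := ⟨orthonormalize, continuous_orthonormalize⟩

theorem orthRetraction_orthInclusion (A : O N) : orthRetraction N (orthInclusion N A) = A := by
  have h : ∀ i j, inner ℝ (cols A.1 i) (cols A.1 j) = if i = j then (1 : ℝ) else 0 := fun i j => by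
    rw [inner_cols, O_transpose_mul, Matrix.one_apply]
  have h1 : gramSchmidt ℝ (cols A.1) = cols A.1 :=
    gramSchmidt_of_orthogonal ℝ fun i j hij => (h i j).trans (if_neg hij)
  refine Subtype.ext (Matrix.ext fun i j => ?_)
  change (gramSchmidtNormed ℝ (cols A.1) j).ofLp i = A.1 i j
  have h2 := (orthonormal_iff_ite.2 h).1 j
  rw [gramSchmidtNormed, h1, h2]
  simp [cols]

/-- Let `Q` be the orthonormalised matrix. Multiplying the segment from `A` to `Q` by `Qᵀ` gives the
segment from `QᵀA` to `1`, which is upper triangular with positive diagonal. Hence the segment stays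
invertible, with the determinant sign of `Q`. -/
theorem det_segment_orthonormalize_pos (A : InvMat N) (t : I) :
    0 < (orthonormalize A).1.det *
      ((1 - t.1) • A.1 + t.1 • (orthonormalize A).1).det := by
  have e : (orthonormalize A).1ᵀ * ((1 - t.1) • A.1 + t.1 • (orthonormalize A).1) =
      (1 - t.1) • ((orthonormalize A).1ᵀ * A.1) + t.1 • (1 : Matrix (Fin N) (Fin N) ℝ) := by
    rw [mul_add, Matrix.mul_smul, Matrix.mul_smul, O_transpose_mul]
  rw [← Matrix.det_transpose, ← Matrix.det_mul, e, Matrix.det_of_isUpperTriangular]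
  · refine Finset.prod_pos fun i _ => ?_
    have h := transpose_orthonormalize_mul_pos A i
    simp only [Matrix.add_apply, Matrix.smul_apply, Matrix.one_apply_eq, smul_eq_mul, mul_one]
    have h0 := t.2.1
    rcases t.2.2.lt_or_eq with h1 | h1
    · have := mul_pos (sub_pos.2 h1) h
      linarith
    · rw [h1]
      simp
  · intro i j (hij : j < i)
    rw [Matrix.add_apply, Matrix.smul_apply, Matrix.smul_apply,
      transpose_orthonormalize_mul_eq_zero A hij, Matrix.one_apply_ne hij.ne']
    simp

theorem det_orthRetraction_pos (A : InvMat N) : 0 < (orthRetraction N A).1.det * A.1.det := by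
  have h := det_segment_orthonormalize_pos A 0
  simp only [Set.Icc.coe_zero, sub_zero, one_smul, zero_smul, add_zero] at h
  exact h

/-- A family of invertible matrices is homotopic to a family of orthogonal matrices. -/
theorem homotopic_orthRetraction {X : Type*} [TopologicalSpace X] (M : C(X, InvMat N)) :
    M.Homotopic ((orthInclusion N).comp ((orthRetraction N).comp M)) := by
  have hc : Continuous fun p : I × X => (1 - p.1.1) • (M p.2).1 +
      p.1.1 • (orthonormalize (M p.2)).1 := by
    have h1 : Continuous fun p : I × X => p.1.1 := by fun_prop
    have h2 : Continuous fun p : I × X => (M p.2).1 := by fun_prop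
    have h3 : Continuous fun p : I × X => (orthonormalize (M p.2)).1 :=
      continuous_subtype_val.comp (continuous_orthonormalize.comp (M.continuous.comp continuous_snd))
    exact ((continuous_const.sub h1).smul h2).add (h1.smul h3)
  refine homotopic_of_continuous (fun t x => ⟨(1 - t.1) • (M x).1 +
    t.1 • (orthonormalize (M x)).1,
    right_ne_zero_of_mul (det_segment_orthonormalize_pos (M x) t).ne'⟩)
    (Continuous.subtype_mk hc _) (fun x => ?_) fun x => ?_
  · exact Subtype.ext (by simp)
  · exact Subtype.ext (by simp [orthInclusion, orthRetraction])

theorem homotopic_of_orthInclusion {X : Type*} [TopologicalSpace X] {f g : C(X, O N)}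
    (h : ((orthInclusion N).comp f).Homotopic ((orthInclusion N).comp g)) : f.Homotopic g := by
  have h2 := (ContinuousMap.Homotopic.refl (orthRetraction N)).comp h
  convert h2 using 1 <;> ext1 x <;> exact (orthRetraction_orthInclusion _).symm

end GramSchmidt

/-! ### Trivializations as families of matrices -/

section Transition

variable {N : ℕ}

theorem continuous_inv_invMat :
    Continuous fun A : InvMat N => (A.1⁻¹ : Matrix (Fin N) (Fin N) ℝ) := by
  have e : (fun A : InvMat N => (A.1⁻¹ : Matrix (Fin N) (Fin N) ℝ)) =
      fun A => (A.1.det)⁻¹ • A.1.adjugate := by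
    funext A
    rw [Matrix.inv_def, Ring.inverse_eq_inv']
  rw [e]
  have h : Continuous fun A : InvMat N => A.1 := continuous_subtype_val
  exact (h.matrix_det.inv₀ fun A => A.2).smul h.matrix_adjugate

/-- The linear automorphism of `ℝ^m` given by an invertible matrix. -/
def invMatEquiv (A : InvMat N) : E N ≃ₗ[ℝ] E N :=
  LinearEquiv.ofLinearMap (Matrix.toEuclideanLin A.1) (Matrix.toEuclideanLin A.1⁻¹)
    (by
      ext1 v
      simp only [LinearMap.comp_apply, Matrix.toLpLin_apply, Matrix.mulVec_mulVec,
        Matrix.mul_nonsing_inv _ A.2.isUnit]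
      simp)
    (by
      ext1 v
      simp only [LinearMap.comp_apply, Matrix.toLpLin_apply, Matrix.mulVec_mulVec,
        Matrix.nonsing_inv_mul _ A.2.isUnit]
      simp)

theorem invMatEquiv_apply (A : InvMat N) (v : E N) :
    invMatEquiv A v = WithLp.toLp 2 (A.1 *ᵥ v.ofLp) := rfl

/-- The matrix of a linear automorphism of `ℝ^m`. -/
def equivMat (e : E N ≃ₗ[ℝ] E N) : InvMat N :=
  ⟨Matrix.of fun i j => (e (EuclideanSpace.single j 1)).ofLp i, by
    have h : (Matrix.of fun i j => (e (EuclideanSpace.single j 1)).ofLp i) =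
        LinearMap.toMatrix (EuclideanSpace.basisFun (Fin N) ℝ).toBasis
          (EuclideanSpace.basisFun (Fin N) ℝ).toBasis e.toLinearMap := by
      ext i j
      simp [LinearMap.toMatrix_apply]
    rw [h, LinearMap.det_toMatrix]
    exact e.isUnit_det'.ne_zero⟩

theorem det_equivMat (e : E N ≃ₗ[ℝ] E N) :
    (equivMat e).1.det = LinearMap.det (e : E N →ₗ[ℝ] E N) := by
  rw [← LinearMap.det_toMatrix (EuclideanSpace.basisFun (Fin N) ℝ).toBasis]
  congr 1

theorem invMatEquiv_equivMat (e : E N ≃ₗ[ℝ] E N) : invMatEquiv (equivMat e) = e := by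
  refine LinearEquiv.toLinearMap_injective
    ((EuclideanSpace.basisFun (Fin N) ℝ).toBasis.ext fun j => ?_)
  ext i
  simp [invMatEquiv_apply, equivMat]

theorem equivMat_invMatEquiv (A : InvMat N) : equivMat (invMatEquiv A) = A := by
  refine Subtype.ext (Matrix.ext fun i j => ?_)
  simp [invMatEquiv_apply, equivMat]

variable {n : ℕ}

/-- The trivialization obtained from `τ` by applying in the fibre over `x` the invertible matrix
`M x`. -/
def linTwist (M : C(SphProd n, InvMat (2 * n))) (τ : StableTriv n) : StableTriv n where
  fiberEquiv x := (τ.fiberEquiv x).trans (invMatEquiv (M x))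
  continuous_toFun := by
    have h1 : Continuous fun v : StableTotal n => (M v.1).1 :=
      continuous_subtype_val.comp (M.continuous.comp
        (FiberBundle.continuous_proj ((E 2 × E (2 * n - 3)) × ℝ) (StableTangent n)))
    have h2 := (PiLp.continuous_ofLp 2 (fun _ : Fin (2 * n) => ℝ)).comp τ.continuous_toFun
    exact (PiLp.continuous_toLp 2 (fun _ : Fin (2 * n) => ℝ)).comp (h1.matrix_mulVec h2)
  continuous_invFun := by
    have h1 : Continuous fun w : SphProd n × E (2 * n) => (M w.1).1⁻¹ :=
      continuous_inv_invMat.comp (M.continuous.comp continuous_fst)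
    have h2 : Continuous fun w : SphProd n × E (2 * n) => w.2.ofLp :=
      (PiLp.continuous_ofLp 2 (fun _ : Fin (2 * n) => ℝ)).comp continuous_snd
    have h3 : Continuous fun w : SphProd n × E (2 * n) => (invMatEquiv (M w.1)).symm w.2 :=
      (PiLp.continuous_toLp 2 (fun _ : Fin (2 * n) => ℝ)).comp (h1.matrix_mulVec h2)
    exact τ.continuous_invFun.comp (continuous_fst.prodMk h3)

/-- The `j`th section of the frame given by a trivialization. -/
def frameSection (τ : StableTriv n) (j : Fin (2 * n)) : C(SphProd n, StableTotal n) where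
  toFun x := ⟨x, (τ.fiberEquiv x).symm (EuclideanSpace.single j 1)⟩
  continuous_toFun := τ.continuous_invFun.comp (continuous_id.prodMk continuous_const)

/-- The transition matrices between two trivializations. -/
def transition (τ₀ τ : StableTriv n) : C(SphProd n, InvMat (2 * n)) where
  toFun x := equivMat ((τ₀.fiberEquiv x).symm.trans (τ.fiberEquiv x))
  continuous_toFun := by
    refine Continuous.subtype_mk (continuous_matrix fun i j => ?_) _
    exact (PiLp.continuous_apply 2 _ i).comp
      (τ.toContinuousMap.continuous.comp (frameSection τ₀ j).continuous)

/-- With `transition_linTwist`, this identifies the trivializations with the maps from the base to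
the invertible matrices, once `τ₀` is fixed. -/
theorem linTwist_transition (τ₀ τ : StableTriv n) : linTwist (transition τ₀ τ) τ₀ = τ := by
  refine StableTriv.ext (funext fun x => ?_)
  change (τ₀.fiberEquiv x).trans (invMatEquiv (equivMat _)) = _
  rw [invMatEquiv_equivMat]
  ext1 v
  simp

theorem transition_linTwist (τ : StableTriv n) (M : C(SphProd n, InvMat (2 * n))) :
    transition τ (linTwist M τ) = M := by
  ext1 x
  change equivMat ((τ.fiberEquiv x).symm.trans ((τ.fiberEquiv x).trans (invMatEquiv (M x)))) = M x
  rw [← LinearEquiv.trans_assoc, LinearEquiv.symm_trans_self, LinearEquiv.refl_trans,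
    equivMat_invMatEquiv]

theorem twist_eq_linTwist (f : C(SphProd n, O (2 * n))) (τ : StableTriv n) :
    StableTriv.twist f τ = linTwist ((orthInclusion (2 * n)).comp f) τ := by
  refine StableTriv.ext (funext fun x => LinearEquiv.ext fun v => rfl)

theorem sameOrientation_iff (τ₀ τ : StableTriv n) :
    τ₀.SameOrientation τ ↔ ∀ x, 0 < (transition τ₀ τ x).1.det := by
  refine forall_congr' fun x => ?_
  rw [← det_equivMat]
  rfl

/-- Homotopic families of invertible matrices give trivializations in the same path component. -/
theorem joined_linTwist {M M' : C(SphProd n, InvMat (2 * n))} (h : M.Homotopic M')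
    (τ : StableTriv n) : Joined (linTwist M τ) (linTwist M' τ) := by
  obtain ⟨H⟩ := h
  have hc : Continuous fun t : I => linTwist (H.curry t) τ := by
    refine continuous_induced_rng.2 (ContinuousMap.continuous_of_continuous_uncurry _ ?_)
    have h1 : Continuous fun p : I × StableTotal n => (H (p.1, p.2.1)).1 :=
      continuous_subtype_val.comp (H.continuous.comp (continuous_fst.prodMk
        ((FiberBundle.continuous_proj ((E 2 × E (2 * n - 3)) × ℝ) (StableTangent n)).comp
          continuous_snd)))
    have h2 := ((PiLp.continuous_ofLp 2 (fun _ : Fin (2 * n) => ℝ)).comp τ.continuous_toFun).comp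
      (continuous_snd (X := I))
    exact (PiLp.continuous_toLp 2 (fun _ : Fin (2 * n) => ℝ)).comp (h1.matrix_mulVec h2)
  refine ⟨⟨⟨_, hc⟩, ?_, ?_⟩⟩
  · change linTwist (H.curry 0) τ = _
    congr 1
    ext1 x
    exact H.apply_zero x
  · change linTwist (H.curry 1) τ = _
    congr 1
    ext1 x
    exact H.apply_one x

theorem homotopic_transition {τ τ' : StableTriv n} (h : Joined τ τ') (τ₀ : StableTriv n) :
    (transition τ₀ τ).Homotopic (transition τ₀ τ') := by
  obtain ⟨γ⟩ := h
  have hγ : Continuous fun t => (γ t).toContinuousMap := continuous_induced_dom.comp γ.continuous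
  have hc : Continuous fun p : I × SphProd n => (transition τ₀ (γ p.1) p.2) := by
    refine Continuous.subtype_mk (continuous_matrix fun i j => ?_) _
    -- Precomposing with a frame section of `τ₀` turns the path of maps on the total space into a
    -- path of maps on the base, which uncurries to one column of the transition matrices.
    have h1 : Continuous fun t => (γ t).toContinuousMap.comp (frameSection τ₀ j) :=
      (ContinuousMap.continuous_precomp _).comp hγ
    exact (PiLp.continuous_apply 2 _ i).comp (ContinuousMap.continuous_uncurry_of_continuous ⟨_, h1⟩)
  refine homotopic_of_continuous (fun t x => transition τ₀ (γ t) x) hc (fun x => ?_) fun x => ?_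
  · rw [γ.source]
  · rw [γ.target]

theorem joined_iff (τ₀ τ τ' : StableTriv n) :
    Joined τ τ' ↔ (transition τ₀ τ).Homotopic (transition τ₀ τ') :=
  ⟨fun h => homotopic_transition h τ₀, fun h => by
    simpa only [linTwist_transition] using joined_linTwist h τ₀⟩

/-- A homotopy through invertible matrices between orthogonal families is pushed into `O(2n)` by the
Gram–Schmidt retraction, which fixes its ends. -/
theorem joined_twist_iff (τ : StableTriv n) {f g : C(SphProd n, O (2 * n))} :
    Joined (StableTriv.twist f τ) (StableTriv.twist g τ) ↔ f.Homotopic g := by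
  rw [joined_iff τ, twist_eq_linTwist, twist_eq_linTwist, transition_linTwist, transition_linTwist]
  exact ⟨homotopic_of_orthInclusion, fun h => (ContinuousMap.Homotopic.refl _).comp h⟩

/-- Every trivialization is homotopic to one obtained from `τ₀` by a family of orthogonal
matrices. -/
theorem exists_joined_twist (τ₀ τ : StableTriv n) : ∃ f : C(SphProd n, O (2 * n)),
    Joined (StableTriv.twist f τ₀) τ ∧ ∀ x, 0 < (f x).1.det * (transition τ₀ τ x).1.det := by
  refine ⟨(orthRetraction (2 * n)).comp (transition τ₀ τ), ?_, fun x => det_orthRetraction_pos _⟩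
  rw [joined_iff τ₀, twist_eq_linTwist, transition_linTwist]
  exact (homotopic_orthRetraction _).symm

theorem sameOrientation_twist_iff (τ : StableTriv n) (f : C(SphProd n, O (2 * n))) :
    τ.SameOrientation (StableTriv.twist f τ) ↔ ∀ x, (f x).1.det = 1 := by
  rw [sameOrientation_iff, twist_eq_linTwist, transition_linTwist]
  refine forall_congr' fun x => ?_
  change 0 < (f x).1.det ↔ _
  rcases O_det (f x) with h | h <;> rw [h] <;> norm_num

end Transition

/-! ### Inverses of fibrewise isomorphisms -/

section BundleIso

variable {B F G : Type*} [TopologicalSpace B] [NormedAddCommGroup F] [NormedSpace ℝ F]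
  [FiniteDimensional ℝ F] [NormedAddCommGroup G] [NormedSpace ℝ G]
  (V : B → Type*) [∀ x, AddCommGroup (V x)] [∀ x, Module ℝ (V x)]
  [∀ x, TopologicalSpace (V x)] [TopologicalSpace (TotalSpace F V)] [FiberBundle F V]
  [VectorBundle ℝ F V]

/-- The inverse of a continuous fibrewise isomorphism from a vector bundle of finite rank to a
product bundle is continuous. -/
theorem continuous_symm_of_fiberwise (L : ∀ x, V x ≃ₗ[ℝ] G)
    (hL : Continuous fun v : TotalSpace F V => L v.1 v.2) :
    Continuous fun w : B × G => (⟨w.1, (L w.1).symm w.2⟩ : TotalSpace F V) := by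
  have : CompleteSpace F := FiniteDimensional.complete ℝ F
  rw [continuous_iff_continuousAt]
  rintro ⟨x₀, w₀⟩
  rw [FiberBundle.continuousAt_totalSpace]
  refine ⟨continuousAt_fst, ?_⟩
  set e := trivializationAt F V x₀ with he
  have hx₀ : x₀ ∈ e.baseSet := FiberBundle.mem_baseSet_trivializationAt F V x₀
  let T : ∀ x ∈ e.baseSet, F ≃L[ℝ] G := fun x hx =>
    ((e.continuousLinearEquivAt ℝ x hx).symm.toLinearEquiv.trans (L x)).toContinuousLinearEquiv
  let A : B → F →L[ℝ] G := fun x => ((L x).toLinearMap ∘ₗ e.symmₗ ℝ x).toContinuousLinearMap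
  have hA : ∀ x hx, A x = (T x hx : F →L[ℝ] G) := by
    intro x hx
    ext f
    change L x (e.symmₗ ℝ x f) = L x ((e.continuousLinearEquivAt ℝ x hx).symm f)
    rw [Trivialization.symm_continuousLinearEquivAt_eq]
    rfl
  -- In finite rank, pointwise continuity of the local representative `A` is continuity in operator
  -- norm, and inversion of operators is continuous at an isomorphism.
  have hAc : ContinuousOn A e.baseSet := by
    rw [continuousOn_clm_apply]
    intro f
    have h1 : ContinuousOn (fun x => (⟨x, e.symm x f⟩ : TotalSpace F V)) e.baseSet :=
      e.continuousOn_symm.comp (f := fun x => (x, f)) (by fun_prop) fun x hx => ⟨hx, trivial⟩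
    refine (hL.comp_continuousOn h1).congr fun x hx => ?_
    change L x (e.symmₗ ℝ x f) = L x (e.symm x f)
    rw [Trivialization.symmₗ_apply _ hx]
  have hAx : ContinuousAt A x₀ := hAc.continuousAt (e.open_baseSet.mem_nhds hx₀)
  have hinv : ContinuousAt (fun x => (A x).inverse) x₀ := by
    have h1 : ContinuousAt ContinuousLinearMap.inverse (A x₀) := by
      rw [hA x₀ hx₀]
      exact (contDiffAt_map_inverse (𝕜 := ℝ) (n := 0) (T x₀ hx₀)).continuousAt
    exact ContinuousAt.comp (f := A) h1 hAx
  have h2 : ContinuousAt (fun w : B × G => (A w.1).inverse w.2) (x₀, w₀) :=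
    (ContinuousAt.comp (f := Prod.fst) (x := (x₀, w₀)) hinv continuousAt_fst).clm_apply
      continuousAt_snd
  refine h2.congr ?_
  filter_upwards [(e.open_baseSet.preimage continuous_fst).mem_nhds
    (show (x₀, w₀) ∈ Prod.fst ⁻¹' e.baseSet from hx₀)] with w hw
  change w.1 ∈ e.baseSet at hw
  rw [hA w.1 hw, ContinuousLinearMap.inverse_equiv]
  change e.continuousLinearEquivAt ℝ w.1 hw ((L w.1).symm w.2) = _
  rfl

end BundleIso

/-! ### Existence of a trivialization -/

section StandardTrivialization

theorem fact_finrank (m : ℕ) : Fact (Module.finrank ℝ (E (m + 1)) = m + 1) :=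
  ⟨finrank_euclideanSpace_fin⟩

/-- The differential of the inclusion of the unit sphere. -/
def dcoe {m : ℕ} (x : Sph m) : E m →L[ℝ] E (m + 1) :=
  mvfderiv (𝓡 m) (Subtype.val : Sph m → E (m + 1)) x

theorem dcoe_injective {m : ℕ} (x : Sph m) : Function.Injective (dcoe x) :=
  have := fact_finrank m
  injective_mvfderiv_subtypeVal_sphere x

theorem inner_dcoe {m : ℕ} (x : Sph m) (v : E m) : inner ℝ x.1 (dcoe x v) = 0 := by
  have := fact_finrank m
  have h : dcoe x v ∈ (ℝ ∙ x.1)ᗮ := (range_mvfderiv_subtypeVal x).le ⟨v, rfl⟩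
  exact Submodule.mem_orthogonal_singleton_iff_inner_right.1 h

theorem dcoe_add_smul_eq_zero {m : ℕ} (x : Sph m) {v : E m} {s : ℝ}
    (h : dcoe x v + s • x.1 = 0) : v = 0 ∧ s = 0 := by
  have h1 := congrArg (inner ℝ x.1) h
  rw [inner_add_right, inner_dcoe, inner_smul_right, real_inner_self_eq_norm_sq,
    mem_sphere_zero_iff_norm.1 x.2, inner_zero_right] at h1
  have hs : s = 0 := by simpa using h1
  rw [hs, zero_smul, add_zero] at h
  exact ⟨dcoe_injective x (h.trans (map_zero _).symm), hs⟩

theorem continuous_dcoe {m : ℕ} :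
    Continuous fun v : TangentBundle (𝓡 m) (Sph m) => dcoe v.1 v.2 := by
  have := fact_finrank m
  have h1 : Continuous (tangentMap (𝓡 m) 𝓘(ℝ, E (m + 1)) (Subtype.val : Sph m → E (m + 1))) :=
    (contMDiff_coe_sphere (m := 1)).continuous_tangentMap le_rfl
  have h2 : Continuous fun v : TangentBundle 𝓘(ℝ, E (m + 1)) (E (m + 1)) => v.2 :=
    (contMDiff_snd_tangentBundle_modelSpace (n := 0) (E (m + 1)) 𝓘(ℝ, E (m + 1))).continuous
  exact h2.comp h1

variable {n : ℕ}

/-- The vector with two given first coordinates and given remaining coordinates. -/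
def glue (hn : 2 ≤ n) : E 3 × E (2 * n - 3 + 1) →ₗ[ℝ] E (2 * n) where
  toFun c := WithLp.toLp 2 fun i =>
    if h : i.1 < 2 then c.1 ⟨i, by omega⟩ else c.2 ⟨i.1 - 2, by omega⟩
  map_add' c d := by
    ext i
    by_cases h : i.1 < 2 <;> simp [h, -Order.lt_two_iff, -not_lt]
  map_smul' a c := by
    ext i
    by_cases h : i.1 < 2 <;> simp [h, -Order.lt_two_iff, -not_lt]

theorem glue_eq_zero (hn : 2 ≤ n) {c : E 3} {d : E (2 * n - 3 + 1)} (h : glue hn (c, d) = 0) :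
    c 0 = 0 ∧ c 1 = 0 ∧ d = 0 := by
  have h1 : ∀ i, glue hn (c, d) i = 0 := fun i => by rw [h]; rfl
  refine ⟨h1 ⟨0, by omega⟩, h1 ⟨1, by omega⟩, ?_⟩
  ext i
  have := h1 ⟨i.1 + 2, by omega⟩
  simpa [glue] using this

/-- The fibre of the standard trivialization over `(x, y)`: the isomorphism
`T S^2 ⊕ ℝ ≅ ℝ^3` followed by `T S^(2n-3) ⊕ ℝ ≅ ℝ^(2n-2)`, where the last line is the third
coordinate line of `ℝ^3`. -/
def standardFiber (hn : 2 ≤ n) (z : SphProd n) :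
    (E 2 × E (2 * n - 3)) × ℝ →ₗ[ℝ] E (2 * n) where
  toFun u := glue hn (dcoe z.1 u.1.1 + u.2 • z.1.1,
    dcoe z.2 u.1.2 + (dcoe z.1 u.1.1 + u.2 • z.1.1) 2 • z.2.1)
  map_add' u v := by
    rw [← map_add]
    congr 1
    refine Prod.ext ?_ ?_ <;> simp only [Prod.fst_add, Prod.snd_add, map_add, add_smul,
      Prod.mk_add_mk, PiLp.add_apply, PiLp.smul_apply] <;> abel
  map_smul' a u := by
    rw [← map_smul]
    congr 1
    refine Prod.ext ?_ ?_ <;> simp [mul_smul, smul_add, add_smul]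

/-- `glue` discards the third coordinate of the `ℝ^3` part, but that coordinate survives as the
normal component along the second sphere, so both components vanish in turn. -/
theorem standardFiber_injective (hn : 2 ≤ n) (z : SphProd n) :
    Function.Injective (standardFiber hn z) := by
  rw [injective_iff_map_eq_zero]
  rintro ⟨⟨v, w⟩, s⟩ h
  obtain ⟨h0, h1, h2⟩ := glue_eq_zero hn h
  obtain ⟨hw, h2⟩ := dcoe_add_smul_eq_zero z.2 h2
  have hc : dcoe z.1 v + s • z.1.1 = 0 := by
    ext i
    fin_cases i
    exacts [h0, h1, h2]
  obtain ⟨hv, hs⟩ := dcoe_add_smul_eq_zero z.1 hc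
  simp only at hw hv hs
  rw [hv, hw, hs]
  rfl

/-- The fibre of the standard trivialization over a point, as an isomorphism. -/
def standardFiberEquiv (hn : 2 ≤ n) (z : SphProd n) :
    ((E 2 × E (2 * n - 3)) × ℝ) ≃ₗ[ℝ] E (2 * n) :=
  LinearMap.linearEquivOfInjective (standardFiber hn z) (standardFiber_injective hn z) (by
    simp only [Module.finrank_prod, finrank_euclideanSpace_fin, Module.finrank_self]
    omega)

theorem standardFiberEquiv_apply (hn : 2 ≤ n) (z : SphProd n)
    (u : (E 2 × E (2 * n - 3)) × ℝ) : standardFiberEquiv hn z u = standardFiber hn z u :=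
  LinearMap.linearEquivOfInjective_apply (standardFiber_injective hn z) _ _

/-- The standard trivialization, fibrewise. -/
def standardEquiv (hn : 2 ≤ n) (z : SphProd n) : StableTangent n z ≃ₗ[ℝ] E (2 * n) :=
  standardFiberEquiv hn z

theorem continuous_standardEquiv (hn : 2 ≤ n) :
    Continuous fun v : StableTotal n => standardEquiv hn v.1 v.2 := by
  have h0 := (FiberBundle.Prod.isInducing_diag (E 2 × E (2 * n - 3))
    (fun x : SphProd n => TangentSpace ((𝓡 2).prod (𝓡 (2 * n - 3))) x) ℝ
    (Bundle.Trivial (SphProd n) ℝ)).continuous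
  have h1 : Continuous fun v : StableTotal n =>
      (⟨v.1, v.2.1⟩ : TangentBundle ((𝓡 2).prod (𝓡 (2 * n - 3))) (SphProd n)) :=
    continuous_fst.comp h0
  have hs : Continuous fun v : StableTotal n => (v.2.2 : ℝ) := by
    have h2 := (Bundle.Trivial.homeomorphProd (SphProd n) ℝ).continuous.comp
      (continuous_snd.comp h0)
    have h3 := continuous_snd.comp h2
    exact h3
  have hz : Continuous fun v : StableTotal n => v.1 :=
    FiberBundle.continuous_proj ((E 2 × E (2 * n - 3)) × ℝ) (StableTangent n)
  have e : Continuous (equivTangentBundleProd (𝓡 2) (Sph 2) (𝓡 (2 * n - 3)) (Sph (2 * n - 3))) :=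
    (contMDiff_equivTangentBundleProd (n := 0)).continuous
  have hv := continuous_dcoe.comp (continuous_fst.comp (e.comp h1))
  have hw := continuous_dcoe.comp (continuous_snd.comp (e.comp h1))
  have hc : Continuous fun v : StableTotal n =>
      dcoe v.1.1 (v.2.1 : E 2 × E (2 * n - 3)).1 + (v.2.2 : ℝ) • v.1.1.1 :=
    hv.add (hs.smul (continuous_subtype_val.comp (continuous_fst.comp hz)))
  have hd : Continuous fun v : StableTotal n =>
      dcoe v.1.2 (v.2.1 : E 2 × E (2 * n - 3)).2 +
        (dcoe v.1.1 (v.2.1 : E 2 × E (2 * n - 3)).1 + (v.2.2 : ℝ) • v.1.1.1) 2 • v.1.2.1 :=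
    hw.add (((PiLp.continuous_apply 2 _ 2).comp hc).smul
      (continuous_subtype_val.comp (continuous_snd.comp hz)))
  have h := (LinearMap.continuous_of_finiteDimensional (glue hn)).comp (hc.prodMk hd)
  exact h.congr fun v => (standardFiberEquiv_apply hn v.1 v.2).symm

/-- The standard trivialization of `T(S^2 × S^(2n-3)) ⊕ ℝ`. -/
def standardTriv (hn : 2 ≤ n) : StableTriv n where
  fiberEquiv := standardEquiv hn
  continuous_toFun := continuous_standardEquiv hn
  continuous_invFun :=
    continuous_symm_of_fiberwise (StableTangent n) (standardEquiv hn) (continuous_standardEquiv hn)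

end StandardTrivialization

/-! ### Classification and counting of components -/

section Classification

variable {n : ℕ}

theorem twist_twist (f g : C(SphProd n, O (2 * n))) (τ : StableTriv n) :
    StableTriv.twist f (StableTriv.twist g τ) = StableTriv.twist (f * g) τ := by
  refine StableTriv.ext (funext fun x => LinearEquiv.ext fun v => ?_)
  change orthEquiv (f x) (orthEquiv (g x) (τ.fiberEquiv x v)) =
    orthEquiv (f x * g x) (τ.fiberEquiv x v)
  simp only [orthEquiv_apply, Matrix.mulVec_mulVec, Submonoid.coe_mul]

theorem zerothHomotopy_eq_iff {τ τ' : StableTriv n} :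
    (Quotient.mk _ τ : ZerothHomotopy (StableTriv n)) = Quotient.mk _ τ' ↔ Joined τ τ' :=
  Quotient.eq

/-- Trivializations inducing the orientation of `τ₀` are classified by pairs of homotopy classes. -/
theorem exists_classification (hn : 2 ≤ n) {p : C(Fin 2 → I, Sph 2)}
    {q : C(Fin (2 * n - 3) → I, Sph (2 * n - 3))} (hp : IsCollapse p) (hq : IsCollapse q)
    (τ₀ : StableTriv n) :
    ∃ Φ : π_ (2 * n - 3) (O (2 * n)) 1 × π_ (2 * n - 1) (O (2 * n)) 1 →
        ZerothHomotopy (StableTriv n),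
      (∀ (α : GenLoop (Fin (2 * n - 3)) (O (2 * n)) 1)
          (β : GenLoop (Fin (2 * n - 1)) (O (2 * n)) 1),
        ∃ (f : C(Sph (2 * n - 3), O (2 * n))) (g : C(SphProd n, O (2 * n))),
          Represents q α f ∧ RepresentsTop hn p q β g ∧
          Φ (Quotient.mk _ α, Quotient.mk _ β) =
            Quotient.mk _ (StableTriv.twist (f.comp ContinuousMap.snd * g) τ₀)) ∧
      Function.Injective Φ ∧
      Set.range Φ = {c | ∃ τ : StableTriv n, τ₀.SameOrientation τ ∧ c = Quotient.mk _ τ} := by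
  choose f hf using fun α : GenLoop (Fin (2 * n - 3)) (O (2 * n)) 1 => exists_represents hq α
  choose g hg using fun β : GenLoop (Fin (2 * n - 1)) (O (2 * n)) 1 =>
    exists_representsTop (hn := hn) hp hq β
  let Φ : π_ (2 * n - 3) (O (2 * n)) 1 × π_ (2 * n - 1) (O (2 * n)) 1 →
      ZerothHomotopy (StableTriv n) := fun c => Quotient.liftOn₂ c.1 c.2
    (fun α β => Quotient.mk _ (StableTriv.twist ((f α).comp ContinuousMap.snd * g β) τ₀))
    fun α β α' β' hα hβ => zerothHomotopy_eq_iff.2 ((joined_twist_iff τ₀).2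
      (product_homotopic hp hq (hf α) (hf α') (hg β) (hg β') hα hβ))
  have hΦ : ∀ α β, Φ (Quotient.mk _ α, Quotient.mk _ β) =
      Quotient.mk _ (StableTriv.twist ((f α).comp ContinuousMap.snd * g β) τ₀) := fun _ _ => rfl
  refine ⟨Φ, fun α β => ⟨f α, g β, hf α, hg β, rfl⟩, ?_, ?_⟩
  · rintro ⟨⟨α⟩, ⟨β⟩⟩ ⟨⟨α'⟩, ⟨β'⟩⟩ h
    obtain ⟨h1, h2⟩ := homotopic_of_product_homotopic hp hq (hf α) (hf α') (hg β) (hg β')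
      ((joined_twist_iff τ₀).1 (zerothHomotopy_eq_iff.1 h))
    exact Prod.ext (Quotient.sound h1) (Quotient.sound h2)
  · ext c
    constructor
    · rintro ⟨⟨⟨α⟩, ⟨β⟩⟩, rfl⟩
      exact ⟨_, (sameOrientation_twist_iff τ₀ _).2 (product_det_one hp (hf α) (hg β)), hΦ α β⟩
    · rintro ⟨τ, hτ, rfl⟩
      obtain ⟨h, hj, hdet⟩ := exists_joined_twist τ₀ τ
      -- Gram–Schmidt preserves the sign of the determinant, so equality of orientations puts `h` in
      -- `SO(2n)`.
      have hd : ∀ x, (h x).1.det = 1 := fun x => (O_det (h x)).resolve_right fun h1 => by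
        have h2 := hdet x
        have h3 := (sameOrientation_iff τ₀ τ).1 hτ x
        rw [h1] at h2
        linarith
      obtain ⟨α, f', β, g', hf', hg', hh⟩ := exists_product_homotopic hn hp hq h hd
      refine ⟨(Quotient.mk _ α, Quotient.mk _ β), (hΦ α β).trans (zerothHomotopy_eq_iff.2 ?_)⟩
      refine Joined.trans ((joined_twist_iff τ₀).2 (ContinuousMap.Homotopic.trans ?_ hh)) hj
      exact product_homotopic hp hq (hf α) hf' (hg β) hg' (GenLoop.Homotopic.refl α)
        (GenLoop.Homotopic.refl β)

/-- An orthogonal involution of determinant `-1`. -/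
theorem exists_O_det_neg_one {m : ℕ} (hm : 1 ≤ m) : ∃ A : O m, A * A = 1 ∧ A.1.det = -1 := by
  let i₀ : Fin m := ⟨0, hm⟩
  let d : Fin m → ℝ := Function.update 1 i₀ (-1)
  have hd : ∀ i, d i * d i = 1 := fun i => by
    by_cases h : i = i₀
    · rw [h]
      simp [d]
    · simp [d, h]
  have hD : Matrix.diagonal d * Matrix.diagonal d = 1 := by
    rw [Matrix.diagonal_mul_diagonal, ← Matrix.diagonal_one]
    exact congrArg _ (funext hd)
  refine ⟨⟨Matrix.diagonal d, ?_⟩, Subtype.ext hD, ?_⟩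
  · rw [Matrix.mem_orthogonalGroup_iff, Matrix.diagonal_transpose]
    exact hD
  · change (Matrix.diagonal d).det = -1
    rw [Matrix.det_diagonal, Finset.prod_update_of_mem (Finset.mem_univ _)]
    simp

/-- Every trivialization is homotopic to one with the orientation of `τ₀`, or to one with the
orientation of its composite with a reflection. -/
theorem exists_sameOrientation (hn : 2 ≤ n) (τ₀ : StableTriv n) {A : O (2 * n)} (hA : A * A = 1)
    (hdet : A.1.det = -1) (τ : StableTriv n) :
    ∃ τ' : StableTriv n, Joined τ' τ ∧ (τ₀.SameOrientation τ' ∨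
      (StableTriv.twist (ContinuousMap.const _ A) τ₀).SameOrientation τ') := by
  obtain ⟨f, hj, -⟩ := exists_joined_twist τ₀ τ
  refine ⟨_, hj, ?_⟩
  obtain ⟨p, -⟩ := exists_isCollapse (m := 2) (by norm_num)
  obtain ⟨q, -⟩ := exists_isCollapse (m := 2 * n - 3) (by omega)
  rcases O_det (f (p 0, q 0)) with h | h
  · exact Or.inl ((sameOrientation_twist_iff _ _).2 fun x =>
      (product_det_eq hn f x (p 0, q 0)).trans h)
  · right
    -- Since `A² = 1`, twisting by `f` is twisting by `f A` after the reflection `A`, and `f A` has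
    -- determinant `1`.
    have e : StableTriv.twist f τ₀ = StableTriv.twist (f * ContinuousMap.const _ A)
        (StableTriv.twist (ContinuousMap.const _ A) τ₀) := by
      rw [twist_twist, mul_assoc]
      have : (ContinuousMap.const (SphProd n) A * ContinuousMap.const (SphProd n) A) = 1 :=
        ContinuousMap.ext fun _ => hA
      rw [this, mul_one]
    rw [e, sameOrientation_twist_iff]
    intro x
    change (f x * A).1.det = 1
    rw [Submonoid.coe_mul, Matrix.det_mul, hdet, product_det_eq hn f x (p 0, q 0), h]
    norm_num

/-- Two images of `S` cover `Z`, so `|Z| ≤ |S| + |S| = |S|` because `S` is infinite; injectivity of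
`Φ` gives the other inequality. -/
theorem nonempty_equiv_of_two_injections {S Z : Type} [Infinite S] {Φ Ψ : S → Z}
    (hΦ : Function.Injective Φ) (h : ∀ z, z ∈ Set.range Φ ∨ z ∈ Set.range Ψ) :
    Nonempty (Z ≃ S) := by
  rw [← Cardinal.eq]
  refine le_antisymm ?_ (Cardinal.mk_le_of_injective hΦ)
  have h1 : Function.Surjective (Sum.elim Φ Ψ) := fun z => by
    rcases h z with ⟨s, rfl⟩ | ⟨s, rfl⟩
    exacts [⟨Sum.inl s, rfl⟩, ⟨Sum.inr s, rfl⟩]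
  refine (Cardinal.mk_le_of_surjective h1).trans ?_
  rw [Cardinal.mk_sum, Cardinal.lift_id, Cardinal.add_eq_self (Cardinal.aleph0_le_mk S)]

/-- Homotopy classes of trivializations correspond to pairs of homotopy classes. -/
theorem nonempty_equiv_zerothHomotopy (hn : 2 ≤ n) :
    Nonempty (ZerothHomotopy (StableTriv n) ≃
      π_ (2 * n - 3) (O (2 * n)) 1 × π_ (2 * n - 1) (O (2 * n)) 1) := by
  obtain ⟨p, hp⟩ := exists_isCollapse (m := 2) (by norm_num)
  obtain ⟨q, hq⟩ := exists_isCollapse (m := 2 * n - 3) (by omega)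
  obtain ⟨A, hA, hdet⟩ := exists_O_det_neg_one (m := 2 * n) (by omega)
  obtain ⟨Φ, -, hΦ, hrange⟩ := exists_classification hn hp hq (standardTriv hn)
  obtain ⟨Ψ, -, -, hrange'⟩ := exists_classification hn hp hq
    (StableTriv.twist (ContinuousMap.const _ A) (standardTriv hn))
  -- The sphere dimension `2n - 1 = 2(n - 1) + 1` is odd and at least `3`. With the other factor
  -- nonempty, the product is infinite.
  have : Infinite (π_ (2 * n - 1) (O (2 * n)) 1) :=
    infinite_homotopyGroup_orthogonal (by omega) ⟨n - 1, by omega⟩ (by omega)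
  have : Nonempty (π_ (2 * n - 3) (O (2 * n)) 1) := ⟨Quotient.mk _ GenLoop.const⟩
  refine nonempty_equiv_of_two_injections (Ψ := Ψ) hΦ ?_
  rintro ⟨τ⟩
  obtain ⟨τ', hj, h⟩ := exists_sameOrientation hn (standardTriv hn) hA hdet τ
  rw [hrange, hrange']
  exact h.imp (fun h => ⟨τ', h, zerothHomotopy_eq_iff.2 hj.symm⟩)
    fun h => ⟨τ', h, zerothHomotopy_eq_iff.2 hj.symm⟩

end Classification

end SphereFraming

end

theorem mainTheorem11 (n : ℕ) (hn : 2 ≤ n) :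
    Nonempty (ZerothHomotopy (SphereFraming.StableTriv n) ≃
      π_ (2 * n - 3) (SphereFraming.O (2 * n)) 1 × π_ (2 * n - 1) (SphereFraming.O (2 * n)) 1) ∧
    ∀ (p : C(Fin 2 → I, SphereFraming.Sph 2))
      (q : C(Fin (2 * n - 3) → I, SphereFraming.Sph (2 * n - 3))),
      SphereFraming.IsCollapse p → SphereFraming.IsCollapse q →
      ∀ τ₀ : SphereFraming.StableTriv n,
        ∃ Φ : π_ (2 * n - 3) (SphereFraming.O (2 * n)) 1 ×
            π_ (2 * n - 1) (SphereFraming.O (2 * n)) 1 →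
            ZerothHomotopy (SphereFraming.StableTriv n),
          (∀ (α : GenLoop (Fin (2 * n - 3)) (SphereFraming.O (2 * n)) 1)
              (β : GenLoop (Fin (2 * n - 1)) (SphereFraming.O (2 * n)) 1),
            ∃ (f : C(SphereFraming.Sph (2 * n - 3), SphereFraming.O (2 * n)))
              (g : C(SphereFraming.SphProd n, SphereFraming.O (2 * n))),
              SphereFraming.Represents q α f ∧ SphereFraming.RepresentsTop hn p q β g ∧
              Φ (Quotient.mk _ α, Quotient.mk _ β) =
                Quotient.mk _ (SphereFraming.StableTriv.twist
                  (f.comp ContinuousMap.snd * g) τ₀)) ∧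
          Function.Injective Φ ∧
          Set.range Φ =
            {c | ∃ τ : SphereFraming.StableTriv n, τ₀.SameOrientation τ ∧ c = Quotient.mk _ τ} :=
  ⟨SphereFraming.nonempty_equiv_zerothHomotopy hn, fun _ _ hp hq τ₀ =>
    SphereFraming.exists_classification hn hp hq τ₀⟩
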